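/- Let $(M,g)$ be a smooth $\hat n$-dimensional manifold, $\hat n\ge 3$, with a smooth semi-Riemannian metric of arbitrary signature. Suppose $M$ is foliated by connected, injectively immersed hypersurfaces (leaves) with non-degenerate first fundamental form, whose tangent spaces are the orthogonal complement of a smooth unit vector field $u$, $g(u,u)=\epsilon\in\{-1,1\}$. **Notation.** $\nabla$ is the Levi-Civita connection of $g$ and $R_{\alpha\beta\mu\nu}$ its Riemann tensor, with $R^\alpha{}_{\beta\mu\nu}X^\beta=\nabla_\mu\nabla_\nu X^\alpha-\nabla_\nu\nabla_\mu X^\alpha$. Let $\gamma_{\alpha\beta}=g_{\alpha\beta}-\epsilon u_\alpha u_\beta$ (so $\gamma^\alpha_\beta$ is the projector orthogonal to $u$), $a=\nabla_uu$, $K_{\alpha\beta}=\gamma^\mu_\alpha\gamma^\nu_\beta\nabla_\mu u_\nu$, $H=\mathrm{tr}_\gamma K$, $\sigma=K-\frac{H}{\hat n-1}\gamma$, $\sigma^{(2)}_{\beta\nu}=\sigma_{\beta\rho}\sigma^\rho{}_\nu$. $D$ is the covariant derivative $\nabla$ in tangential directions followed by projection of all indices with $\gamma$, and $\pounds_u$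 is the Lie derivative along $u$. $\mathrm{Riem}_\Sigma=R^\Sigma_{\alpha\beta\mu\nu}$, $\mathrm{Ric}_\Sigma$, $\mathrm{Scal}_\Sigma$, $\mathrm{Weyl}_\Sigma$ are the tensors on $M$, completely orthogonal to $u$, associated with the Riemann, Ricci, scalar and (for $\hat n\ge4$) Weyl curvature of the induced metrics of the leaves, and $(A\owedge B)_{\alpha\beta\mu\nu}=A_{\alpha\mu}B_{\beta\nu}-A_{\alpha\nu}B_{\beta\mu}-A_{\beta\mu}B_{\alpha\nu}+A_{\beta\nu}B_{\alpha\mu}$. For a $(0,4)$-tensor $T$ with the algebraic symmetries of a Riemann tensor put $T^\parallel_{\alpha\beta\mu\nu}=\gamma^\rho_\alpha\gamma^\sigma_\beta\gamma^\kappa_\mu\gamma^\delta_\nu T_{\rho\sigma\kappa\delta}$, $T^{\perp\parallel}_{\beta\mu\nu}=u^\alpha\gamma^\kappa_\mu\gamma^\sigma_\nu T_{\alpha\beta\kappa\sigma}$, $T^\perp_{\beta\nu}=u^\alpha u^\mu T_{\alpha\beta\mu\nu}$. Let $\mathrm{Ric}(T^\parallel)$ be the trace of $T^\parallel$ in its first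 and third indices, $\mathrm{Scal}(T^\parallel)$ the trace of $\mathrm{Ric}(T^\parallel)$, and (for $\hat n\ge4$) $$\mathrm{Weyl}_u(T^\parallel)=T^\parallel-\tfrac{1}{\hat n-3}\Big(\mathrm{Ric}(T^\parallel)-\tfrac{\mathrm{Scal}(T^\parallel)}{2(\hat n-2)}\gamma\Big)\owedge\gamma .$$ Let $T^\perp_{\rm tr}=\mathrm{tr}_\gamma T^\perp$, $(T^{\perp\parallel}_{\rm tr})_\mu=\gamma^{\alpha\beta}T^{\perp\parallel}_{\alpha\beta\mu}$. A hat denotes the trace-free part: $\widehat S=S-\frac{\mathrm{tr}_\gamma S}{\hat n-1}\gamma$ for symmetric 2-tensors, and $\widehat{T^{\perp\parallel}}_{\alpha\beta\mu}=T^{\perp\parallel}_{\alpha\beta\mu}+\frac1{\hat n-2}\big(-\gamma_{\alpha\beta}(T^{\perp\parallel}_{\rm tr})_\mu+\gamma_{\alpha\mu}(T^{\perp\parallel}_{\rm tr})_\beta\big)$. Consider the identities - (Gauss) $T^\parallel_{\alpha\beta\mu\nu}=R^\Sigma_{\alpha\beta\mu\nu}-\epsilon K_{\alpha\mu}K_{\beta\nu}+\epsilon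 K_{\alpha\nu}K_{\beta\mu}$, - (Codazzi) $T^{\perp\parallel}_{\beta\mu\nu}=D_\nu K_{\mu\beta}-D_\mu K_{\nu\beta}$, - (Ricci) $T^\perp_{\beta\nu}=D_\beta a_\nu-\epsilon a_\beta a_\nu+K_{\beta\gamma}K_\nu{}^\gamma-\pounds_uK_{\beta\nu}$. **Claim.** At each point of $M$ and for each such tensor $T$ at that point, the following equivalences hold. (1) If $\hat n\ge4$, (Gauss) is equivalent to the system $$\mathrm{Scal}(T^\parallel)=\mathrm{Scal}_\Sigma+\epsilon\,\mathrm{tr}_\gamma\sigma^{(2)}-\tfrac{\epsilon(\hat n-2)}{\hat n-1}H^2,$$ $$\widehat{\mathrm{Ric}(T^\parallel)}=\widehat{\mathrm{Ric}_\Sigma}+\epsilon\Big(\sigma^{(2)}-\tfrac{\mathrm{tr}_\gamma\sigma^{(2)}}{\hat n-1}\gamma\Big)-\tfrac{\epsilon(\hat n-3)}{\hat n-1}H\sigma,$$ $$\mathrm{Weyl}_u(T^\parallel)=\mathrm{Weyl}_\Sigma-\tfrac\epsilon2\,\sigma\owedge\sigma-\tfrac{\epsilon}{\hat n-3}\,\sigma^{(2)}\owedge\gamma+\tfrac{\epsilon\,\mathrm{tr}_\gamma\sigma^{(2)}}{2(\hat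 n-2)(\hat n-3)}\,\gamma\owedge\gamma.$$ (2) (Codazzi) is equivalent to the system $$\widehat{T^{\perp\parallel}}_{\beta\mu\nu}=D_\nu\sigma_{\mu\beta}-D_\mu\sigma_{\nu\beta}+\tfrac1{\hat n-2}\big(\gamma_{\beta\mu}D_\delta\sigma^\delta{}_\nu-\gamma_{\beta\nu}D_\delta\sigma^\delta{}_\mu\big),\qquad (T^{\perp\parallel}_{\rm tr})_\nu=\tfrac{\hat n-2}{\hat n-1}D_\nu H-D_\delta\sigma^\delta{}_\nu.$$ (3) (Ricci) is equivalent to the system $$T^\perp_{\rm tr}=D_\mu a^\mu-\epsilon a_\mu a^\mu-\sigma_{\mu\nu}\sigma^{\mu\nu}-\tfrac{H^2}{\hat n-1}-u(H),$$ $$\widehat{T^\perp}_{\beta\nu}=D_\beta a_\nu-\epsilon a_\beta a_\nu+\tfrac1{\hat n-1}\big(-D_\mu a^\mu+\epsilon a_\mu a^\mu+\sigma_{\rho\sigma}\sigma^{\rho\sigma}\big)\gamma_{\beta\nu}+\sigma_{\beta\gamma}\sigma_\nu{}^\gamma-\pounds_u\sigma_{\beta\nu}.$$ Moreover, for $T=R$,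 the Riemann tensor of $g$, the identities (Gauss), (Codazzi), (Ricci) hold everywhere on $M$; hence so do the systems in (2) and (3) and, when $\hat n\ge4$, the system in (1). -/

import Mathlib

open scoped Manifold ContDiff

noncomputable section

namespace FoliationGCR

/-- The coordinate space of a `d`-dimensional manifold. -/
abbrev Coord (d : ℕ) : Type := EuclideanSpace ℝ (Fin d)

/-- Components of covariant tensors at a point, of order one to four. -/
abbrev Tensor1 (d : ℕ) : Type := Fin d → ℝ

abbrev Tensor2 (d : ℕ) : Type := Fin d → Fin d → ℝ

abbrev Tensor3 (d : ℕ) : Type := Fin d → Fin d → Fin d → ℝ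

abbrev Tensor4 (d : ℕ) : Type := Fin d → Fin d → Fin d → Fin d → ℝ

/-! ### Algebra at a point

The argument `gi` is always the matrix of a contravariant (inverse) metric, used for traces, and
`h` is a covariant metric, or the projected metric `γ` of a hyperplane. -/

/-- `T` has the algebraic symmetries of a Riemann tensor. -/
def IsRiemannType {d : ℕ} (T : Tensor4 d) : Prop :=
  (∀ a b c e, T a b c e = -T a b e c) ∧
  (∀ a b c e, T a b c e = -T b a c e) ∧
  (∀ a b c e, T a b c e = T c e a b) ∧
  (∀ a b c e, T a b c e + T a c e b + T a e b c = 0)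

/-- The trace of a covariant 2-tensor. -/
def tr {d : ℕ} (gi : Tensor2 d) (S : Tensor2 d) : ℝ :=
  ∑ a, ∑ b, gi a b * S a b

/-- `Ric(T)_{bν} = T^a_{baν}`: the trace in the first and third indices. -/
def ric {d : ℕ} (gi : Tensor2 d) (T : Tensor4 d) : Tensor2 d := fun b v =>
  ∑ a, ∑ c, gi a c * T a b c v

/-- `Scal(T)`: the trace of `Ric(T)`. -/
def scal {d : ℕ} (gi : Tensor2 d) (T : Tensor4 d) : ℝ := tr gi (ric gi T)

/-- The Kulkarni–Nomizu product. -/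
def kn {d : ℕ} (A B : Tensor2 d) : Tensor4 d := fun a b m v =>
  A a m * B b v - A a v * B b m - A b m * B a v + A b v * B a m

/-- The Schouten map on a space of dimension `k` with metric `h`:
`(k - 2)⁻¹ (Ric(T) - Scal(T) / (2 (k - 1)) h)`. -/
def sch {d : ℕ} (k : ℝ) (gi h : Tensor2 d) (T : Tensor4 d) : Tensor2 d := fun a b =>
  1 / (k - 2) * (ric gi T a b - scal gi T / (2 * (k - 1)) * h a b)

/-- The Weyl map on a space of dimension `k` with metric `h`: `T - Sch(T) ∧ h`.
It is used with `k` the dimension of the leaves, both for tensors on a leaf (`h` the induced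
metric) and for tensors on the ambient space orthogonal to the normal `u` (`h = γ`); in the
second case it is the map `Weyl_u`. -/
def weyl {d : ℕ} (k : ℝ) (gi h : Tensor2 d) (T : Tensor4 d) : Tensor4 d := fun a b m v =>
  T a b m v - kn (sch k gi h T) h a b m v

/-- The trace-free part of a 2-tensor on a space of dimension `k` with metric `h`,
when its trace is `t`. -/
def traceFree {d : ℕ} (k : ℝ) (h : Tensor2 d) (t : ℝ) (S : Tensor2 d) : Tensor2 d := fun a b =>
  S a b - t / k * h a b

/-! ### Semi-Riemannian geometry in coordinates

`G` is the matrix of components of a metric, as a function of the coordinates. -/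

/-- The partial derivative `∂_i f`. -/
def pd {d : ℕ} (i : Fin d) (f : Coord d → ℝ) (x : Coord d) : ℝ :=
  fderiv ℝ f x (EuclideanSpace.single i 1)

/-- The contravariant metric. -/
def invMetric {d : ℕ} (G : Coord d → Tensor2 d) (x : Coord d) : Tensor2 d := fun i j =>
  (Matrix.of (G x))⁻¹ i j

/-- The Christoffel symbols `Γ^k_{ij}` of the Levi-Civita connection. -/
def christoffel {d : ℕ} (G : Coord d → Tensor2 d) (x : Coord d) (k i j : Fin d) : ℝ :=
  1 / 2 * ∑ l, invMetric G x k l *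
    (pd i (fun y => G y j l) x + pd j (fun y => G y i l) x - pd l (fun y => G y i j) x)

/-- `R^a_{bmv}`, with `R^a_{bmv} X^b = ∇_m ∇_v X^a - ∇_v ∇_m X^a`. -/
def riemUp {d : ℕ} (G : Coord d → Tensor2 d) (x : Coord d) (a b m v : Fin d) : ℝ :=
  pd m (fun y => christoffel G y a v b) x - pd v (fun y => christoffel G y a m b) x
    + ∑ l, (christoffel G x a m l * christoffel G x l v b
        - christoffel G x a v l * christoffel G x l m b)

/-- The Riemann tensor `R_{abmv}`. -/
def riem {d : ℕ} (G : Coord d → Tensor2 d) (x : Coord d) : Tensor4 d := fun a b m v =>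
  ∑ k, G x a k * riemUp G x k b m v

/-- `∇_i w_j` for a one-form `w`. -/
def cov1 {d : ℕ} (G : Coord d → Tensor2 d) (w : Coord d → Tensor1 d) (x : Coord d) :
    Tensor2 d := fun i j =>
  pd i (fun y => w y j) x - ∑ k, christoffel G x k i j * w x k

/-- `∇_i S_{jk}` for a covariant 2-tensor `S`. -/
def cov2 {d : ℕ} (G : Coord d → Tensor2 d) (S : Coord d → Tensor2 d) (x : Coord d) :
    Tensor3 d := fun i j k =>
  pd i (fun y => S y j k) x - ∑ l, christoffel G x l i j * S x l k
    - ∑ l, christoffel G x l i k * S x j l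

/-! ### The geometry of a unit normal field in coordinates -/

/-- Coordinate expressions of a metric `g_{ij}` and of a one-form `u_i`, which is the metric dual
of a unit vector field of square norm `ε`. -/
structure LocalData (d : ℕ) where
  g : Coord d → Tensor2 d
  u : Coord d → Tensor1 d
  ε : ℝ

namespace LocalData

variable {d : ℕ} (L : LocalData d)

/-- `g^{ij}`. -/
def gi (x : Coord d) : Tensor2 d := invMetric L.g x

/-- `u^i`. -/
def uUp (x : Coord d) : Tensor1 d := fun i => ∑ j, L.gi x i j * L.u x j

/-- The projector `γ^i_j = δ^i_j - ε u^i u_j`. -/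
def proj (x : Coord d) (i j : Fin d) : ℝ :=
  (if i = j then 1 else 0) - L.ε * L.uUp x i * L.u x j

/-- `γ_{ij} = g_{ij} - ε u_i u_j`. -/
def gam (x : Coord d) : Tensor2 d := fun i j => L.g x i j - L.ε * L.u x i * L.u x j

/-- `γ^{ij} = g^{ij} - ε u^i u^j`. -/
def gamUp (x : Coord d) : Tensor2 d := fun i j => L.gi x i j - L.ε * L.uUp x i * L.uUp x j

/-- The acceleration `a_j = u^i ∇_i u_j`. -/
def acc (x : Coord d) : Tensor1 d := fun j => ∑ i, L.uUp x i * cov1 L.g L.u x i j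

/-- The second fundamental form `K_{ab} = γ_a^m γ_b^v ∇_m u_v`. -/
def K (x : Coord d) : Tensor2 d := fun a b =>
  ∑ m, ∑ v, L.proj x m a * L.proj x v b * cov1 L.g L.u x m v

/-- The expansion `H = tr_γ K`. -/
def H (x : Coord d) : ℝ := tr (L.gamUp x) (L.K x)

/-- The shear `σ = K - H / (n - 1) γ`, where `n` is the dimension of the ambient space. -/
def shear (x : Coord d) : Tensor2 d := fun a b =>
  L.K x a b - L.H x / ((d : ℝ) - 1) * L.gam x a b

/-- The square `S_{bρ} S^ρ_v` of a 2-tensor. -/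
def square (x : Coord d) (S : Tensor2 d) : Tensor2 d := fun b v =>
  ∑ r, ∑ s, L.gi x r s * S b r * S s v

/-- `D_v f = γ_v^m ∂_m f`. -/
def D0 (f : Coord d → ℝ) (x : Coord d) : Tensor1 d := fun v =>
  ∑ m, L.proj x m v * pd m f x

/-- `D_b w_v = γ_b^m γ_v^r ∇_m w_r`. -/
def D1 (w : Coord d → Tensor1 d) (x : Coord d) : Tensor2 d := fun b v =>
  ∑ m, ∑ r, L.proj x m b * L.proj x r v * cov1 L.g w x m r

/-- `D_c S_{ab} = γ_c^k γ_a^m γ_b^v ∇_k S_{mv}`. -/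
def D2 (S : Coord d → Tensor2 d) (x : Coord d) : Tensor3 d := fun c a b =>
  ∑ k, ∑ m, ∑ v, L.proj x k c * L.proj x m a * L.proj x v b * cov2 L.g S x k m v

/-- The divergence `D_c w^c`. -/
def div1 (w : Coord d → Tensor1 d) (x : Coord d) : ℝ := tr (L.gamUp x) (L.D1 w x)

/-- The divergence `D_c S^c_v`. -/
def div2 (S : Coord d → Tensor2 d) (x : Coord d) : Tensor1 d := fun v =>
  ∑ c, ∑ k, L.gamUp x c k * L.D2 S x c k v

/-- `u(f)`. -/
def uDeriv (f : Coord d → ℝ) (x : Coord d) : ℝ := ∑ i, L.uUp x i * pd i f x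

/-- The Lie derivative of a covariant 2-tensor along `u`. -/
def lieU (S : Coord d → Tensor2 d) (x : Coord d) : Tensor2 d := fun b v =>
  L.uDeriv (fun y => S y b v) x
    + ∑ i, pd b (fun y => L.uUp y i) x * S x i v
    + ∑ i, pd v (fun y => L.uUp y i) x * S x b i

/-- `a_m a^m`. -/
def accSq (x : Coord d) : ℝ := ∑ m, ∑ v, L.gi x m v * L.acc x m * L.acc x v

/-- `σ_{mv} σ^{mv}`. -/
def shearNormSq (x : Coord d) : ℝ :=
  ∑ m, ∑ r, ∑ v, ∑ s, L.gi x m r * L.gi x v s * L.shear x m v * L.shear x r s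

/-! #### Tangential and normal parts of a 4-tensor -/

/-- `T^∥_{abmv} = γ_a^p γ_b^q γ_m^r γ_v^s T_{pqrs}`. -/
def par (x : Coord d) (T : Tensor4 d) : Tensor4 d := fun a b m v =>
  ∑ p, ∑ q, ∑ r, ∑ s,
    L.proj x p a * L.proj x q b * L.proj x r m * L.proj x s v * T p q r s

/-- `T^{⊥∥}_{bmv} = u^a γ_m^r γ_v^s T_{abrs}`. -/
def perpPar (x : Coord d) (T : Tensor4 d) : Tensor3 d := fun b m v =>
  ∑ a, ∑ r, ∑ s, L.uUp x a * L.proj x r m * L.proj x s v * T a b r s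

/-- `T^⊥_{bv} = u^a u^m T_{abmv}`. -/
def perp (x : Coord d) (T : Tensor4 d) : Tensor2 d := fun b v =>
  ∑ a, ∑ m, L.uUp x a * L.uUp x m * T a b m v

/-- `Ric(T^∥)`. -/
def ricPar (x : Coord d) (T : Tensor4 d) : Tensor2 d := ric (L.gi x) (L.par x T)

/-- `Scal(T^∥)`. -/
def scalPar (x : Coord d) (T : Tensor4 d) : ℝ := scal (L.gi x) (L.par x T)

/-- The trace-free part of `Ric(T^∥)`. -/
def ricParHat (x : Coord d) (T : Tensor4 d) : Tensor2 d :=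
  traceFree ((d : ℝ) - 1) (L.gam x) (L.scalPar x T) (L.ricPar x T)

/-- `Weyl_u(T^∥)`, the Weyl map of the `(n - 1)`-dimensional space orthogonal to `u`. -/
def weylPar (x : Coord d) (T : Tensor4 d) : Tensor4 d :=
  weyl ((d : ℝ) - 1) (L.gi x) (L.gam x) (L.par x T)

/-- The trace `(T^{⊥∥}_tr)_v = γ^{ab} T^{⊥∥}_{abv}`. -/
def perpParTr (x : Coord d) (T : Tensor4 d) : Tensor1 d := fun v =>
  ∑ a, ∑ b, L.gamUp x a b * L.perpPar x T a b v

/-- The trace-free part of `T^{⊥∥}`. -/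
def perpParHat (x : Coord d) (T : Tensor4 d) : Tensor3 d := fun a b m =>
  L.perpPar x T a b m + 1 / ((d : ℝ) - 2) *
    (-(L.gam x a b * L.perpParTr x T m) + L.gam x a m * L.perpParTr x T b)

/-- The trace `T^⊥_tr = tr_γ T^⊥`. -/
def perpTr (x : Coord d) (T : Tensor4 d) : ℝ := tr (L.gamUp x) (L.perp x T)

/-- The trace-free part of `T^⊥`. -/
def perpHat (x : Coord d) (T : Tensor4 d) : Tensor2 d :=
  traceFree ((d : ℝ) - 1) (L.gam x) (L.perpTr x T) (L.perp x T)

end LocalData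

/-- The values at a point of the ambient tensors associated with the Riemann tensor, the Ricci
tensor, the scalar curvature and the Weyl tensor of a leaf. -/
structure LeafCurvature (d : ℕ) where
  Riem : Tensor4 d
  Ric : Tensor2 d
  Scal : ℝ
  Weyl : Tensor4 d

/-! #### The identities, for a 4-tensor `T` at the point with coordinates `x` -/

section Identities

variable {d : ℕ} (L : LocalData d) (S : LeafCurvature d) (x : Coord d) (T : Tensor4 d)

/-- The Gauss identity. -/
def GaussIdentity : Prop :=
  ∀ a b m v, L.par x T a b m v =
    S.Riem a b m v - L.ε * L.K x a m * L.K x b v + L.ε * L.K x a v * L.K x b m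

/-- The Codazzi identity. -/
def CodazziIdentity : Prop :=
  ∀ b m v, L.perpPar x T b m v = L.D2 L.K x v m b - L.D2 L.K x m v b

/-- The Ricci identity. -/
def RicciIdentity : Prop :=
  ∀ b v, L.perp x T b v =
    L.D1 L.acc x b v - L.ε * L.acc x b * L.acc x v
      + (∑ r, ∑ s, L.gi x r s * L.K x b r * L.K x v s) - L.lieU L.K x b v

/-- The trace and trace-free parts of the Gauss identity. -/
def GaussDecomposed : Prop :=
  (L.scalPar x T = S.Scal + L.ε * tr (L.gamUp x) (L.square x (L.shear x))
      - L.ε * ((d : ℝ) - 2) / ((d : ℝ) - 1) * L.H x ^ 2) ∧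
  (∀ b v, L.ricParHat x T b v =
    traceFree ((d : ℝ) - 1) (L.gam x) S.Scal S.Ric b v
      + L.ε * (L.square x (L.shear x) b v
          - tr (L.gamUp x) (L.square x (L.shear x)) / ((d : ℝ) - 1) * L.gam x b v)
      - L.ε * ((d : ℝ) - 3) / ((d : ℝ) - 1) * L.H x * L.shear x b v) ∧
  (∀ a b m v, L.weylPar x T a b m v =
    S.Weyl a b m v - L.ε / 2 * kn (L.shear x) (L.shear x) a b m v
      - L.ε / ((d : ℝ) - 3) * kn (L.square x (L.shear x)) (L.gam x) a b m v
      + L.ε * tr (L.gamUp x) (L.square x (L.shear x)) / (2 * ((d : ℝ) - 2) * ((d : ℝ) - 3))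
          * kn (L.gam x) (L.gam x) a b m v)

/-- The trace and trace-free parts of the Codazzi identity. -/
def CodazziDecomposed : Prop :=
  (∀ b m v, L.perpParHat x T b m v =
    L.D2 L.shear x v m b - L.D2 L.shear x m v b
      + 1 / ((d : ℝ) - 2) *
        (L.gam x b m * L.div2 L.shear x v - L.gam x b v * L.div2 L.shear x m)) ∧
  (∀ v, L.perpParTr x T v =
    ((d : ℝ) - 2) / ((d : ℝ) - 1) * L.D0 L.H x v - L.div2 L.shear x v)

/-- The trace and trace-free parts of the Ricci identity. -/
def RicciDecomposed : Prop :=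
  (L.perpTr x T = L.div1 L.acc x - L.ε * L.accSq x - L.shearNormSq x
      - L.H x ^ 2 / ((d : ℝ) - 1) - L.uDeriv L.H x) ∧
  (∀ b v, L.perpHat x T b v =
    L.D1 L.acc x b v - L.ε * L.acc x b * L.acc x v
      + 1 / ((d : ℝ) - 1) *
        (-L.div1 L.acc x + L.ε * L.accSq x + L.shearNormSq x) * L.gam x b v
      + (∑ r, ∑ s, L.gi x r s * L.shear x b r * L.shear x v s) - L.lieU L.shear x b v)

end Identities

/-! ### Foliated semi-Riemannian manifolds -/

section Manifold

variable {n : ℕ} {M : Type*} [TopologicalSpace M] [ChartedSpace (Coord n) M]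

/-- The coordinate vector field `∂_i` of the chart `e`, at the point with coordinates `x`. -/
def coordVec (e : OpenPartialHomeomorph M (Coord n)) (x : Coord n) (i : Fin n) :
    TangentSpace (𝓡 n) (e.symm x) :=
  mfderiv (𝓡 n) (𝓡 n) e.symm x (EuclideanSpace.single i (1 : ℝ) : Coord n)

/-- The components in the chart `e` of a covariant 2-tensor field. -/
def components2 (b : ∀ p : M, TangentSpace (𝓡 n) p → TangentSpace (𝓡 n) p → ℝ)
    (e : OpenPartialHomeomorph M (Coord n)) (x : Coord n) : Tensor2 n := fun i j =>
  b (e.symm x) (coordVec e x i) (coordVec e x j)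

end Manifold

/-- A smooth semi-Riemannian metric, of arbitrary signature. -/
structure SemiRiemannianMetric (n : ℕ) (M : Type*) [TopologicalSpace M]
    [ChartedSpace (Coord n) M] [IsManifold (𝓡 n) ∞ M] where
  inner (p : M) : TangentSpace (𝓡 n) p →L[ℝ] TangentSpace (𝓡 n) p →L[ℝ] ℝ
  symm (p : M) (v w : TangentSpace (𝓡 n) p) : inner p v w = inner p w v
  nondegenerate (p : M) (v : TangentSpace (𝓡 n) p) : (∀ w, inner p v w = 0) → v = 0
  contMDiff : ContMDiff (𝓡 n) ((𝓡 n).prod 𝓘(ℝ, Coord n →L[ℝ] Coord n →L[ℝ] ℝ)) ∞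
    (fun p => Bundle.TotalSpace.mk' (Coord n →L[ℝ] Coord n →L[ℝ] ℝ)
      (E := fun p : M => TangentSpace (𝓡 n) p →L[ℝ] TangentSpace (𝓡 n) p →L[ℝ] ℝ)
      p (inner p))

section Foliation

variable {n : ℕ} {M : Type*} [TopologicalSpace M] [ChartedSpace (Coord n) M]
  [IsManifold (𝓡 n) ∞ M]

/-- A foliation of `M` by hypersurfaces orthogonal to the vector field `u`: connected
`(n - 1)`-manifolds, injectively immersed in `M`, such that through each point of `M` passes
exactly one of them, and whose tangent spaces are the orthogonal complements of `u`.
When `u` is smooth and of square norm `±1`, the tangent distribution is smooth and the first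
fundamental form of each leaf is non-degenerate. -/
structure HypersurfaceFoliation (g : SemiRiemannianMetric n M)
    (u : ∀ p : M, TangentSpace (𝓡 n) p) where
  Index : Type*
  Leaf : Index → Type*
  [topologicalSpace : ∀ l, TopologicalSpace (Leaf l)]
  [chartedSpace : ∀ l, ChartedSpace (Coord (n - 1)) (Leaf l)]
  [isManifold : ∀ l, IsManifold (𝓡 (n - 1)) ∞ (Leaf l)]
  [connectedSpace : ∀ l, ConnectedSpace (Leaf l)]
  incl : ∀ l, Leaf l → M
  contMDiff : ∀ l, ContMDiff (𝓡 (n - 1)) (𝓡 n) ∞ (incl l)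
  immersive : ∀ l q, Function.Injective (mfderiv (𝓡 (n - 1)) (𝓡 n) (incl l) q)
  injective : ∀ l, Function.Injective (incl l)
  partition : ∀ p : M, ∃! l, p ∈ Set.range (incl l)
  tangent : ∀ l q (v : TangentSpace (𝓡 n) (incl l q)),
    v ∈ Set.range (mfderiv (𝓡 (n - 1)) (𝓡 n) (incl l) q) ↔ g.inner (incl l q) (u (incl l q)) v = 0

attribute [instance] HypersurfaceFoliation.topologicalSpace
  HypersurfaceFoliation.chartedSpace HypersurfaceFoliation.isManifold
  HypersurfaceFoliation.connectedSpace

/-- The components in the chart `e` of the metric and of the one-form metrically related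
to `u`. -/
def localData (g : SemiRiemannianMetric n M) (u : ∀ p : M, TangentSpace (𝓡 n) p) (ε : ℝ)
    (e : OpenPartialHomeomorph M (Coord n)) : LocalData n where
  g := components2 (fun p v w => g.inner p v w) e
  u := fun x i => g.inner (e.symm x) (u (e.symm x)) (coordVec e x i)
  ε := ε

namespace HypersurfaceFoliation

variable {g : SemiRiemannianMetric n M} {u : ∀ p : M, TangentSpace (𝓡 n) p}
  (F : HypersurfaceFoliation g u) {l : F.Index}

/-- The first fundamental form of a leaf, i.e. the pull-back of `g` to the leaf. -/
def inducedMetric (q : F.Leaf l) (v w : TangentSpace (𝓡 (n - 1)) q) : ℝ :=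
  g.inner (F.incl l q) (mfderiv (𝓡 (n - 1)) (𝓡 n) (F.incl l) q v)
    (mfderiv (𝓡 (n - 1)) (𝓡 n) (F.incl l) q w)

/-- The components of the first fundamental form in the chart `c` of the leaf. -/
def leafMetric (c : OpenPartialHomeomorph (F.Leaf l) (Coord (n - 1))) :
    Coord (n - 1) → Tensor2 (n - 1) :=
  components2 (fun q v w => F.inducedMetric q v w) c

/-- The matrix `θ^A_i` of the orthogonal projection of `T_pM` onto the tangent space of the leaf,
in the charts `e` of `M` and `c` of the leaf: `θ^A_i = h^{AB} e_B^j g_{ji}`, where `e_B^j` is the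
Jacobian matrix of the inclusion and `h_{AB}` the first fundamental form. It satisfies
`θ^A_i e_B^i = δ^A_B` and `θ^A_i u^i = 0`. -/
def theta (e : OpenPartialHomeomorph M (Coord n))
    (c : OpenPartialHomeomorph (F.Leaf l) (Coord (n - 1))) (q : F.Leaf l)
    (A : Fin (n - 1)) (i : Fin n) : ℝ :=
  ∑ B, ∑ j, invMetric (F.leafMetric c) (c q) A B *
    pd B (fun y => e (F.incl l (c.symm y)) j) (c q) *
    components2 (fun p v w => g.inner p v w) e (e (F.incl l q)) j i

/-- The ambient covariant tensor, completely orthogonal to `u`, that is associated with a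
covariant 2-tensor on the leaf. -/
def ext2 (e : OpenPartialHomeomorph M (Coord n))
    (c : OpenPartialHomeomorph (F.Leaf l) (Coord (n - 1))) (q : F.Leaf l)
    (S : Tensor2 (n - 1)) : Tensor2 n := fun i j =>
  ∑ A, ∑ B, F.theta e c q A i * F.theta e c q B j * S A B

/-- The ambient covariant tensor, completely orthogonal to `u`, that is associated with a
covariant 4-tensor on the leaf. -/
def ext4 (e : OpenPartialHomeomorph M (Coord n))
    (c : OpenPartialHomeomorph (F.Leaf l) (Coord (n - 1))) (q : F.Leaf l)
    (T : Tensor4 (n - 1)) : Tensor4 n := fun i j k m =>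
  ∑ A, ∑ B, ∑ C, ∑ D, F.theta e c q A i * F.theta e c q B j * F.theta e c q C k *
    F.theta e c q D m * T A B C D

/-- The intrinsic curvature of the leaf at `q`, i.e. that of its first fundamental form, seen as a
collection of ambient tensors. -/
def leafCurvature (e : OpenPartialHomeomorph M (Coord n))
    (c : OpenPartialHomeomorph (F.Leaf l) (Coord (n - 1))) (q : F.Leaf l) :
    LeafCurvature n where
  Riem := F.ext4 e c q (riem (F.leafMetric c) (c q))
  Ric := F.ext2 e c q
    (ric (invMetric (F.leafMetric c) (c q)) (riem (F.leafMetric c) (c q)))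
  Scal := scal (invMetric (F.leafMetric c) (c q)) (riem (F.leafMetric c) (c q))
  Weyl := F.ext4 e c q
    (weyl ((n : ℝ) - 1) (invMetric (F.leafMetric c) (c q)) (F.leafMetric c (c q))
      (riem (F.leafMetric c) (c q)))

end HypersurfaceFoliation

end Foliation

end FoliationGCR

end

noncomputable section

namespace FoliationGCR

/-! ### Calculus of partial derivatives -/

section Calculus

variable {d : ℕ} {f g : Coord d → ℝ} {x : Coord d}

/-! The statement splits into two independent halves: the algebraic equivalences for a general
tensor `T`, and the three identities for the Riemann tensor itself. Both are proved in coordinates;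
at the end a chart of `M` and a chart of a leaf are shown to provide the coordinate data.

Equivalences. Each identity has the form "part of `T` = X". A part is recovered linearly from its
traces and its trace-free remainder, so the identity is equivalent to the same equations between the
components, and only the components of X have to be computed. Write t = H/(n-1), so that K = σ + tγ.
In Gauss, X = Riem_Σ - (ε/2) K ∧ K, and the terms with H in K ∧ K have the form S ∧ γ, which the
Weyl map removes (`gauss_iff`). In Codazzi, Dγ = 0 and tr_γ D_c K = D_c H, so H enters only through
DH in a pure trace term (`codazzi_iff`). In Ricci, £_u γ = 2K, so the terms 2tσ of K² and of £_u K
cancel and H survives only in the trace (`ricci_iff`).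

Identities for R. The commutator of two covariant derivatives applied to u gives u^a R_{abmv} in
terms of ∇∇u (`sum_uUp_riem`). With ∇u = K + ε u ⊗ a, projecting it yields Codazzi and contracting
it once more with u yields Ricci.

For Gauss, let E be the Jacobian of the parametrized leaf. The ambient connection pulled back to the
leaf satisfies ∇_A E = E Γ_A + N_A, where N_A is orthogonal to the leaf. The tangential component
Γ_A is symmetric and compatible with the induced metric h, hence is its Levi-Civita connection
(`gMat_h_mul_conn`). Commuting ∇_A and ∇_B on E, taking tangential components, and using N_A = -ε u
K_A produces the Gauss equation on the leaf (`gauss_nor`, `gauss_pull`). The matrix θ = h⁻¹ Eᵀ g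
carries leaf tensors to ambient ones: Eθ is the projector, and θ g⁻¹ θᵀ = h⁻¹, so extension commutes
with Ric, Scal and Weyl (`isCompatible`).

Integrability enters through the symmetry of K. Differentiating u·E = 0 gives K_{AB} = -u·∇_A E_B,
symmetric because second partial derivatives commute and the connection is torsion-free. Since a
leaf passes through every point, K is symmetric on the whole chart and its symmetry may be
differentiated. -/

theorem pd_congr {U : Set (Coord d)} (hU : IsOpen U) (hx : x ∈ U) (h : ∀ y ∈ U, f y = g y)
    (i : Fin d) : pd i f x = pd i g x := by
  have : f =ᶠ[nhds x] g := Filter.eventuallyEq_of_mem (hU.mem_nhds hx) h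
  simp [pd, this.fderiv_eq]

theorem contDiffAt_pd (hf : ContDiffAt ℝ ∞ f x) (i : Fin d) : ContDiffAt ℝ ∞ (pd i f) x :=
  (hf.fderiv_right (m := ∞) (by simp)).clm_apply contDiffAt_const

theorem differentiableAt_of_smooth (hf : ContDiffAt ℝ ∞ f x) : DifferentiableAt ℝ f x :=
  hf.differentiableAt (by simp)

theorem pd_add (hf : ContDiffAt ℝ ∞ f x) (hg : ContDiffAt ℝ ∞ g x) (i : Fin d) :
    pd i (fun y => f y + g y) x = pd i f x + pd i g x := by
  simp [pd, fderiv_fun_add (differentiableAt_of_smooth hf) (differentiableAt_of_smooth hg)]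

theorem pd_sub (hf : ContDiffAt ℝ ∞ f x) (hg : ContDiffAt ℝ ∞ g x) (i : Fin d) :
    pd i (fun y => f y - g y) x = pd i f x - pd i g x := by
  simp [pd, fderiv_fun_sub (differentiableAt_of_smooth hf) (differentiableAt_of_smooth hg)]

theorem pd_mul (hf : ContDiffAt ℝ ∞ f x) (hg : ContDiffAt ℝ ∞ g x) (i : Fin d) :
    pd i (fun y => f y * g y) x = pd i f x * g x + f x * pd i g x := by
  simp [pd, fderiv_fun_mul (differentiableAt_of_smooth hf) (differentiableAt_of_smooth hg)]
  ring

theorem pd_const (c : ℝ) (i : Fin d) : pd i (fun _ => c) x = 0 := by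
  simp [pd]

theorem pd_const_mul (hf : ContDiffAt ℝ ∞ f x) (c : ℝ) (i : Fin d) :
    pd i (fun y => c * f y) x = c * pd i f x := by
  rw [pd_mul contDiffAt_const hf, pd_const]; ring

theorem pd_sum {ι : Type*} {s : Finset ι} {f : ι → Coord d → ℝ}
    (hf : ∀ j ∈ s, ContDiffAt ℝ ∞ (f j) x) (i : Fin d) :
    pd i (fun y => ∑ j ∈ s, f j y) x = ∑ j ∈ s, pd i (f j) x := by
  have := fderiv_fun_sum (fun j hj => differentiableAt_of_smooth (hf j hj))
  simp [pd, this]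

theorem pd_comm (hf : ContDiffAt ℝ ∞ f x) (i j : Fin d) :
    pd i (pd j f) x = pd j (pd i f) x := by
  have h2 : DifferentiableAt ℝ (fderiv ℝ f) x :=
    (hf.fderiv_right (m := ∞) (by simp)).differentiableAt (by simp)
  have key : ∀ i j : Fin d, pd i (pd j f) x =
      fderiv ℝ (fderiv ℝ f) x (EuclideanSpace.single i 1) (EuclideanSpace.single j 1) := by
    intro i j
    change fderiv ℝ (fun y => fderiv ℝ f y (EuclideanSpace.single j 1)) x _ = _
    rw [fderiv_clm_apply h2 (differentiableAt_const _)]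
    simp
  rw [key, key]
  -- Over ℝ, C² regularity suffices for the symmetry of the second derivative.
  exact hf.isSymmSndFDerivAt (by
    rw [minSmoothness_of_isRCLikeNormedField]
    exact WithTop.coe_le_coe.2 (le_top : (2 : ℕ∞) ≤ ⊤)) _ _

theorem pd_comp {k : ℕ} {φ : Coord k → Coord d} {y : Coord k}
    (hf : ContDiffAt ℝ ∞ f (φ y)) (hφ : ∀ j, ContDiffAt ℝ ∞ (fun z => φ z j) y) (i : Fin k) :
    pd i (fun z => f (φ z)) y = ∑ j, pd i (fun z => φ z j) y * pd j f (φ y) := by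
  have hφ' : DifferentiableAt ℝ φ y :=
    (contDiffAt_euclidean.2 hφ).differentiableAt (by simp)
  have h1 : fderiv ℝ (fun z => f (φ z)) y = (fderiv ℝ f (φ y)).comp (fderiv ℝ φ y) :=
    fderiv_fun_comp y (differentiableAt_of_smooth hf) hφ'
  have h2 : ∀ (v : Coord k) (j : Fin d),
      fderiv ℝ (fun z => φ z j) y v = fderiv ℝ φ y v j := by
    intro v j
    have := ((hasFDerivWithinAt_euclidean.1 hφ'.hasFDerivAt.hasFDerivWithinAt) j).hasFDerivAt
      Filter.univ_mem
    rw [this.fderiv]; rfl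
  simp only [pd, h1, h2, ContinuousLinearMap.comp_apply]
  set v := fderiv ℝ φ y (EuclideanSpace.single i 1)
  conv_lhs => rw [show v = ∑ j, v j • EuclideanSpace.single j (1 : ℝ) by
    ext m; simp [Finset.sum_apply, Pi.single_apply]]
  simp

end Calculus

/-! ### Matrix-valued functions -/

section MatrixCalculus

variable {d : ℕ} {ι κ τ : Type*}

/-- The entrywise partial derivative of a matrix-valued function. -/
def mpd (i : Fin d) (M : Coord d → Matrix ι κ ℝ) (x : Coord d) : Matrix ι κ ℝ :=
  Matrix.of fun a b => pd i (fun y => M y a b) x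

/-- Smoothness at a point of all entries of a matrix-valued function. -/
def MSmoothAt (M : Coord d → Matrix ι κ ℝ) (x : Coord d) : Prop :=
  ∀ a b, ContDiffAt ℝ ∞ (fun y => M y a b) x

variable {M N : Coord d → Matrix ι κ ℝ} {x : Coord d}

theorem mpd_congr {U : Set (Coord d)} (hU : IsOpen U) (hx : x ∈ U) (h : ∀ y ∈ U, M y = N y)
    (i : Fin d) : mpd i M x = mpd i N x := by
  ext a b
  exact pd_congr hU hx (fun y hy => by rw [h y hy]) i

theorem mpd_const (C : Matrix ι κ ℝ) (i : Fin d) : mpd i (fun _ => C) x = 0 := by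
  ext a b; exact pd_const _ _

theorem mpd_add (hM : MSmoothAt M x) (hN : MSmoothAt N x) (i : Fin d) :
    mpd i (fun y => M y + N y) x = mpd i M x + mpd i N x := by
  ext a b; exact pd_add (hM a b) (hN a b) i

theorem mpd_sub (hM : MSmoothAt M x) (hN : MSmoothAt N x) (i : Fin d) :
    mpd i (fun y => M y - N y) x = mpd i M x - mpd i N x := by
  ext a b; exact pd_sub (hM a b) (hN a b) i

theorem mpd_transpose (i : Fin d) : mpd i (fun y => (M y).transpose) x = (mpd i M x).transpose :=
  rfl

theorem mpd_mul [Fintype κ] {N : Coord d → Matrix κ τ ℝ} (hM : MSmoothAt M x)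
    (hN : MSmoothAt N x) (i : Fin d) :
    mpd i (fun y => M y * N y) x = mpd i M x * N x + M x * mpd i N x := by
  ext a b
  simp only [mpd, Matrix.of_apply, Matrix.mul_apply, Matrix.add_apply]
  rw [pd_sum (fun j _ => (hM a j).mul (hN j b)), ← Finset.sum_add_distrib]
  exact Finset.sum_congr rfl fun j _ => pd_mul (hM a j) (hN j b) i

theorem mpd_comm (hM : MSmoothAt M x) (i j : Fin d) :
    mpd i (mpd j M) x = mpd j (mpd i M) x := by
  ext a b; exact pd_comm (hM a b) i j

theorem MSmoothAt.mpd (hM : MSmoothAt M x) (i : Fin d) : MSmoothAt (mpd i M) x :=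
  fun a b => contDiffAt_pd (hM a b) i

theorem MSmoothAt.add (hM : MSmoothAt M x) (hN : MSmoothAt N x) :
    MSmoothAt (fun y => M y + N y) x := fun a b => (hM a b).add (hN a b)

theorem MSmoothAt.sub (hM : MSmoothAt M x) (hN : MSmoothAt N x) :
    MSmoothAt (fun y => M y - N y) x := fun a b => (hM a b).sub (hN a b)

theorem MSmoothAt.transpose (hM : MSmoothAt M x) :
    MSmoothAt (fun y => (M y).transpose) x := fun a b => hM b a

theorem MSmoothAt.mul [Fintype κ] {N : Coord d → Matrix κ τ ℝ} (hM : MSmoothAt M x)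
    (hN : MSmoothAt N x) : MSmoothAt (fun y => M y * N y) x := fun a b => by
  simp only [Matrix.mul_apply]
  exact ContDiffAt.sum fun j _ => (hM a j).mul (hN j b)

theorem MSmoothAt.det {M : Coord d → Matrix ι ι ℝ} [Fintype ι] [DecidableEq ι]
    (hM : MSmoothAt M x) : ContDiffAt ℝ ∞ (fun y => (M y).det) x := by
  simp only [Matrix.det_apply']
  exact ContDiffAt.sum fun σ _ => contDiffAt_const.mul (contDiffAt_prod fun j _ => hM _ _)

/-- Cramer's rule: an entry of the inverse is an adjugate entry, itself the determinant of a matrix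
with one row replaced, divided by the nonvanishing determinant. -/
theorem MSmoothAt.inv {M : Coord d → Matrix ι ι ℝ} [Fintype ι] [DecidableEq ι]
    (hM : MSmoothAt M x) (hdet : IsUnit (M x).det) : MSmoothAt (fun y => (M y)⁻¹) x := by
  intro a b
  have hadj : ContDiffAt ℝ ∞ (fun y => (M y).adjugate a b) x := by
    simp only [Matrix.adjugate_apply]
    refine MSmoothAt.det (M := fun y => (M y).updateRow b (Pi.single a 1)) ?_
    intro a' b'
    by_cases h : a' = b
    · subst h; simpa using contDiffAt_const
    · simpa [Matrix.updateRow_ne h] using hM a' b'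
  have : (fun y => (M y)⁻¹ a b) = fun y => ((M y).det)⁻¹ * (M y).adjugate a b := by
    funext y; simp [Matrix.inv_def]
  rw [this]
  exact (hM.det.inv hdet.ne_zero).mul hadj

/-- Differentiate M⁻¹ M = 1. This equation must hold near the point, hence the invertibility on an
open set. -/
theorem mpd_inv {M : Coord d → Matrix ι ι ℝ} [Fintype ι] [DecidableEq ι] {U : Set (Coord d)}
    (hU : IsOpen U) (hx : x ∈ U) (hM : MSmoothAt M x) (hdet : ∀ y ∈ U, IsUnit (M y).det)
    (i : Fin d) : mpd i (fun y => (M y)⁻¹) x = -((M x)⁻¹ * mpd i M x * (M x)⁻¹) := by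
  have h1 := mpd_mul (hM.inv (hdet x hx)) hM i
  rw [mpd_congr hU hx (N := fun _ => 1) (fun y hy => Matrix.nonsing_inv_mul _ (hdet y hy)),
    mpd_const] at h1
  have h2 := congrArg (· * (M x)⁻¹) h1
  simp only [Matrix.zero_mul, Matrix.add_mul, Matrix.mul_assoc,
    Matrix.mul_nonsing_inv _ (hdet x hx), Matrix.mul_one] at h2
  rw [Matrix.mul_assoc]
  exact (neg_eq_of_add_eq_zero_left h2.symm).symm

end MatrixCalculus

/-! ### The Levi-Civita connection -/

section LeviCivita

variable {d : ℕ}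

/-- The components of a semi-Riemannian metric on the open set `U`. -/
structure IsMetricOn (G : Coord d → Tensor2 d) (U : Set (Coord d)) : Prop where
  isOpen : IsOpen U
  smooth : ∀ x ∈ U, ∀ i j, ContDiffAt ℝ ∞ (fun y => G y i j) x
  symm : ∀ x ∈ U, ∀ i j, G x i j = G x j i
  isUnit_det : ∀ x ∈ U, IsUnit (Matrix.of (G x)).det

/-- The metric as a matrix. -/
def gMat (G : Coord d → Tensor2 d) (x : Coord d) : Matrix (Fin d) (Fin d) ℝ := Matrix.of (G x)

/-- The matrix `Γ_i` with entries `Γ^k_{ij}`. -/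
def conn (G : Coord d → Tensor2 d) (i : Fin d) (x : Coord d) : Matrix (Fin d) (Fin d) ℝ :=
  Matrix.of fun k j => christoffel G x k i j

/-- The curvature endomorphism `R^a_{bmv}` for fixed `m`, `v`. -/
def curv (G : Coord d → Tensor2 d) (x : Coord d) (m v : Fin d) : Matrix (Fin d) (Fin d) ℝ :=
  mpd m (conn G v) x - mpd v (conn G m) x + (conn G m x * conn G v x - conn G v x * conn G m x)

theorem riemUp_eq_curv (G : Coord d → Tensor2 d) (x : Coord d) (a b m v : Fin d) :
    riemUp G x a b m v = curv G x m v a b := by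
  simp [riemUp, curv, mpd, conn, Matrix.mul_apply, Finset.sum_sub_distrib]

/-- With the last two indices fixed, curvature is a matrix, and its symmetries become noncommutative
matrix identities. -/
theorem riem_eq_curv (G : Coord d → Tensor2 d) (x : Coord d) (a b m v : Fin d) :
    riem G x a b m v = (gMat G x * curv G x m v) a b := by
  simp [riem, riemUp_eq_curv, Matrix.mul_apply, gMat]

theorem curv_antisymm (G : Coord d → Tensor2 d) (x : Coord d) (m v : Fin d) :
    curv G x m v = -curv G x v m := by
  simp only [curv]; abel

namespace IsMetricOn

variable {G : Coord d → Tensor2 d} {U : Set (Coord d)} (hG : IsMetricOn G U) {x : Coord d}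
  (hx : x ∈ U)
include hG hx

theorem gMat_smooth : MSmoothAt (gMat G) x := hG.smooth x hx

theorem gMat_transpose : (gMat G x).transpose = gMat G x := by
  ext i j; exact hG.symm x hx j i

theorem inv_transpose : ((gMat G x)⁻¹).transpose = (gMat G x)⁻¹ := by
  rw [Matrix.transpose_nonsing_inv, hG.gMat_transpose hx]

theorem invMetric_symm (i j : Fin d) : invMetric G x i j = invMetric G x j i :=
  congrFun (congrFun (hG.inv_transpose hx) j) i

theorem inv_smooth : MSmoothAt (fun y => (gMat G y)⁻¹) x :=
  (hG.gMat_smooth hx).inv (hG.isUnit_det x hx)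

theorem gMat_mul_inv : gMat G x * (gMat G x)⁻¹ = 1 :=
  Matrix.mul_nonsing_inv _ (hG.isUnit_det x hx)

theorem inv_mul_gMat : (gMat G x)⁻¹ * gMat G x = 1 :=
  Matrix.nonsing_inv_mul _ (hG.isUnit_det x hx)

theorem gMat_mul_inv_mul {κ : Type*} (X : Matrix (Fin d) κ ℝ) :
    gMat G x * ((gMat G x)⁻¹ * X) = X := by
  rw [← Matrix.mul_assoc, hG.gMat_mul_inv hx, Matrix.one_mul]

theorem inv_mul_gMat_mul {κ : Type*} (X : Matrix (Fin d) κ ℝ) :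
    (gMat G x)⁻¹ * (gMat G x * X) = X := by
  rw [← Matrix.mul_assoc, hG.inv_mul_gMat hx, Matrix.one_mul]

theorem conn_smooth (i : Fin d) : MSmoothAt (conn G i) x := by
  intro k j
  have h : ∀ i j k : Fin d, ContDiffAt ℝ ∞ (fun z => pd i (fun y => G y j k) z) x :=
    fun i j k => contDiffAt_pd (hG.smooth x hx j k) i
  refine contDiffAt_const.mul (ContDiffAt.sum fun l _ => ?_)
  exact (hG.inv_smooth hx k l).mul (((h _ _ _).add (h _ _ _)).sub (h _ _ _))

theorem christoffel_symm (k i j : Fin d) : christoffel G x k i j = christoffel G x k j i := by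
  have h : ∀ l, pd l (fun y => G y i j) x = pd l (fun y => G y j i) x := fun l =>
    pd_congr hG.isOpen hx (fun y hy => hG.symm y hy i j) l
  simp only [christoffel, h]
  congr 1
  exact Finset.sum_congr rfl fun l _ => by ring

/-- The Christoffel symbols of the first kind. -/
theorem gMat_mul_conn (i m j : Fin d) : (gMat G x * conn G i x) m j =
    1 / 2 * (pd i (fun y => G y j m) x + pd j (fun y => G y i m) x
      - pd m (fun y => G y i j) x) := by
  have : conn G i x = (gMat G x)⁻¹ * Matrix.of fun l j => 1 / 2 * (pd i (fun y => G y j l) x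
      + pd j (fun y => G y i l) x - pd l (fun y => G y i j) x) := by
    ext k j
    simp only [conn, christoffel, Matrix.of_apply, Matrix.mul_apply, Finset.mul_sum]
    exact Finset.sum_congr rfl fun l _ => by simp only [invMetric, gMat]; ring
  rw [this, hG.gMat_mul_inv_mul hx]; rfl

/-- A symmetric metric connection is the Levi-Civita connection. -/
theorem gMat_mul_conn_eq {C : Fin d → Matrix (Fin d) (Fin d) ℝ}
    (hC : ∀ i j k, C i j k = C k j i)
    (hm : ∀ i, mpd i (gMat G) x = (C i).transpose + C i) (i : Fin d) :
    gMat G x * conn G i x = C i := by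
  ext m j
  have h : ∀ i j k, pd i (fun y => G y j k) x = C i k j + C i j k := fun i j k =>
    congrFun (congrFun (hm i) j) k
  rw [hG.gMat_mul_conn hx, h, h, h]
  -- Koszul's argument: of the six terms C in the Christoffel combination, four cancel by symmetry
  -- and the other two agree.
  linarith [hC i j m, hC i m j, hC j i m]

/-- Metric compatibility of the Levi-Civita connection. -/
theorem mpd_gMat (i : Fin d) : mpd i (gMat G) x =
    (conn G i x).transpose * gMat G x + gMat G x * conn G i x := by
  have : (conn G i x).transpose * gMat G x = (gMat G x * conn G i x).transpose := by
    rw [Matrix.transpose_mul, hG.gMat_transpose hx]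
  rw [this]
  ext a b
  have h : ∀ l a b, pd l (fun y => G y a b) x = pd l (fun y => G y b a) x := fun l a b =>
    pd_congr hG.isOpen hx (fun y hy => hG.symm y hy a b) l
  rw [Matrix.add_apply, Matrix.transpose_apply, hG.gMat_mul_conn hx, hG.gMat_mul_conn hx,
    h i b a]
  change pd i (fun y => G y a b) x = _
  linarith [h a i b, h b i a]

/-- Metric compatibility, transported to the inverse metric by `mpd_inv`. -/
theorem mpd_inv_gMat (i : Fin d) : mpd i (fun y => (gMat G y)⁻¹) x =
    -(conn G i x * (gMat G x)⁻¹ + (gMat G x)⁻¹ * (conn G i x).transpose) := by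
  rw [mpd_inv hG.isOpen hx (hG.gMat_smooth hx) hG.isUnit_det, hG.mpd_gMat hx]
  simp only [Matrix.mul_add, Matrix.add_mul, Matrix.mul_assoc, hG.gMat_mul_inv hx,
    hG.inv_mul_gMat_mul hx, Matrix.mul_one]
  rw [add_comm]

/-- Antisymmetry of the Riemann tensor in its first pair of indices. -/
theorem gMat_mul_curv (m v : Fin d) : gMat G x * curv G x m v =
    -(gMat G x * curv G x m v).transpose := by
  have key : ∀ m v, mpd m (mpd v (gMat G)) x =
      (mpd m (conn G v) x).transpose * gMat G x + (conn G v x).transpose *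
        ((conn G m x).transpose * gMat G x + gMat G x * conn G m x) +
      (((conn G m x).transpose * gMat G x + gMat G x * conn G m x) * conn G v x
        + gMat G x * mpd m (conn G v) x) := by
    intro m v
    have s1 := hG.conn_smooth hx v
    have s2 := hG.gMat_smooth hx
    rw [mpd_congr hG.isOpen hx (fun y hy => hG.mpd_gMat hy v),
      mpd_add (s1.transpose.mul s2) (s2.mul s1), mpd_mul s1.transpose s2, mpd_mul s2 s1,
      mpd_transpose, hG.mpd_gMat hx]
  -- Antisymmetrizing ∂_m ∂_v g in m and v cancels the mixed products of connection matrices and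
  -- leaves exactly gR + (gR)ᵀ.
  have h := mpd_comm (hG.gMat_smooth hx) m v
  rw [key, key] at h
  rw [Matrix.transpose_mul, hG.gMat_transpose hx]
  simp only [curv, Matrix.transpose_add, Matrix.transpose_sub, Matrix.transpose_mul]
  rw [← sub_eq_zero] at h ⊢
  rw [← h]
  noncomm_ring

/-- Because Γ is symmetric in its lower indices, the derivative terms and the quadratic terms of the
cyclic sum cancel in pairs. -/
theorem curv_bianchi (a b m v : Fin d) :
    curv G x m v a b + curv G x v b a m + curv G x b m a v = 0 := by
  have hs : ∀ i k j, conn G i x k j = conn G j x k i := fun i k j => hG.christoffel_symm hx k i j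
  have hd : ∀ l i k j, mpd l (conn G i) x k j = mpd l (conn G j) x k i := fun l i k j =>
    pd_congr hG.isOpen hx (fun y hy => hG.christoffel_symm hy k i j) l
  have hp : ∀ m v b, (conn G m x * conn G v x) a b = (conn G m x * conn G b x) a v := by
    intro m v b
    simp only [Matrix.mul_apply, hs v _ b]
  simp only [curv, Matrix.add_apply, Matrix.sub_apply]
  rw [hd m v a b, hd v b a m, hd b m a v, hp m v b, hp v b m, hp b m v]
  ring

theorem isRiemannType_riem : IsRiemannType (riem G x) := by
  have h1 : ∀ a b c e, riem G x a b c e = -riem G x a b e c := by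
    intro a b c e
    rw [riem_eq_curv, riem_eq_curv, curv_antisymm]; simp
  have h2 : ∀ a b c e, riem G x a b c e = -riem G x b a c e := by
    intro a b c e
    rw [riem_eq_curv, riem_eq_curv]
    exact congrFun (congrFun (hG.gMat_mul_curv hx c e) a) b
  have h4 : ∀ a b c e, riem G x a b c e + riem G x a c e b + riem G x a e b c = 0 := by
    intro a b c e
    simp only [riem_eq_curv, Matrix.mul_apply, ← Finset.sum_add_distrib, ← mul_add]
    refine Finset.sum_eq_zero fun k _ => ?_
    rw [hG.curv_bianchi hx, mul_zero]
  refine ⟨h1, h2, fun a b c e => ?_, h4⟩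
  -- The octahedron argument: pair symmetry is a linear combination of four cyclic identities and
  -- the two antisymmetries.
  linarith [h4 a b c e, h4 b c e a, h4 c e a b, h4 e a b c, h1 a b c e, h1 a c e b, h1 a e b c,
    h1 b c e a, h1 b e a c, h1 b a c e, h1 c e a b, h1 c a b e, h1 c b e a, h1 e a b c,
    h1 e b c a, h1 e c a b, h2 a b c e, h2 a c e b, h2 a e b c, h2 b c e a, h2 b e a c,
    h2 c e a b, h2 a b e c, h2 a c b e, h2 a e c b, h2 b c a e, h2 b e c a, h2 c e b a]

end IsMetricOn

end LeviCivita

/-! ### Covariant derivatives as matrices -/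

section Covariant

variable {d : ℕ}

/-- A one-form as a row matrix. -/
def row {d : ℕ} (v : Fin d → ℝ) : Matrix Unit (Fin d) ℝ := Matrix.of fun _ j => v j

/-- The trace of a 2-tensor as the trace of a matrix. -/
theorem tr_eq_trace {gi : Tensor2 d} (hgi : ∀ a b, gi a b = gi b a) (S : Tensor2 d) :
    tr gi S = (Matrix.of gi * Matrix.of S).trace := by
  simp only [tr, Matrix.trace, Matrix.diag, Matrix.mul_apply, Matrix.of_apply]
  rw [Finset.sum_comm]
  exact Finset.sum_congr rfl fun a _ => Finset.sum_congr rfl fun b _ => by rw [hgi]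

variable (G : Coord d → Tensor2 d)

theorem cov1_eq (w : Coord d → Tensor1 d) (x : Coord d) (i : Fin d) :
    row (cov1 G w x i) = mpd i (fun y => row (w y)) x - row (w x) * conn G i x := by
  ext _ j
  simp only [row, cov1, mpd, conn, Matrix.sub_apply, Matrix.mul_apply, Matrix.of_apply]
  congr 1
  exact Finset.sum_congr rfl fun k _ => mul_comm _ _

theorem cov2_eq (S : Coord d → Tensor2 d) (x : Coord d) (i : Fin d) :
    Matrix.of (cov2 G S x i) = mpd i (fun y => Matrix.of (S y)) x
      - (conn G i x).transpose * Matrix.of (S x) - Matrix.of (S x) * conn G i x := by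
  ext j k
  simp only [cov2, mpd, conn, Matrix.sub_apply, Matrix.mul_apply, Matrix.of_apply,
    Matrix.transpose_apply]
  congr 1
  exact Finset.sum_congr rfl fun k _ => mul_comm _ _

theorem cov2_transpose (S : Coord d → Tensor2 d) (x : Coord d) (i j k : Fin d) :
    cov2 G (fun y a b => S y b a) x i j k = cov2 G S x i k j := by
  simp only [cov2]; ring

variable {G} {U : Set (Coord d)} {x : Coord d}

theorem cov1_congr (hU : IsOpen U) (hx : x ∈ U) {w w' : Coord d → Tensor1 d}
    (h : ∀ y ∈ U, ∀ i, w y i = w' y i) (i j : Fin d) : cov1 G w x i j = cov1 G w' x i j := by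
  simp only [cov1, h x hx, pd_congr hU hx (fun y hy => h y hy j)]

theorem cov2_congr (hU : IsOpen U) (hx : x ∈ U) {S S' : Coord d → Tensor2 d}
    (h : ∀ y ∈ U, ∀ i j, S y i j = S' y i j) (i j k : Fin d) :
    cov2 G S x i j k = cov2 G S' x i j k := by
  simp only [cov2, h x hx, pd_congr hU hx (fun y hy => h y hy j k)]

theorem cov1_zero (i j : Fin d) : cov1 G (fun _ _ => 0) x i j = 0 := by
  simp [cov1, pd_const]

theorem cov2_add {S S' : Coord d → Tensor2 d}
    (hS : ∀ i j, ContDiffAt ℝ ∞ (fun y => S y i j) x)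
    (hS' : ∀ i j, ContDiffAt ℝ ∞ (fun y => S' y i j) x) (i j k : Fin d) :
    cov2 G (fun y a b => S y a b + S' y a b) x i j k = cov2 G S x i j k + cov2 G S' x i j k := by
  simp only [cov2, pd_add (hS j k) (hS' j k), mul_add, Finset.sum_add_distrib]
  ring

theorem cov2_sub {S S' : Coord d → Tensor2 d}
    (hS : ∀ i j, ContDiffAt ℝ ∞ (fun y => S y i j) x)
    (hS' : ∀ i j, ContDiffAt ℝ ∞ (fun y => S' y i j) x) (i j k : Fin d) :
    cov2 G (fun y a b => S y a b - S' y a b) x i j k = cov2 G S x i j k - cov2 G S' x i j k := by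
  simp only [cov2, pd_sub (hS j k) (hS' j k), mul_sub, Finset.sum_sub_distrib]
  ring

/-- The Leibniz rule for the product of a function and a 2-tensor. -/
theorem cov2_fun_mul {f : Coord d → ℝ} (hf : ContDiffAt ℝ ∞ f x) {S : Coord d → Tensor2 d}
    (hS : ∀ i j, ContDiffAt ℝ ∞ (fun y => S y i j) x) (i j k : Fin d) :
    cov2 G (fun y a b => f y * S y a b) x i j k = pd i f x * S x j k + f x * cov2 G S x i j k := by
  simp only [cov2, pd_mul hf (hS j k), mul_sub, Finset.mul_sum, mul_left_comm (f x)]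
  ring

/-- The Leibniz rule for the tensor product of one-forms. -/
theorem cov2_tensor {v w : Coord d → Tensor1 d} (hv : ∀ i, ContDiffAt ℝ ∞ (fun y => v y i) x)
    (hw : ∀ i, ContDiffAt ℝ ∞ (fun y => w y i) x) (i j k : Fin d) :
    cov2 G (fun y a b => v y a * w y b) x i j k =
      cov1 G v x i j * w x k + v x j * cov1 G w x i k := by
  simp only [cov2, cov1, pd_mul (hv j) (hw k), mul_sub, sub_mul, Finset.mul_sum, Finset.sum_mul,
    mul_assoc, mul_left_comm (v x j)]
  ring

theorem contDiffAt_cov1 (hG : IsMetricOn G U) (hx : x ∈ U) {w : Coord d → Tensor1 d}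
    (hw : ∀ i, ContDiffAt ℝ ∞ (fun y => w y i) x) (i j : Fin d) :
    ContDiffAt ℝ ∞ (fun y => cov1 G w y i j) x :=
  (contDiffAt_pd (hw j) i).sub
    (ContDiffAt.sum fun k _ => (hG.conn_smooth hx i k j).mul (hw k))

/-- The Ricci identity for one-forms. -/
theorem cov2_cov1_comm (hG : IsMetricOn G U) (hx : x ∈ U) {w : Coord d → Tensor1 d}
    (hw : ∀ y ∈ U, ∀ i, ContDiffAt ℝ ∞ (fun y => w y i) y) (m v b : Fin d) :
    cov2 G (cov1 G w) x m v b - cov2 G (cov1 G w) x v m b =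
      -∑ a, w x a * curv G x m v a b := by
  have hw' : ∀ y ∈ U, MSmoothAt (fun y => row (w y)) y := fun y hy _ j => hw y hy j
  have key : ∀ m v, mpd m (fun y => row (cov1 G w y v)) x - row (cov1 G w x v) * conn G m x =
      mpd m (mpd v (fun y => row (w y))) x
        - (mpd m (fun y => row (w y)) x * conn G v x + row (w x) * mpd m (conn G v) x)
        - (mpd v (fun y => row (w y)) x - row (w x) * conn G v x) * conn G m x := by
    intro m v
    rw [cov1_eq, mpd_congr hG.isOpen hx (fun y _ => cov1_eq G w y v),
      mpd_sub ((hw' x hx).mpd v) ((hw' x hx).mul (hG.conn_smooth hx v)),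
      mpd_mul (hw' x hx) (hG.conn_smooth hx v)]
  have h : (mpd m (fun y => row (cov1 G w y v)) x - row (cov1 G w x v) * conn G m x)
      - (mpd v (fun y => row (cov1 G w y m)) x - row (cov1 G w x m) * conn G v x) =
      -(row (w x) * curv G x m v) := by
    rw [key, key, mpd_comm (hw' x hx) v m, curv]
    simp only [Matrix.mul_add, Matrix.mul_sub, Matrix.sub_mul, Matrix.mul_assoc]
    abel
  have h' := congrFun (congrFun h ()) b
  simp only [Matrix.sub_apply, Matrix.neg_apply, Matrix.mul_apply, mpd, row, conn,
    Matrix.of_apply] at h'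
  rw [← h']
  -- The connection terms acting on the index of the first derivative agree in both orders, since
  -- there is no torsion; the matrix identity for the other index is all that remains.
  simp only [cov2, hG.christoffel_symm hx _ v m, mul_comm (christoffel G x _ _ b)]
  ring

/-- The derivative of the trace of a 2-tensor is the trace of its covariant derivative. -/
theorem pd_tr (hG : IsMetricOn G U) (hx : x ∈ U) {S : Coord d → Tensor2 d}
    (hS : ∀ y ∈ U, ∀ i j, ContDiffAt ℝ ∞ (fun y => S y i j) y) (i : Fin d) :
    pd i (fun y => tr (invMetric G y) (S y)) x = tr (invMetric G x) (cov2 G S x i) := by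
  have hS' : MSmoothAt (fun y => Matrix.of (S y)) x := hS x hx
  have h1 : pd i (fun y => tr (invMetric G y) (S y)) x =
      (mpd i (fun y => (gMat G y)⁻¹ * Matrix.of (S y)) x).trace := by
    rw [pd_congr hG.isOpen hx (fun y hy => tr_eq_trace (hG.invMetric_symm hy) (S y))]
    exact pd_sum (f := fun a y => ((gMat G y)⁻¹ * Matrix.of (S y)) a a)
      (fun a _ => ((hG.inv_smooth hx).mul hS') a a) i
  rw [h1, tr_eq_trace (hG.invMetric_symm hx), mpd_mul (hG.inv_smooth hx) hS', hG.mpd_inv_gMat hx,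
    cov2_eq]
  change _ = ((gMat G x)⁻¹ * _).trace
  simp only [Matrix.neg_mul, Matrix.add_mul, Matrix.mul_sub, Matrix.trace_add, Matrix.trace_sub,
    Matrix.trace_neg, Matrix.mul_assoc]
  -- Cyclicity of the trace matches the derivative of g⁻¹ with the connection terms of ∇S.
  rw [Matrix.trace_mul_comm (conn G i x)]
  simp only [Matrix.mul_assoc]
  ring

end Covariant

/-! ### The unit normal -/

/-- On the open set `U`, `L` consists of a smooth metric and a smooth one-form of
square norm `ε = ±1`. -/
structure LocalData.IsUnitNormal {d : ℕ} (L : LocalData d) (U : Set (Coord d)) : Prop where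
  metric : IsMetricOn L.g U
  smooth_u : ∀ x ∈ U, ∀ i, ContDiffAt ℝ ∞ (fun y => L.u y i) x
  norm : ∀ x ∈ U, ∑ i, L.uUp x i * L.u x i = L.ε
  sq : L.ε * L.ε = 1

namespace LocalData

variable {d : ℕ} (L : LocalData d)

/-- The covariant derivative `∇_i u_j`. -/
def W (x : Coord d) : Tensor2 d := cov1 L.g L.u x

/-- Projection of one covariant index. -/
def pr (x : Coord d) (a : Fin d) (f : Fin d → ℝ) : ℝ := ∑ m, L.proj x m a * f m

variable {L} {x : Coord d}

theorem pr_eq (a : Fin d) (f : Fin d → ℝ) :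
    L.pr x a f = f a - L.ε * L.u x a * ∑ m, L.uUp x m * f m := by
  simp only [pr, proj, sub_mul, Finset.sum_sub_distrib, Finset.mul_sum]
  congr 1
  · simp
  · exact Finset.sum_congr rfl fun m _ => by ring

theorem pr_add (a : Fin d) (f f' : Fin d → ℝ) :
    L.pr x a (fun m => f m + f' m) = L.pr x a f + L.pr x a f' := by
  simp only [pr, mul_add, Finset.sum_add_distrib]

theorem pr_sub (a : Fin d) (f f' : Fin d → ℝ) :
    L.pr x a (fun m => f m - f' m) = L.pr x a f - L.pr x a f' := by
  simp only [pr, mul_sub, Finset.sum_sub_distrib]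

theorem pr_const_mul (a : Fin d) (c : ℝ) (f : Fin d → ℝ) :
    L.pr x a (fun m => c * f m) = c * L.pr x a f := by
  simp only [pr, Finset.mul_sum, mul_left_comm c]

theorem pr_mul_const (a : Fin d) (c : ℝ) (f : Fin d → ℝ) :
    L.pr x a (fun m => f m * c) = L.pr x a f * c := by
  simp only [pr, Finset.sum_mul, mul_assoc]

theorem pr_zero (a : Fin d) : L.pr x a (fun _ => 0) = 0 := by
  simp [pr]

theorem pr_comm (a b : Fin d) (f : Fin d → Fin d → ℝ) :
    L.pr x a (fun m => L.pr x b (f m)) = L.pr x b (fun v => L.pr x a (fun m => f m v)) := by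
  simp only [pr, Finset.mul_sum]
  rw [Finset.sum_comm]
  exact Finset.sum_congr rfl fun m _ => Finset.sum_congr rfl fun v _ => by ring

theorem D0_eq (f : Coord d → ℝ) (v : Fin d) : L.D0 f x v = L.pr x v (fun m => pd m f x) := rfl

theorem D1_eq (w : Coord d → Tensor1 d) (b v : Fin d) :
    L.D1 w x b v = L.pr x b (fun m => L.pr x v (cov1 L.g w x m)) := by
  simp only [D1, pr, Finset.mul_sum, mul_assoc]

theorem D2_eq (S : Coord d → Tensor2 d) (c a b : Fin d) :
    L.D2 S x c a b = L.pr x c (fun k => L.pr x a (fun m => L.pr x b (cov2 L.g S x k m))) := by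
  simp only [D2, pr, Finset.mul_sum, mul_assoc]

theorem K_eq_pr (a b : Fin d) : L.K x a b = L.pr x a (fun m => L.pr x b (L.W x m)) := by
  simp only [K, pr, Finset.mul_sum, mul_assoc, W]

theorem perpPar_eq (T : Tensor4 d) (b m v : Fin d) :
    L.perpPar x T b m v = L.pr x m (fun r => L.pr x v (fun s => ∑ a, L.uUp x a * T a b r s)) := by
  simp only [perpPar, pr, Finset.mul_sum]
  rw [Finset.sum_comm]
  refine Finset.sum_congr rfl fun r _ => ?_
  rw [Finset.sum_comm]
  exact Finset.sum_congr rfl fun s _ => Finset.sum_congr rfl fun a _ => by ring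

theorem uUp_row : (row (L.uUp x)).transpose = (gMat L.g x)⁻¹ * (row (L.u x)).transpose := by
  ext i _
  simp [Matrix.mul_apply, row, gMat, uUp, gi, invMetric]

theorem pr_of_orth {f : Fin d → ℝ} (hf : ∑ m, L.uUp x m * f m = 0) (a : Fin d) :
    L.pr x a f = f a := by
  rw [pr_eq, hf]; ring

namespace IsUnitNormal

variable {U : Set (Coord d)} (hL : L.IsUnitNormal U) (hx : x ∈ U)
include hL hx

theorem gi_symm (i j : Fin d) : L.gi x i j = L.gi x j i := hL.metric.invMetric_symm hx i j

theorem smooth_gi (i j : Fin d) : ContDiffAt ℝ ∞ (fun y => L.gi y i j) x :=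
  hL.metric.inv_smooth hx i j

theorem smooth_uUp (i : Fin d) : ContDiffAt ℝ ∞ (fun y => L.uUp y i) x :=
  ContDiffAt.sum fun j _ => (hL.smooth_gi hx i j).mul (hL.smooth_u x hx j)

theorem smooth_W (i j : Fin d) : ContDiffAt ℝ ∞ (fun y => L.W y i j) x :=
  contDiffAt_cov1 hL.metric hx (hL.smooth_u x hx) i j

theorem smooth_acc (i : Fin d) : ContDiffAt ℝ ∞ (fun y => L.acc y i) x :=
  ContDiffAt.sum fun j _ => (hL.smooth_uUp hx j).mul (hL.smooth_W hx j i)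

theorem smooth_proj (i j : Fin d) : ContDiffAt ℝ ∞ (fun y => L.proj y i j) x :=
  contDiffAt_const.sub ((contDiffAt_const.mul (hL.smooth_uUp hx i)).mul (hL.smooth_u x hx j))

theorem smooth_K (i j : Fin d) : ContDiffAt ℝ ∞ (fun y => L.K y i j) x :=
  ContDiffAt.sum fun m _ => ContDiffAt.sum fun v _ =>
    ((hL.smooth_proj hx m i).mul (hL.smooth_proj hx v j)).mul (hL.smooth_W hx m v)

theorem smooth_gamUp (i j : Fin d) : ContDiffAt ℝ ∞ (fun y => L.gamUp y i j) x :=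
  (hL.smooth_gi hx i j).sub ((contDiffAt_const.mul (hL.smooth_uUp hx i)).mul (hL.smooth_uUp hx j))

theorem smooth_gam (i j : Fin d) : ContDiffAt ℝ ∞ (fun y => L.gam y i j) x :=
  (hL.metric.smooth x hx i j).sub
    ((contDiffAt_const.mul (hL.smooth_u x hx i)).mul (hL.smooth_u x hx j))

theorem smooth_H : ContDiffAt ℝ ∞ L.H x := by
  change ContDiffAt ℝ ∞ (fun y => ∑ a, ∑ b, L.gamUp y a b * L.K y a b) x
  exact ContDiffAt.sum fun a _ => ContDiffAt.sum fun b _ =>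
    (hL.smooth_gamUp hx a b).mul (hL.smooth_K hx a b)

theorem smooth_shear (i j : Fin d) : ContDiffAt ℝ ∞ (fun y => L.shear y i j) x :=
  (hL.smooth_K hx i j).sub (((hL.smooth_H hx).div_const _).mul (hL.smooth_gam hx i j))

/-- `u_i = g_{ij} u^j`. -/
theorem u_eq (i : Fin d) : L.u x i = ∑ j, L.g x i j * L.uUp x j := by
  have h : (row (L.u x)).transpose =
      gMat L.g x * ((gMat L.g x)⁻¹ * (row (L.u x)).transpose) :=
    (hL.metric.gMat_mul_inv_mul hx _).symm
  have h' := congrFun (congrFun h i) ()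
  simpa [Matrix.mul_apply, row, gMat, uUp, gi, invMetric] using h'

/-- Covariant differentiation commutes with raising the index of `u`. -/
theorem mpd_uUp (i : Fin d) : mpd i (fun y => (row (L.uUp y)).transpose) x =
    (gMat L.g x)⁻¹ * (row (L.W x i)).transpose - conn L.g i x * (row (L.uUp x)).transpose := by
  have hu : MSmoothAt (fun y => (row (L.u y)).transpose) x := fun j _ => hL.smooth_u x hx j
  rw [mpd_congr hL.metric.isOpen hx (fun y hy => uUp_row),
    mpd_mul (hL.metric.inv_smooth hx) hu, hL.metric.mpd_inv_gMat hx, uUp_row, W, cov1_eq,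
    mpd_transpose]
  simp only [Matrix.transpose_sub, Matrix.transpose_mul, Matrix.mul_sub, Matrix.neg_mul,
    Matrix.add_mul, Matrix.mul_assoc]
  abel

theorem pd_uUp (i j : Fin d) : pd i (fun y => L.uUp y j) x =
    ∑ k, L.gi x j k * L.W x i k - ∑ k, christoffel L.g x j i k * L.uUp x k := by
  have h := congrFun (congrFun (hL.mpd_uUp hx i) j) ()
  simpa [Matrix.mul_apply, row, mpd, conn, gMat, gi, invMetric] using h

theorem smooth_row_uUp : MSmoothAt (fun y => row (L.uUp y)) x := fun _ j => hL.smooth_uUp hx j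

/-- The Leibniz rule for `∇_b (u^m S_{mv})`. -/
theorem cov1_contract {S : Coord d → Tensor2 d}
    (hS : ∀ i j, ContDiffAt ℝ ∞ (fun y => S y i j) x) (b v : Fin d) :
    cov1 L.g (fun y v => ∑ m, L.uUp y m * S y m v) x b v =
      ∑ m, L.uUp x m * cov2 L.g S x b m v + ∑ m, ∑ k, L.gi x m k * L.W x b k * S x m v := by
  have hrow : ∀ y, row (fun v => ∑ m, L.uUp y m * S y m v) = row (L.uUp y) * Matrix.of (S y) := by
    intro y; ext _ j; simp [row, Matrix.mul_apply]
  have hS' : MSmoothAt (fun y => Matrix.of (S y)) x := hS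
  have h := cov1_eq L.g (fun y v => ∑ m, L.uUp y m * S y m v) x b
  have hm := hL.mpd_uUp hx b
  rw [mpd_transpose] at hm
  have hm' := congrArg Matrix.transpose hm
  simp only [Matrix.transpose_sub, Matrix.transpose_mul, Matrix.transpose_transpose,
    hL.metric.inv_transpose hx] at hm'
  simp only [hrow] at h
  rw [mpd_mul (hL.smooth_row_uUp hx) hS', hm'] at h
  have h2 := cov2_eq L.g S x b
  have h3 : row (cov1 L.g (fun y v => ∑ m, L.uUp y m * S y m v) x b) =
      row (L.uUp x) * Matrix.of (cov2 L.g S x b)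
        + row (L.W x b) * (gMat L.g x)⁻¹ * Matrix.of (S x) := by
    rw [h, h2]
    simp only [Matrix.mul_sub, Matrix.sub_mul, Matrix.mul_assoc]
    abel
  have h4 := congrFun (congrFun h3 ()) v
  simp only [Matrix.add_apply, Matrix.mul_apply, row, Matrix.of_apply] at h4
  rw [h4]
  congr 1
  refine Finset.sum_congr rfl fun m _ => ?_
  rw [Finset.sum_mul]
  refine Finset.sum_congr rfl fun k _ => ?_
  rw [hL.gi_symm hx m k]
  simp only [gi, invMetric, gMat]
  ring

/-- The Leibniz rule for `∂_i (w_v u^v)`. -/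
theorem pd_contract {w : Coord d → Tensor1 d} (hw : ∀ i, ContDiffAt ℝ ∞ (fun y => w y i) x)
    (i : Fin d) : pd i (fun y => ∑ v, L.uUp y v * w y v) x =
      ∑ v, L.uUp x v * cov1 L.g w x i v + ∑ v, ∑ k, L.gi x v k * L.W x i k * w x v := by
  rw [pd_sum (fun v _ => (hL.smooth_uUp hx v).mul (hw v))]
  simp only [pd_mul (hL.smooth_uUp hx _) (hw _), hL.pd_uUp hx, cov1, mul_sub, sub_mul,
    Finset.sum_add_distrib, Finset.sum_sub_distrib, Finset.sum_mul, Finset.mul_sum]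
  rw [Finset.sum_comm (f := fun v k => christoffel L.g x v i k * L.uUp x k * w x v)]
  simp only [mul_assoc, mul_left_comm (L.uUp x _)]
  ring

/-- `u^j ∇_i u_j = 0`. -/
theorem sum_uUp_W (i : Fin d) : ∑ j, L.uUp x j * L.W x i j = 0 := by
  have h := hL.pd_contract hx (hL.smooth_u x hx) i
  -- Differentiating g(u,u) = ε: the two Leibniz terms are equal, so each vanishes.
  rw [pd_congr hL.metric.isOpen hx (fun y hy => hL.norm y hy), pd_const] at h
  have h2 : ∑ v, ∑ k, L.gi x v k * L.W x i k * L.u x v = ∑ j, L.uUp x j * L.W x i j := by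
    rw [Finset.sum_comm]
    refine Finset.sum_congr rfl fun k _ => ?_
    rw [uUp, Finset.sum_mul]
    exact Finset.sum_congr rfl fun v _ => by rw [hL.gi_symm hx v k]; ring
  rw [h2] at h
  change 0 = ∑ j, L.uUp x j * L.W x i j + _ at h
  linarith

/-- `u^j a_j = 0`. -/
theorem sum_uUp_acc : ∑ j, L.uUp x j * L.acc x j = 0 := by
  simp only [acc, Finset.mul_sum]
  rw [Finset.sum_comm]
  refine Finset.sum_eq_zero fun i _ => ?_
  have := hL.sum_uUp_W hx i
  simp only [mul_left_comm _ (L.uUp x i), ← Finset.mul_sum]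
  change _ * ∑ j, L.uUp x j * L.W x i j = 0
  rw [this, mul_zero]

theorem pr_u (a : Fin d) : L.pr x a (L.u x) = 0 := by
  rw [pr_eq, hL.norm x hx]
  linear_combination (-L.u x a) * hL.sq

theorem uUp_pr (f : Fin d → ℝ) : ∑ a, L.uUp x a * L.pr x a f = 0 := by
  have h := hL.norm x hx
  simp only [pr_eq, mul_sub, Finset.sum_sub_distrib]
  have : ∀ a, L.uUp x a * (L.ε * L.u x a * ∑ m, L.uUp x m * f m) =
      L.uUp x a * L.u x a * (L.ε * ∑ m, L.uUp x m * f m) := fun a => by ring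
  simp only [this, ← Finset.sum_mul, h]
  linear_combination (-∑ m, L.uUp x m * f m) * hL.sq

/-- `K = ∇u - ε u ⊗ a`. -/
theorem K_eq (a b : Fin d) : L.K x a b = L.W x a b - L.ε * L.u x a * L.acc x b := by
  rw [K_eq_pr]
  simp only [pr_of_orth (hL.sum_uUp_W hx _)]
  rw [pr_eq]; rfl

theorem W_eq (a b : Fin d) : L.W x a b = L.K x a b + L.ε * (L.u x a * L.acc x b) := by
  rw [hL.K_eq hx]; ring

theorem sum_uUp_K_right (a : Fin d) : ∑ b, L.uUp x b * L.K x a b = 0 := by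
  have : ∀ b, L.K x a b = L.pr x b (fun v => L.pr x a (fun m => L.W x m v)) := fun b => by
    rw [K_eq_pr, pr_comm]
  simp only [this, hL.uUp_pr hx]

theorem sum_uUp_K_left (b : Fin d) : ∑ a, L.uUp x a * L.K x a b = 0 := by
  simp only [K_eq_pr, hL.uUp_pr hx]

end IsUnitNormal

end LocalData

namespace LocalData

variable {d : ℕ} {L : LocalData d} {x : Coord d}

namespace IsUnitNormal

variable {U : Set (Coord d)} (hL : L.IsUnitNormal U) (hx : x ∈ U)
include hL hx

/-! ### Codazzi and Ricci identities of the ambient Riemann tensor -/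

/-- The Ricci identity for the one-form u, with the contraction moved from u_k to u^a by g. It is
the common source of the Codazzi and Ricci identities of R. -/
theorem sum_uUp_riem (b m v : Fin d) : ∑ a, L.uUp x a * riem L.g x a b m v =
    cov2 L.g L.W x v m b - cov2 L.g L.W x m v b := by
  have h := cov2_cov1_comm hL.metric hx hL.smooth_u m v b
  have h2 : ∑ a, L.uUp x a * riem L.g x a b m v = ∑ k, L.u x k * curv L.g x m v k b := by
    simp only [riem, riemUp_eq_curv, Finset.mul_sum]
    rw [Finset.sum_comm]
    refine Finset.sum_congr rfl fun k _ => ?_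
    rw [hL.u_eq hx k, Finset.sum_mul]
    exact Finset.sum_congr rfl fun a _ => by rw [hL.metric.symm x hx k a]; ring
  rw [h2]
  change cov2 L.g L.W x m v b - cov2 L.g L.W x v m b = _ at h
  linarith

theorem cov2_K (k m v : Fin d) : cov2 L.g L.K x k m v = cov2 L.g L.W x k m v
    - L.ε * (L.W x k m * L.acc x v + L.u x m * cov1 L.g L.acc x k v) := by
  have h1 : ∀ i j, ContDiffAt ℝ ∞ (fun y => L.u y i * L.acc y j) x := fun i j =>
    (hL.smooth_u x hx i).mul (hL.smooth_acc hx j)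
  rw [cov2_congr hL.metric.isOpen hx (S' := fun y a b => L.W y a b - L.ε * (L.u y a * L.acc y b))
    (fun y hy i j => by rw [hL.K_eq hy]; ring),
    cov2_sub (hL.smooth_W hx) (fun i j => contDiffAt_const.mul (h1 i j)),
    cov2_fun_mul contDiffAt_const h1, pd_const, cov2_tensor (hL.smooth_u x hx) (hL.smooth_acc hx)]
  simp only [W]
  ring

/-- Differentiate K = W - ε u ⊗ a and project: the term containing ∇a keeps a factor u and dies,
while differentiating u leaves ε K_{ca} a_b. -/
theorem D2_K (c a b : Fin d) : L.D2 L.K x c a b =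
    L.pr x c (fun k => L.pr x a (fun m => L.pr x b (cov2 L.g L.W x k m)))
      - L.ε * L.K x c a * L.acc x b := by
  have h : ∀ k m, L.pr x b (cov2 L.g L.K x k m) = L.pr x b (cov2 L.g L.W x k m)
      - (L.W x k m * (L.ε * L.acc x b) + L.u x m * (L.ε * L.pr x b (cov1 L.g L.acc x k))) := by
    intro k m
    have : cov2 L.g L.K x k m = fun v => cov2 L.g L.W x k m v
        - ((L.ε * L.W x k m) * L.acc x v + (L.ε * L.u x m) * cov1 L.g L.acc x k v) := by
      funext v; rw [hL.cov2_K hx]; ring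
    rw [this, pr_sub, pr_add, pr_const_mul, pr_const_mul, pr_of_orth (hL.sum_uUp_acc hx)]
    ring
  rw [D2_eq]
  simp only [h, pr_sub, pr_add, pr_mul_const]
  have hu : L.pr x a (fun m => L.u x m) = 0 := hL.pr_u hx a
  have hW : L.pr x c (fun k => L.pr x a (fun m => L.W x k m)) = L.K x c a := (K_eq_pr c a).symm
  simp only [hu, hW, zero_mul, pr_zero]
  ring

/-- The Codazzi identity for the Riemann tensor. -/
theorem codazziIdentity (hK : ∀ a b, L.K x a b = L.K x b a) :
    CodazziIdentity L x (riem L.g x) := by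
  intro b m v
  have hR := hL.metric.isRiemannType_riem hx
  -- The index b of T^{⊥∥} carries no projector in its definition; antisymmetry of R in its first
  -- pair makes the contraction orthogonal to u, so a projector may be inserted.
  have horth : ∀ r s, ∑ b, L.uUp x b * ∑ a, L.uUp x a * riem L.g x a b r s = 0 := by
    intro r s
    have h : ∑ b, L.uUp x b * ∑ a, L.uUp x a * riem L.g x a b r s =
        -∑ b, L.uUp x b * ∑ a, L.uUp x a * riem L.g x a b r s := by
      conv_lhs =>
        simp only [Finset.mul_sum]
        rw [Finset.sum_comm]
      simp only [Finset.mul_sum, ← Finset.sum_neg_distrib]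
      refine Finset.sum_congr rfl fun a _ => Finset.sum_congr rfl fun b _ => ?_
      rw [hR.2.1 a b]; ring
    linarith
  have h : ∀ r s, ∑ a, L.uUp x a * riem L.g x a b r s =
      L.pr x b (cov2 L.g L.W x s r) - L.pr x b (cov2 L.g L.W x r s) := by
    intro r s
    rw [← pr_of_orth (horth r s) b, ← pr_sub]
    simp only [hL.sum_uUp_riem hx]
  rw [perpPar_eq]
  simp only [h, pr_sub]
  -- The acceleration terms ε K_{vm} a_b and ε K_{mv} a_b cancel by the symmetry of K.
  rw [hL.D2_K hx, hL.D2_K hx, hK v m, pr_comm m v]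
  ring

/-- The Lie derivative along `u` in terms of the Levi-Civita connection. -/
theorem lieU_eq {S : Coord d → Tensor2 d} (b v : Fin d) :
    L.lieU S x b v = ∑ m, L.uUp x m * cov2 L.g S x m b v
      + ∑ i, ∑ k, L.gi x i k * L.W x b k * S x i v
      + ∑ i, ∑ k, L.gi x i k * L.W x v k * S x b i := by
  simp only [lieU, uDeriv, hL.pd_uUp hx, cov2, mul_sub, sub_mul, Finset.sum_sub_distrib,
    Finset.sum_mul, Finset.mul_sum]
  rw [Finset.sum_comm (f := fun m l => L.uUp x m * (christoffel L.g x l m b * S x l v)),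
    Finset.sum_comm (f := fun m l => L.uUp x m * (christoffel L.g x l m v * S x b l))]
  have h : ∀ b, ∀ f : Fin d → ℝ,
      ∑ l, ∑ m, L.uUp x m * (christoffel L.g x l m b * f l) =
      ∑ l, ∑ m, christoffel L.g x l b m * L.uUp x m * f l := fun b f =>
    Finset.sum_congr rfl fun l _ => Finset.sum_congr rfl fun m _ => by
      rw [hL.metric.christoffel_symm hx l m b]; ring
  rw [h b (fun l => S x l v), h v (fun l => S x b l)]
  ring

theorem sum_gi_u (k : Fin d) : ∑ i, L.gi x i k * L.u x i = L.uUp x k := by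
  rw [uUp]
  exact Finset.sum_congr rfl fun i _ => by rw [hL.gi_symm hx i k]

/-- Contraction with a tensor `W = K + ε u ⊗ a`. -/
theorem sum_gi_W_mul (b : Fin d) (f : Fin d → ℝ) :
    ∑ i, ∑ k, L.gi x i k * L.W x b k * f i = ∑ i, ∑ k, L.gi x i k * L.K x b k * f i
      + L.ε * L.u x b * ∑ i, ∑ k, L.gi x i k * L.acc x k * f i := by
  simp only [hL.W_eq hx, Finset.mul_sum, ← Finset.sum_add_distrib]
  exact Finset.sum_congr rfl fun i _ => Finset.sum_congr rfl fun k _ => by ring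

theorem lieU_K (b v : Fin d) :
    L.lieU L.K x b v = ∑ m, L.uUp x m * cov2 L.g L.K x m b v
      + ∑ i, ∑ k, L.gi x i k * L.K x b k * L.K x i v
      + ∑ i, ∑ k, L.gi x i k * L.K x v k * L.K x b i
      + L.ε * L.u x b * ∑ i, ∑ k, L.gi x i k * L.acc x k * L.K x i v
      + L.ε * L.u x v * ∑ i, ∑ k, L.gi x i k * L.acc x k * L.K x b i := by
  rw [hL.lieU_eq hx, hL.sum_gi_W_mul hx, hL.sum_gi_W_mul hx v]
  ring

theorem sum_gi_u_mul (f : Fin d → ℝ) :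
    ∑ i, ∑ k, L.gi x i k * L.u x i * f k = ∑ k, L.uUp x k * f k := by
  rw [Finset.sum_comm]
  exact Finset.sum_congr rfl fun k _ => by rw [← Finset.sum_mul, hL.sum_gi_u hx]

/-- The Ricci identity for the Riemann tensor. -/
theorem ricciIdentity : RicciIdentity L x (riem L.g x) := by
  intro b v
  have hR := hL.metric.isRiemannType_riem hx
  -- Pair symmetry of R puts the second contraction with u on an index of the commutator formula.
  have h1 : L.perp x (riem L.g x) b v =
      ∑ m, L.uUp x m * cov2 L.g L.W x b m v - ∑ m, L.uUp x m * cov2 L.g L.W x m b v := by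
    rw [← Finset.sum_sub_distrib]
    simp only [perp]
    refine Finset.sum_congr rfl fun a _ => ?_
    rw [← mul_sub, ← hL.sum_uUp_riem hx, Finset.mul_sum]
    exact Finset.sum_congr rfl fun m _ => by rw [hR.2.2.1 a b m v]; ring
  -- Leibniz for a_v = u^m W_{mv}: this trades one of the ∇∇u terms for ∇a and a quadratic term.
  have h2 : cov1 L.g L.acc x b v = ∑ m, L.uUp x m * cov2 L.g L.W x b m v
      + ∑ m, ∑ k, L.gi x m k * L.W x b k * L.W x m v := hL.cov1_contract hx (hL.smooth_W hx) b v
  -- The acceleration part of the second W contracts u with the differentiated index of ∇_b u, which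
  -- gives zero.
  have h3 : ∑ m, ∑ k, L.gi x m k * L.W x b k * L.W x m v =
      ∑ m, ∑ k, L.gi x m k * L.W x b k * L.K x m v := by
    have : ∀ m k, L.gi x m k * L.W x b k * L.W x m v = L.gi x m k * L.W x b k * L.K x m v
        + L.gi x m k * L.u x m * (L.W x b k * (L.ε * L.acc x v)) := fun m k => by
      rw [hL.W_eq hx m v]; ring
    simp only [this, Finset.sum_add_distrib, hL.sum_gi_u_mul hx]
    simp only [← mul_assoc, ← Finset.sum_mul, hL.sum_uUp_W hx]
    ring
  have h4 : ∑ m, L.uUp x m * cov2 L.g L.K x m b v = ∑ m, L.uUp x m * cov2 L.g L.W x m b v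
      - L.ε * (L.acc x b * L.acc x v
        + L.u x b * ∑ m, L.uUp x m * cov1 L.g L.acc x m v) := by
    have : L.acc x b = ∑ m, L.uUp x m * L.W x m b := rfl
    rw [this]
    simp only [hL.cov2_K hx, mul_sub, Finset.sum_sub_distrib, mul_add, Finset.sum_add_distrib,
      Finset.mul_sum, Finset.sum_mul]
    congr 1
    congr 1 <;> exact Finset.sum_congr rfl fun m _ => by ring
  -- Differentiate u^r a_r = 0.
  have h5 : ∀ m, ∑ r, L.uUp x r * cov1 L.g L.acc x m r =
      -∑ r, ∑ k, L.gi x r k * L.W x m k * L.acc x r := by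
    intro m
    have h := hL.pd_contract hx (hL.smooth_acc hx) m
    rw [pd_congr hL.metric.isOpen hx (fun y hy => hL.sum_uUp_acc hy), pd_const] at h
    linarith
  -- Projecting ∇a produces two correction terms with a factor u; they match those in £_u K.
  have h6 : L.D1 L.acc x b v = cov1 L.g L.acc x b v
      - L.ε * L.u x b * ∑ m, L.uUp x m * cov1 L.g L.acc x m v
      + L.ε * L.u x v * ∑ r, ∑ k, L.gi x r k * L.K x b k * L.acc x r := by
    have hv : ∀ m, L.pr x v (cov1 L.g L.acc x m) = cov1 L.g L.acc x m v
        + L.ε * L.u x v * ∑ r, ∑ k, L.gi x r k * L.W x m k * L.acc x r := by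
      intro m; rw [pr_eq, h5]; ring
    have hW : ∀ k, ∑ m, L.proj x m b * L.W x m k = L.K x b k := by
      intro k
      rw [K_eq_pr]
      simp only [pr_of_orth (hL.sum_uUp_W hx _)]
      rfl
    have hs : L.pr x b (fun m => ∑ r, ∑ k, L.gi x r k * L.W x m k * L.acc x r) =
        ∑ r, ∑ k, L.gi x r k * L.K x b k * L.acc x r := by
      simp only [pr, ← hW, Finset.mul_sum, Finset.sum_mul]
      rw [Finset.sum_comm]
      refine Finset.sum_congr rfl fun r _ => ?_
      rw [Finset.sum_comm]
      exact Finset.sum_congr rfl fun k _ => Finset.sum_congr rfl fun m _ => by ring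
    rw [D1_eq]
    simp only [hv]
    rw [pr_add, pr_const_mul, hs, pr_eq]
  have h7 : ∑ r, ∑ s, L.gi x r s * L.K x b r * L.K x v s =
      ∑ i, ∑ k, L.gi x i k * L.K x v k * L.K x b i :=
    Finset.sum_congr rfl fun i _ => Finset.sum_congr rfl fun k _ => by ring
  have h8 : ∑ r, ∑ k, L.gi x r k * L.K x b k * L.acc x r =
      ∑ i, ∑ k, L.gi x i k * L.acc x k * L.K x b i := by
    rw [Finset.sum_comm]
    exact Finset.sum_congr rfl fun i _ => Finset.sum_congr rfl fun k _ => by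
      rw [hL.gi_symm hx k i]; ring
  rw [h3, hL.sum_gi_W_mul hx] at h2
  rw [h1, h6, h7, hL.lieU_K hx, h4, h8]
  linear_combination -h2

end IsUnitNormal

end LocalData

/-! ### Linearity of the trace -/

section Trace

variable {d : ℕ} (gi : Tensor2 d)

theorem tr_add (S S' : Tensor2 d) : tr gi (fun a b => S a b + S' a b) = tr gi S + tr gi S' := by
  simp only [tr, mul_add, Finset.sum_add_distrib]

theorem tr_sub (S S' : Tensor2 d) : tr gi (fun a b => S a b - S' a b) = tr gi S - tr gi S' := by
  simp only [tr, mul_sub, Finset.sum_sub_distrib]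

theorem tr_const_mul (c : ℝ) (S : Tensor2 d) : tr gi (fun a b => c * S a b) = c * tr gi S := by
  simp only [tr, Finset.mul_sum, mul_left_comm c]

theorem tr_swap {gi : Tensor2 d} (h : ∀ a b, gi a b = gi b a) (S : Tensor2 d) :
    tr gi (fun a b => S b a) = tr gi S := by
  simp only [tr]
  rw [Finset.sum_comm]
  exact Finset.sum_congr rfl fun a _ => Finset.sum_congr rfl fun b _ => by rw [h]

theorem tr_sum {ι : Type*} (s : Finset ι) (c : ι → ℝ) (S : ι → Tensor2 d) :
    tr gi (fun a b => ∑ i ∈ s, c i * S i a b) = ∑ i ∈ s, c i * tr gi (S i) := by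
  simp only [tr, Finset.mul_sum]
  have h : ∀ a, ∑ b, ∑ i ∈ s, gi a b * (c i * S i a b) =
      ∑ i ∈ s, ∑ b, gi a b * (c i * S i a b) := fun a => Finset.sum_comm
  simp only [h]
  rw [Finset.sum_comm]
  exact Finset.sum_congr rfl fun i _ => Finset.sum_congr rfl fun a _ =>
    Finset.sum_congr rfl fun b _ => by ring

end Trace

/-! ### Traces over the orthogonal complement of u and the splitting of K -/

namespace LocalData

variable {d : ℕ} {L : LocalData d} {x : Coord d}

theorem tr_gamUp (S : Tensor2 d) : tr (L.gamUp x) S =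
    tr (L.gi x) S - L.ε * ∑ a, L.uUp x a * ∑ b, L.uUp x b * S a b := by
  simp only [tr, gamUp, sub_mul, Finset.sum_sub_distrib, Finset.mul_sum]
  congr 1
  exact Finset.sum_congr rfl fun a _ => Finset.sum_congr rfl fun b _ => by ring

theorem tr_gamUp_of_orth_right {S : Tensor2 d} (hS : ∀ a, ∑ b, L.uUp x b * S a b = 0) :
    tr (L.gamUp x) S = tr (L.gi x) S := by
  rw [tr_gamUp]; simp [hS]

theorem K_eq_shear (a b : Fin d) :
    L.K x a b = L.shear x a b + L.H x / ((d : ℝ) - 1) * L.gam x a b := by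
  simp only [shear]; ring

theorem square_orth {S : Tensor2 d} (hS : ∀ a, ∑ b, L.uUp x b * S a b = 0) (b : Fin d) :
    ∑ v, L.uUp x v * L.square x S b v = 0 := by
  simp only [square, Finset.mul_sum]
  rw [Finset.sum_comm]
  refine Finset.sum_eq_zero fun r _ => ?_
  rw [Finset.sum_comm]
  refine Finset.sum_eq_zero fun s _ => ?_
  simp only [mul_left_comm (L.uUp x _), ← Finset.mul_sum, hS, mul_zero]

theorem square_K_eq (hK : ∀ a b, L.K x a b = L.K x b a) (b v : Fin d) :
    ∑ r, ∑ s, L.gi x r s * L.K x b r * L.K x v s = L.square x (L.K x) b v :=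
  Finset.sum_congr rfl fun r _ => Finset.sum_congr rfl fun s _ => by rw [hK v s]

namespace IsUnitNormal

variable {U : Set (Coord d)} (hL : L.IsUnitNormal U) (hx : x ∈ U)
include hL hx

theorem gamUp_symm (a b : Fin d) : L.gamUp x a b = L.gamUp x b a := by
  simp only [gamUp, hL.gi_symm hx a b]; ring

theorem gam_symm (a b : Fin d) : L.gam x a b = L.gam x b a := by
  simp only [gam, hL.metric.symm x hx a b]; ring

theorem sum_uUp_gam (a : Fin d) : ∑ b, L.uUp x b * L.gam x a b = 0 := by
  simp only [gam, mul_sub, Finset.sum_sub_distrib]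
  have h1 := hL.u_eq hx a
  have h2 : ∑ b, L.uUp x b * (L.ε * L.u x a * L.u x b) = L.ε * L.u x a * L.ε := by
    rw [← hL.norm x hx, Finset.mul_sum]
    exact Finset.sum_congr rfl fun b _ => by rw [hL.norm x hx]; ring
  have h3 : ∑ b, L.uUp x b * L.g x a b = L.u x a := by
    rw [h1]; exact Finset.sum_congr rfl fun b _ => mul_comm _ _
  rw [h2, h3]
  linear_combination (-L.u x a) * hL.sq

theorem sum_gamUp_u (b : Fin d) : ∑ a, L.gamUp x a b * L.u x a = 0 := by
  simp only [gamUp, sub_mul, Finset.sum_sub_distrib, hL.sum_gi_u hx]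
  have : ∑ a, L.ε * L.uUp x a * L.uUp x b * L.u x a = L.ε * L.uUp x b * L.ε := by
    rw [← hL.norm x hx, Finset.mul_sum]
    exact Finset.sum_congr rfl fun b _ => by rw [hL.norm x hx]; ring
  rw [this]
  linear_combination (-L.uUp x b) * hL.sq

theorem tr_gamUp_u_mul (f : Fin d → ℝ) : tr (L.gamUp x) (fun a b => L.u x a * f b) = 0 := by
  simp only [tr]
  rw [Finset.sum_comm]
  refine Finset.sum_eq_zero fun b _ => ?_
  simp only [← mul_assoc, ← Finset.sum_mul, hL.sum_gamUp_u hx, zero_mul]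

theorem tr_gamUp_mul_u (f : Fin d → ℝ) : tr (L.gamUp x) (fun a b => f a * L.u x b) = 0 := by
  rw [← hL.tr_gamUp_u_mul hx f, ← tr_swap (hL.gamUp_symm hx)]
  simp only [mul_comm]

/-- Projecting changes S only by terms u ⊗ f and f ⊗ u, and γ^{ab} annihilates u. -/
theorem tr_gamUp_pr_pr (S : Tensor2 d) :
    tr (L.gamUp x) (fun a b => L.pr x a (fun m => L.pr x b (S m))) = tr (L.gamUp x) S := by
  have h : (fun a b => L.pr x a (fun m => L.pr x b (S m))) = fun a b =>
      (S a b - (fun c => L.ε * ∑ v, L.uUp x v * S c v) a * L.u x b) -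
        L.u x a * (L.ε * ∑ m, L.uUp x m * L.pr x b (S m)) := by
    funext a b; rw [pr_eq, pr_eq b (S a)]; ring
  rw [h, tr_sub, tr_sub, hL.tr_gamUp_u_mul hx, hL.tr_gamUp_mul_u hx]
  ring

/-- The metric contributes d, and u ⊗ u contributes ε · ε = 1. -/
theorem tr_gi_gam : tr (L.gi x) (L.gam x) = d - 1 := by
  have h1 : tr (L.gi x) (L.g x) = d := by
    rw [tr_eq_trace (hL.gi_symm hx)]
    change ((gMat L.g x)⁻¹ * gMat L.g x).trace = _
    rw [hL.metric.inv_mul_gMat hx]; simp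
  have h2 : tr (L.gi x) (fun a b => L.u x a * L.u x b) = L.ε := by
    rw [← hL.norm x hx]
    simp only [tr]
    rw [Finset.sum_comm]
    refine Finset.sum_congr rfl fun b _ => ?_
    rw [← hL.sum_gi_u hx, Finset.sum_mul]
    exact Finset.sum_congr rfl fun a _ => by ring
  have h3 : L.gam x = fun a b => L.g x a b - L.ε * (L.u x a * L.u x b) := by
    funext a b; simp only [gam]; ring
  rw [h3, tr_sub, tr_const_mul, h1, h2, hL.sq]

theorem H_eq : L.H x = tr (L.gi x) (L.K x) :=
  tr_gamUp_of_orth_right (hL.sum_uUp_K_right hx)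

theorem sum_uUp_shear_right (a : Fin d) : ∑ b, L.uUp x b * L.shear x a b = 0 := by
  simp only [shear, mul_sub, Finset.sum_sub_distrib, hL.sum_uUp_K_right hx,
    mul_left_comm _ (L.H x / ((d : ℝ) - 1)), ← Finset.mul_sum, hL.sum_uUp_gam hx]
  ring

theorem tr_shear (hd : (d : ℝ) - 1 ≠ 0) : tr (L.gi x) (L.shear x) = 0 := by
  have : L.shear x = fun a b => L.K x a b - L.H x / ((d : ℝ) - 1) * L.gam x a b := rfl
  rw [this, tr_sub, tr_const_mul, hL.tr_gi_gam hx, ← hL.H_eq hx]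
  field_simp; ring

theorem shear_symm (hK : ∀ a b, L.K x a b = L.K x b a) (a b : Fin d) :
    L.shear x a b = L.shear x b a := by
  simp only [shear, hK a b, hL.gam_symm hx a b]

/-- `S_{br} g^{rs} γ_{sv} = S_{bv}` for a covector orthogonal to `u`. -/
theorem sum_gi_gam {f : Fin d → ℝ} (hf : ∑ k, L.uUp x k * f k = 0) (v : Fin d) :
    ∑ r, ∑ s, L.gi x r s * f r * L.gam x s v = f v := by
  have h1 : ∀ r, ∑ s, L.gi x r s * L.gam x s v =
      (if r = v then 1 else 0) - L.ε * L.uUp x r * L.u x v := by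
    intro r
    have h := congrFun (congrFun (hL.metric.inv_mul_gMat hx) r) v
    simp only [Matrix.mul_apply, Matrix.one_apply] at h
    change ∑ s, L.gi x r s * L.g x s v = _ at h
    simp only [gam, mul_sub, Finset.sum_sub_distrib, h]
    congr 1
    rw [uUp]
    simp only [Finset.mul_sum, Finset.sum_mul]
    exact Finset.sum_congr rfl fun s _ => by ring
  simp only [mul_right_comm _ (f _), ← Finset.sum_mul, h1, sub_mul, Finset.sum_sub_distrib]
  have h2 : ∑ r, L.ε * L.uUp x r * L.u x v * f r = L.ε * L.u x v * ∑ r, L.uUp x r * f r := by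
    rw [Finset.mul_sum]; exact Finset.sum_congr rfl fun r _ => by ring
  rw [h2, hf]
  simp

/-- Expand K = σ + tγ, with t = H/(d-1); γ acts as the identity on tensors orthogonal to u. -/
theorem square_K (hK : ∀ a b, L.K x a b = L.K x b a) (b v : Fin d) :
    L.square x (L.K x) b v = L.square x (L.shear x) b v
      + 2 * (L.H x / ((d : ℝ) - 1)) * L.shear x b v
      + (L.H x / ((d : ℝ) - 1)) ^ 2 * L.gam x b v := by
  have h1 := hL.sum_gi_gam hx (hL.sum_uUp_shear_right hx b) v
  have h2 := hL.sum_gi_gam hx (hL.sum_uUp_shear_right hx v) b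
  have h3 := hL.sum_gi_gam hx (hL.sum_uUp_gam hx b) v
  have h2' : ∑ r, ∑ s, L.gi x r s * L.gam x b r * L.shear x s v = L.shear x b v := by
    rw [hL.shear_symm hx hK b v, ← h2, Finset.sum_comm]
    refine Finset.sum_congr rfl fun r _ => Finset.sum_congr rfl fun s _ => ?_
    rw [hL.gi_symm hx s r, hL.gam_symm hx b s, hL.shear_symm hx hK r v]; ring
  set t := L.H x / ((d : ℝ) - 1) with ht
  have : L.square x (L.K x) b v = L.square x (L.shear x) b v
      + t * ∑ r, ∑ s, L.gi x r s * L.shear x b r * L.gam x s v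
      + t * ∑ r, ∑ s, L.gi x r s * L.gam x b r * L.shear x s v
      + t ^ 2 * ∑ r, ∑ s, L.gi x r s * L.gam x b r * L.gam x s v := by
    simp only [square, Finset.mul_sum, ← Finset.sum_add_distrib]
    refine Finset.sum_congr rfl fun r _ => Finset.sum_congr rfl fun s _ => ?_
    rw [K_eq_shear, K_eq_shear, ← ht]; ring
  rw [this, h1, h2', h3]; ring

theorem tr_square_K (hd : (d : ℝ) - 1 ≠ 0) (hK : ∀ a b, L.K x a b = L.K x b a) :
    tr (L.gi x) (L.square x (L.K x)) =
      tr (L.gi x) (L.square x (L.shear x)) + L.H x ^ 2 / ((d : ℝ) - 1) := by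
  have h : L.square x (L.K x) = fun b v => (L.square x (L.shear x) b v
      + 2 * (L.H x / ((d : ℝ) - 1)) * L.shear x b v)
      + (L.H x / ((d : ℝ) - 1)) ^ 2 * L.gam x b v := by
    funext b v; exact hL.square_K hx hK b v
  rw [h, tr_add, tr_add, tr_const_mul, tr_const_mul, hL.tr_gi_gam hx, hL.tr_shear hx hd]
  field_simp; ring

theorem shearNormSq_eq (hK : ∀ a b, L.K x a b = L.K x b a) :
    L.shearNormSq x = tr (L.gi x) (L.square x (L.shear x)) := by
  simp only [shearNormSq, tr, square, Finset.mul_sum]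
  refine Finset.sum_congr rfl fun m _ => Finset.sum_congr rfl fun r _ =>
    Finset.sum_congr rfl fun v _ => Finset.sum_congr rfl fun s _ => ?_
  rw [hL.shear_symm hx hK r s]; ring

theorem square_shear_eq (hK : ∀ a b, L.K x a b = L.K x b a) (b v : Fin d) :
    ∑ r, ∑ s, L.gi x r s * L.shear x b r * L.shear x v s = L.square x (L.shear x) b v :=
  Finset.sum_congr rfl fun r _ => Finset.sum_congr rfl fun s _ => by
    rw [hL.shear_symm hx hK v s]

/-! ### The intrinsic derivative of the second fundamental form -/

theorem cov2_g (k m v : Fin d) : cov2 L.g L.g x k m v = 0 := by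
  have h := cov2_eq L.g L.g x k
  have h2 : mpd k (fun y => Matrix.of (L.g y)) x = _ := hL.metric.mpd_gMat hx k
  rw [h2] at h
  have h3 := congrFun (congrFun h m) v
  simpa [gMat] using h3

/-- Since ∇g = 0, only u ⊗ u is differentiated. Every term keeps an undifferentiated u, so the
projection Dγ vanishes. -/
theorem cov2_gam (k m v : Fin d) : cov2 L.g L.gam x k m v =
    -(L.ε * (L.W x k m * L.u x v + L.u x m * L.W x k v)) := by
  have h1 : ∀ i j, ContDiffAt ℝ ∞ (fun y => L.u y i * L.u y j) x := fun i j =>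
    (hL.smooth_u x hx i).mul (hL.smooth_u x hx j)
  rw [cov2_congr hL.metric.isOpen hx (S' := fun y a b => L.g y a b - L.ε * (L.u y a * L.u y b))
    (fun y hy i j => by simp only [gam]; ring),
    cov2_sub (hL.metric.smooth x hx) (fun i j => contDiffAt_const.mul (h1 i j)),
    cov2_fun_mul contDiffAt_const h1, pd_const, cov2_tensor (hL.smooth_u x hx) (hL.smooth_u x hx),
    hL.cov2_g hx]
  simp only [W]
  ring

theorem smooth_expansion : ContDiffAt ℝ ∞ (fun y => L.H y / ((d : ℝ) - 1)) x :=
  (hL.smooth_H hx).div_const _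

theorem pd_expansion (k : Fin d) :
    pd k (fun y => L.H y / ((d : ℝ) - 1)) x = pd k L.H x / ((d : ℝ) - 1) := by
  simp only [div_eq_inv_mul]
  exact pd_const_mul (hL.smooth_H hx) _ k

theorem cov2_K_shear (k m v : Fin d) : cov2 L.g L.K x k m v = cov2 L.g L.shear x k m v
    + (pd k L.H x / ((d : ℝ) - 1) * L.gam x m v
      + L.H x / ((d : ℝ) - 1) * cov2 L.g L.gam x k m v) := by
  rw [cov2_congr hL.metric.isOpen hx
    (S' := fun y a b => L.shear y a b + L.H y / ((d : ℝ) - 1) * L.gam y a b)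
    (fun y hy i j => K_eq_shear i j),
    cov2_add (hL.smooth_shear hx) (fun i j => (hL.smooth_expansion hx).mul (hL.smooth_gam hx i j)),
    cov2_fun_mul (hL.smooth_expansion hx) (hL.smooth_gam hx), hL.pd_expansion hx]

/-- Because Dγ = 0, the trace part of K contributes only the derivative of H. -/
theorem D2_K_shear (c a b : Fin d) : L.D2 L.K x c a b = L.D2 L.shear x c a b
    + L.D0 L.H x c / ((d : ℝ) - 1) * L.gam x a b := by
  have h : ∀ k m, L.pr x b (cov2 L.g L.K x k m) = L.pr x b (cov2 L.g L.shear x k m)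
      + (pd k L.H x / ((d : ℝ) - 1) * L.gam x m b
        - L.u x m * (L.H x / ((d : ℝ) - 1) * L.ε * L.pr x b (L.W x k))) := by
    intro k m
    have : cov2 L.g L.K x k m = fun v => cov2 L.g L.shear x k m v
        + ((pd k L.H x / ((d : ℝ) - 1) * L.gam x m v
          - (L.u x m * (L.H x / ((d : ℝ) - 1) * L.ε)) * L.W x k v)
          - (L.H x / ((d : ℝ) - 1) * L.ε * L.W x k m) * L.u x v) := by
      funext v; rw [hL.cov2_K_shear hx, hL.cov2_gam hx]; ring
    have hu : L.pr x b (fun v => L.u x v) = 0 := hL.pr_u hx b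
    have hg : L.pr x b (fun v => L.gam x m v) = L.gam x m b := pr_of_orth (hL.sum_uUp_gam hx m) b
    rw [this, pr_add, pr_sub, pr_sub, pr_const_mul, pr_const_mul, pr_const_mul, hu, hg]
    ring
  have hu : L.pr x a (fun v => L.u x v) = 0 := hL.pr_u hx a
  have hg : L.pr x a (fun m => L.gam x m b) = L.gam x a b := by
    simp only [hL.gam_symm hx _ b]
    exact pr_of_orth (hL.sum_uUp_gam hx b) a
  rw [D2_eq, D2_eq, D0_eq]
  simp only [h, pr_add, pr_sub, pr_const_mul, pr_mul_const, hu, hg, zero_mul, sub_zero,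
    div_eq_mul_inv]

theorem D2_symm {S : Coord d → Tensor2 d} (hS : ∀ y ∈ U, ∀ a b, S y a b = S y b a)
    (c a b : Fin d) : L.D2 S x c a b = L.D2 S x c b a := by
  rw [D2_eq, D2_eq]
  congr 1
  funext k
  rw [pr_comm]
  congr 1
  funext v
  congr 1
  funext m
  rw [cov2_congr hL.metric.isOpen hx hS k m v, cov2_transpose]

/-- `u^m u^v ∇_k S_{mv} = 0` for a tensor orthogonal to `u`. -/
theorem sum_uUp_uUp_cov2 {S : Coord d → Tensor2 d}
    (hS : ∀ i j, ContDiffAt ℝ ∞ (fun y => S y i j) x)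
    (hl : ∀ y ∈ U, ∀ b, ∑ a, L.uUp y a * S y a b = 0)
    (hr : ∀ a, ∑ b, L.uUp x b * S x a b = 0) (k : Fin d) :
    ∑ m, L.uUp x m * ∑ v, L.uUp x v * cov2 L.g S x k m v = 0 := by
  -- Differentiating u^m S_{mv} = 0 moves the derivative onto u; the remaining u^v then annihilates
  -- the undifferentiated S.
  have h : ∀ v, ∑ m, L.uUp x m * cov2 L.g S x k m v =
      -∑ m, ∑ j, L.gi x m j * L.W x k j * S x m v := by
    intro v
    have := hL.cov1_contract hx hS k v
    rw [cov1_congr hL.metric.isOpen hx (w' := fun _ _ => 0) (fun y hy i => hl y hy i),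
      cov1_zero] at this
    linarith
  have h2 : ∑ m, L.uUp x m * ∑ v, L.uUp x v * cov2 L.g S x k m v =
      ∑ v, L.uUp x v * ∑ m, L.uUp x m * cov2 L.g S x k m v := by
    simp only [Finset.mul_sum]
    rw [Finset.sum_comm]
    exact Finset.sum_congr rfl fun m _ => Finset.sum_congr rfl fun v _ => by ring
  rw [h2]
  simp only [h, mul_neg, Finset.sum_neg_distrib, Finset.mul_sum]
  rw [neg_eq_zero, Finset.sum_comm]
  refine Finset.sum_eq_zero fun m _ => ?_
  rw [Finset.sum_comm]
  refine Finset.sum_eq_zero fun j _ => ?_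
  simp only [mul_left_comm (L.uUp x _), ← Finset.mul_sum, hr, mul_zero]

/-- The traces over γ and over g differ by u^m u^v ∇_k K_{mv} = 0, and the full metric trace
commutes with ∇. -/
theorem tr_gamUp_cov2_K (k : Fin d) : tr (L.gamUp x) (cov2 L.g L.K x k) = pd k L.H x := by
  rw [tr_gamUp, hL.sum_uUp_uUp_cov2 hx (hL.smooth_K hx)
    (fun y hy => hL.sum_uUp_K_left hy) (hL.sum_uUp_K_right hx), mul_zero, sub_zero,
    pd_congr hL.metric.isOpen hx (fun y hy => hL.H_eq hy)]
  exact (pd_tr hL.metric hx (fun y hy => hL.smooth_K hy) k).symm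

theorem tr_gamUp_D2_K (c : Fin d) : tr (L.gamUp x) (L.D2 L.K x c) = L.D0 L.H x c := by
  have h : L.D2 L.K x c = fun a b => ∑ k, L.proj x k c *
      (fun k a b => L.pr x a (fun m => L.pr x b (cov2 L.g L.K x k m))) k a b := by
    funext a b; rw [D2_eq]; rfl
  rw [h, tr_sum]
  simp only [hL.tr_gamUp_pr_pr hx, hL.tr_gamUp_cov2_K hx]
  rfl

theorem sum_gamUp_gam {f : Fin d → ℝ} (hf : ∑ k, L.uUp x k * f k = 0) (v : Fin d) :
    ∑ c, ∑ k, L.gamUp x c k * (f c * L.gam x k v) = f v := by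
  rw [← hL.sum_gi_gam hx hf v]
  have : ∀ c k, L.gamUp x c k * (f c * L.gam x k v) = L.gi x c k * f c * L.gam x k v
      - L.ε * L.uUp x c * f c * (L.uUp x k * L.gam x k v) := fun c k => by
    simp only [gamUp]; ring
  have hg : ∑ k, L.uUp x k * L.gam x k v = 0 := by
    simp only [fun k => hL.gam_symm hx k v, hL.sum_uUp_gam hx]
  simp [this, Finset.sum_sub_distrib, ← Finset.mul_sum, hg]

theorem div2_K (v : Fin d) : L.div2 L.K x v =
    L.div2 L.shear x v + L.D0 L.H x v / ((d : ℝ) - 1) := by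
  have hf : ∑ k, L.uUp x k * L.D0 L.H x k = 0 := by
    simp only [D0_eq, hL.uUp_pr hx]
  simp only [div2, hL.D2_K_shear hx, mul_add, Finset.sum_add_distrib]
  congr 1
  rw [← hL.sum_gamUp_gam hx hf v, Finset.sum_div]
  refine Finset.sum_congr rfl fun c _ => ?_
  rw [Finset.sum_div]
  exact Finset.sum_congr rfl fun k _ => by ring

/-! ### The decomposition of the Codazzi identity -/

/-- T^{⊥∥} is its hat part plus a term linear in its trace, so both together determine it. On the
right-hand side DH appears as γ_{mb} D_v H - γ_{vb} D_m H, which the hat removes. Symmetry of K is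
required on `U` because it is differentiated. -/
theorem codazzi_iff (hd : (d : ℝ) - 1 ≠ 0) (hd2 : (d : ℝ) - 2 ≠ 0)
    (hK : ∀ y ∈ U, ∀ a b, L.K y a b = L.K y b a) (T : Tensor4 d) :
    CodazziIdentity L x T ↔ CodazziDecomposed L x T := by
  -- The trace is D_v H minus the divergence of K; that divergence contains D_v H / (d-1), whence
  -- the factor (d-2)/(d-1).
  have htr : ∀ v, ∑ a, ∑ b, L.gamUp x a b * (L.D2 L.K x v b a - L.D2 L.K x b v a) =
      ((d : ℝ) - 2) / ((d : ℝ) - 1) * L.D0 L.H x v - L.div2 L.shear x v := by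
    intro v
    simp only [mul_sub, Finset.sum_sub_distrib]
    have h1 : ∑ a, ∑ b, L.gamUp x a b * L.D2 L.K x v b a = L.D0 L.H x v := by
      rw [← hL.tr_gamUp_D2_K hx v, ← tr_swap (hL.gamUp_symm hx)]; rfl
    have h2 : ∑ a, ∑ b, L.gamUp x a b * L.D2 L.K x b v a = L.div2 L.K x v := by
      rw [Finset.sum_comm]
      refine Finset.sum_congr rfl fun b _ => Finset.sum_congr rfl fun a _ => ?_
      rw [hL.gamUp_symm hx a b, hL.D2_symm hx hK]
    rw [h1, h2, hL.div2_K hx]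
    field_simp; ring
  constructor
  · intro h
    have hT : ∀ v, L.perpParTr x T v =
        ((d : ℝ) - 2) / ((d : ℝ) - 1) * L.D0 L.H x v - L.div2 L.shear x v := by
      intro v
      rw [← htr]
      simp only [perpParTr, h _ _ _]
    refine ⟨fun b m v => ?_, hT⟩
    simp only [perpParHat, h b m v, hT, hL.D2_K_shear hx, hL.gam_symm hx m b, hL.gam_symm hx v b]
    field_simp; ring
  · rintro ⟨h1, h2⟩ b m v
    have h := h1 b m v
    simp only [perpParHat, h2] at h
    rw [hL.D2_K_shear hx, hL.D2_K_shear hx, hL.gam_symm hx m b, hL.gam_symm hx v b]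
    rw [eq_sub_of_add_eq h]
    field_simp; ring

end IsUnitNormal

end LocalData

namespace LocalData

variable {d : ℕ} {L : LocalData d} {x : Coord d}

namespace IsUnitNormal

variable {U : Set (Coord d)} (hL : L.IsUnitNormal U) (hx : x ∈ U)
include hL hx

/-! ### The decomposition of the Ricci identity -/

/-- The symmetrized ∇u contributes 2K plus acceleration terms, which cancel those of ∇_u γ. -/
theorem lieU_gam (hK : ∀ a b, L.K x a b = L.K x b a) (b v : Fin d) :
    L.lieU L.gam x b v = 2 * L.K x b v := by
  have h1 : ∑ m, L.uUp x m * cov2 L.g L.gam x m b v =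
      -(L.ε * (L.acc x b * L.u x v + L.u x b * L.acc x v)) := by
    have : ∀ b, L.acc x b = ∑ m, L.uUp x m * L.W x m b := fun _ => rfl
    simp only [hL.cov2_gam hx, this, Finset.mul_sum, Finset.sum_mul, ← Finset.sum_add_distrib,
      ← Finset.sum_neg_distrib]
    exact Finset.sum_congr rfl fun m _ => by ring
  have h2 : ∀ b v, ∑ i, ∑ k, L.gi x i k * L.W x b k * L.gam x i v = L.W x b v := by
    intro b v
    rw [← hL.sum_gi_gam hx (hL.sum_uUp_W hx b) v, Finset.sum_comm]
    exact Finset.sum_congr rfl fun i _ => Finset.sum_congr rfl fun k _ => by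
      rw [hL.gi_symm hx]
  rw [hL.lieU_eq hx, h1, h2]
  simp only [fun i => hL.gam_symm hx b i, h2]
  rw [hL.W_eq hx, hL.W_eq hx, hK v b]
  ring

/-- Leibniz rule for K = σ + tγ, together with £_u γ = 2K. -/
theorem lieU_K_shear (hK : ∀ a b, L.K x a b = L.K x b a) (b v : Fin d) :
    L.lieU L.K x b v = L.lieU L.shear x b v + L.uDeriv L.H x / ((d : ℝ) - 1) * L.gam x b v
      + 2 * (L.H x / ((d : ℝ) - 1)) * L.K x b v := by
  have h : L.uDeriv (fun y => L.K y b v) x = L.uDeriv (fun y => L.shear y b v) x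
      + L.uDeriv L.H x / ((d : ℝ) - 1) * L.gam x b v
      + L.H x / ((d : ℝ) - 1) * L.uDeriv (fun y => L.gam y b v) x := by
    have h1 : ∀ i, pd i (fun y => L.K y b v) x = pd i (fun y => L.shear y b v) x
        + (pd i L.H x / ((d : ℝ) - 1) * L.gam x b v
          + L.H x / ((d : ℝ) - 1) * pd i (fun y => L.gam y b v) x) := by
      intro i
      rw [← hL.pd_expansion hx, ← pd_mul (hL.smooth_expansion hx) (hL.smooth_gam hx b v),
        ← pd_add (hL.smooth_shear hx b v)
          ((hL.smooth_expansion hx).mul (hL.smooth_gam hx b v))]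
      simp only [K_eq_shear]
    simp only [uDeriv, h1, Finset.sum_div, Finset.mul_sum, Finset.sum_mul,
      ← Finset.sum_add_distrib]
    exact Finset.sum_congr rfl fun i _ => by ring
  have hg := hL.lieU_gam hx hK b v
  have e1 : ∀ c : Fin d, ∀ S T V : Fin d → ℝ, ∀ t : ℝ,
      (∀ i, S i = T i + t * V i) → ∑ i, pd c (fun y => L.uUp y i) x * S i =
      ∑ i, pd c (fun y => L.uUp y i) x * T i + t * ∑ i, pd c (fun y => L.uUp y i) x * V i := by
    intro c S T V t hS
    simp only [hS, Finset.mul_sum, ← Finset.sum_add_distrib]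
    exact Finset.sum_congr rfl fun i _ => by ring
  rw [show 2 * (L.H x / ((d : ℝ) - 1)) * L.K x b v =
    L.H x / ((d : ℝ) - 1) * L.lieU L.gam x b v by rw [hg]; ring]
  simp only [lieU]
  rw [h, e1 b _ _ _ _ (fun i => K_eq_shear i v), e1 v _ _ _ _ (fun i => K_eq_shear b i)]
  ring

/-- The trace does not commute with £_u: writing £_u through ∇_u adds two copies of K², while the
acceleration terms carry a factor u and are traceless. -/
theorem tr_gamUp_lieU_K (hK : ∀ a b, L.K x a b = L.K x b a) :
    tr (L.gamUp x) (L.lieU L.K x) =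
      L.uDeriv L.H x + 2 * tr (L.gi x) (L.square x (L.K x)) := by
  have hs1 : ∀ b v, ∑ i, ∑ k, L.gi x i k * L.K x b k * L.K x i v = L.square x (L.K x) b v := by
    intro b v
    simp only [square]
    rw [Finset.sum_comm]
    exact Finset.sum_congr rfl fun i _ => Finset.sum_congr rfl fun k _ => by
      rw [hL.gi_symm hx]
  have hs2 : ∀ b v, ∑ i, ∑ k, L.gi x i k * L.K x v k * L.K x b i = L.square x (L.K x) b v := by
    intro b v
    exact Finset.sum_congr rfl fun i _ => Finset.sum_congr rfl fun k _ => by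
      rw [hK v k]; ring
  have h : L.lieU L.K x = fun b v => (((∑ m, L.uUp x m * cov2 L.g L.K x m b v)
      + 2 * L.square x (L.K x) b v)
      + L.u x b * (L.ε * ∑ i, ∑ k, L.gi x i k * L.acc x k * L.K x i v))
      + (L.ε * ∑ i, ∑ k, L.gi x i k * L.acc x k * L.K x b i) * L.u x v := by
    funext b v
    rw [hL.lieU_K hx, hs1, hs2]; ring
  rw [h, tr_add, tr_add, tr_add, tr_sum, tr_const_mul, hL.tr_gamUp_u_mul hx, hL.tr_gamUp_mul_u hx,
    tr_gamUp_of_orth_right (square_orth (hL.sum_uUp_K_right hx))]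
  simp only [hL.tr_gamUp_cov2_K hx, uDeriv]
  ring

theorem tr_gamUp_acc :
    tr (L.gamUp x) (fun a b => L.acc x a * L.acc x b) = L.accSq x := by
  rw [tr_gamUp_of_orth_right]
  · simp only [tr, accSq, mul_assoc]
  · intro a
    simp only [mul_left_comm _ (L.acc x a), ← Finset.mul_sum, hL.sum_uUp_acc hx, mul_zero]

/-- A 2-tensor is equivalent to its trace and trace-free part, so it suffices to split the
right-hand side `X`. -/
theorem ricci_iff (hd : (d : ℝ) - 1 ≠ 0) (hK : ∀ a b, L.K x a b = L.K x b a) (T : Tensor4 d) :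
    RicciIdentity L x T ↔ RicciDecomposed L x T := by
  set X : Tensor2 d := fun b v => L.D1 L.acc x b v - L.ε * L.acc x b * L.acc x v
      + (∑ r, ∑ s, L.gi x r s * L.K x b r * L.K x v s) - L.lieU L.K x b v with hX
  have hXtr : tr (L.gamUp x) X = L.div1 L.acc x - L.ε * L.accSq x - L.shearNormSq x
      - L.H x ^ 2 / ((d : ℝ) - 1) - L.uDeriv L.H x := by
    have h : X = fun b v => ((L.D1 L.acc x b v - L.ε * (L.acc x b * L.acc x v))
        + L.square x (L.K x) b v) - L.lieU L.K x b v := by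
      funext b v
      simp only [hX, square_K_eq hK]
      ring
    rw [h, tr_sub, tr_add, tr_sub, tr_const_mul, hL.tr_gamUp_acc hx, hL.tr_gamUp_lieU_K hx hK,
      tr_gamUp_of_orth_right (square_orth (hL.sum_uUp_K_right hx)), hL.tr_square_K hx hd hK,
      hL.shearNormSq_eq hx hK, div1]
    ring
  -- With t = H/(d-1), the terms 2tσ of K² and of £_u K cancel, and the remaining multiples of γ by
  -- H² and u(H) are those subtracted with the trace.
  have hXhat : ∀ b v, X b v - (L.div1 L.acc x - L.ε * L.accSq x - L.shearNormSq x
      - L.H x ^ 2 / ((d : ℝ) - 1) - L.uDeriv L.H x) / ((d : ℝ) - 1) * L.gam x b v =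
      L.D1 L.acc x b v - L.ε * L.acc x b * L.acc x v
      + 1 / ((d : ℝ) - 1) *
        (-L.div1 L.acc x + L.ε * L.accSq x + L.shearNormSq x) * L.gam x b v
      + (∑ r, ∑ s, L.gi x r s * L.shear x b r * L.shear x v s) - L.lieU L.shear x b v := by
    intro b v
    simp only [hX, square_K_eq hK, hL.square_shear_eq hx hK, hL.square_K hx hK,
      hL.lieU_K_shear hx hK]
    rw [K_eq_shear b v]
    field_simp
    ring
  have hiff : RicciIdentity L x T ↔ ∀ b v, L.perp x T b v = X b v := Iff.rfl
  rw [hiff]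
  constructor
  · intro h
    have htr : L.perpTr x T = tr (L.gamUp x) X := by
      simp only [perpTr, funext fun b => funext (h b)]
    refine ⟨htr.trans hXtr, fun b v => ?_⟩
    rw [← hXhat]
    simp only [perpHat, traceFree, htr, hXtr, h b v]
  · rintro ⟨h1, h2⟩ b v
    have h := h2 b v
    rw [← hXhat] at h
    simp only [perpHat, traceFree, h1] at h
    linarith

end IsUnitNormal

end LocalData

/-! ### The decomposition of the Gauss identity -/

section KulkarniNomizu

variable {d : ℕ}

theorem ric_add (gi : Tensor2 d) (T T' : Tensor4 d) (b v : Fin d) :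
    ric gi (fun a b m v => T a b m v + T' a b m v) b v = ric gi T b v + ric gi T' b v := by
  simp only [ric, mul_add, Finset.sum_add_distrib]

theorem ric_const_mul (gi : Tensor2 d) (c : ℝ) (T : Tensor4 d) (b v : Fin d) :
    ric gi (fun a b m v => c * T a b m v) b v = c * ric gi T b v := by
  simp only [ric, Finset.mul_sum, mul_left_comm c]

theorem ric_kn_self (gi A : Tensor2 d) (hgi : ∀ a b, gi a b = gi b a) (b v : Fin d) :
    ric gi (kn A A) b v =
      2 * (tr gi A * A b v) - 2 * ∑ r, ∑ s, gi r s * A b r * A s v := by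
  simp only [ric, kn, tr, Finset.sum_mul, Finset.mul_sum, ← Finset.sum_sub_distrib]
  have h : ∀ a c, gi a c * (A a c * A b v - A a v * A b c - A b c * A a v + A b v * A a c) =
      2 * (gi a c * A a c * A b v) - 2 * (gi c a * A b c * A a v) := fun a c => by
    rw [hgi c a]; ring
  simp only [h, Finset.sum_sub_distrib]
  congr 1
  exact Finset.sum_comm

end KulkarniNomizu

namespace LocalData

variable {d : ℕ} {L : LocalData d} {x : Coord d}

/-- The curvature tensors in `S` are related to each other as those of a metric are. -/
structure IsCompatible (L : LocalData d) (x : Coord d) (S : LeafCurvature d) : Prop where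
  ric_eq : ∀ b v, S.Ric b v = ric (L.gi x) S.Riem b v
  scal_eq : S.Scal = scal (L.gi x) S.Riem
  weyl_eq : ∀ a b m v, S.Weyl a b m v =
    weyl ((d : ℝ) - 1) (L.gi x) (L.gam x) S.Riem a b m v

/-- By its definition, Weyl_u together with Ric and Scal reconstructs T^∥, so it suffices to compute
these three for the right-hand side `X`. -/
theorem IsUnitNormal.gauss_iff {U : Set (Coord d)} (hL : L.IsUnitNormal U) (hx : x ∈ U)
    (hd1 : (d : ℝ) - 1 ≠ 0) (hd2 : (d : ℝ) - 2 ≠ 0) (hd3 : (d : ℝ) - 3 ≠ 0)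
    (hK : ∀ a b, L.K x a b = L.K x b a) {S : LeafCurvature d} (hS : IsCompatible L x S)
    (T : Tensor4 d) :
    GaussIdentity L S x T ↔ GaussDecomposed L S x T := by
  -- The factor 1/2 appears because K ∧ K contains each of its products twice.
  set X : Tensor4 d := fun a b m v => S.Riem a b m v + (-(L.ε / 2)) * kn (L.K x) (L.K x) a b m v
    with hX
  have hiff : GaussIdentity L S x T ↔ ∀ a b m v, L.par x T a b m v = X a b m v := by
    have : ∀ a b m v, S.Riem a b m v - L.ε * L.K x a m * L.K x b v
        + L.ε * L.K x a v * L.K x b m = X a b m v := by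
      intro a b m v
      simp only [hX, kn]; ring
    simp only [GaussIdentity, this]
  have hH := hL.H_eq hx
  have hXric : ∀ b v, ric (L.gi x) X b v =
      S.Ric b v - L.ε * (L.H x * L.K x b v) + L.ε * L.square x (L.K x) b v := by
    intro b v
    rw [hX, ric_add, ric_const_mul, ric_kn_self _ _ (hL.gi_symm hx), ← hH, hS.ric_eq]
    simp only [square]; ring
  have htrσ : tr (L.gamUp x) (L.square x (L.shear x)) = tr (L.gi x) (L.square x (L.shear x)) :=
    tr_gamUp_of_orth_right (square_orth (hL.sum_uUp_shear_right hx))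
  set τ := tr (L.gi x) (L.square x (L.shear x)) with hτ
  have hXscal : scal (L.gi x) X = S.Scal + L.ε * τ
      - L.ε * ((d : ℝ) - 2) / ((d : ℝ) - 1) * L.H x ^ 2 := by
    have h : ric (L.gi x) X = fun b v => (S.Ric b v - L.ε * L.H x * L.K x b v)
        + L.ε * L.square x (L.K x) b v := by
      funext b v; rw [hXric]; ring
    have hR : S.Ric = ric (L.gi x) S.Riem := funext fun b => funext (hS.ric_eq b)
    rw [scal, h, tr_add, tr_sub, tr_const_mul, tr_const_mul, hL.tr_square_K hx hd1 hK, ← hH,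
      ← hτ, hS.scal_eq, scal, hR]
    field_simp; ring
  have hXhat : ∀ b v, ric (L.gi x) X b v - scal (L.gi x) X / ((d : ℝ) - 1) * L.gam x b v =
      traceFree ((d : ℝ) - 1) (L.gam x) S.Scal S.Ric b v
      + L.ε * (L.square x (L.shear x) b v - τ / ((d : ℝ) - 1) * L.gam x b v)
      - L.ε * ((d : ℝ) - 3) / ((d : ℝ) - 1) * L.H x * L.shear x b v := by
    intro b v
    rw [hXscal, hXric, hL.square_K hx hK, K_eq_shear b v, traceFree]
    field_simp; ring
  -- The two terms with H are exactly those whose product with γ cancels the H-dependence of (ε/2) K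
  -- ∧ K; the terms in σ² and τ = tr σ² survive in the Weyl part.
  have hsch : ∀ b v, sch ((d : ℝ) - 1) (L.gi x) (L.gam x) X b v =
      sch ((d : ℝ) - 1) (L.gi x) (L.gam x) S.Riem b v
      + L.ε / ((d : ℝ) - 3) * L.square x (L.shear x) b v
      - L.ε * (L.H x / ((d : ℝ) - 1)) * L.shear x b v
      - L.ε * τ / (2 * ((d : ℝ) - 2) * ((d : ℝ) - 3)) * L.gam x b v
      - L.ε / 2 * (L.H x / ((d : ℝ) - 1)) ^ 2 * L.gam x b v := by
    intro b v
    simp only [sch]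
    rw [hXscal, hXric, hL.square_K hx hK, K_eq_shear b v, hS.ric_eq, hS.scal_eq,
      show (d : ℝ) - 1 - 2 = (d : ℝ) - 3 by ring, show (d : ℝ) - 1 - 1 = (d : ℝ) - 2 by ring]
    field_simp; ring
  have hXweyl : ∀ a b m v, weyl ((d : ℝ) - 1) (L.gi x) (L.gam x) X a b m v =
      S.Weyl a b m v - L.ε / 2 * kn (L.shear x) (L.shear x) a b m v
      - L.ε / ((d : ℝ) - 3) * kn (L.square x (L.shear x)) (L.gam x) a b m v
      + L.ε * τ / (2 * ((d : ℝ) - 2) * ((d : ℝ) - 3)) * kn (L.gam x) (L.gam x) a b m v := by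
    intro a b m v
    rw [hS.weyl_eq]
    simp only [weyl, kn, hsch]
    simp only [hX, kn]
    simp only [K_eq_shear]
    ring
  rw [hiff]
  constructor
  · intro h
    have hT : L.par x T = X := by
      funext a b m v; exact h a b m v
    refine ⟨?_, fun b v => ?_, fun a b m v => ?_⟩
    · rw [htrσ, scalPar, hT, hXscal]
    · rw [htrσ, ← hXhat, ricParHat, scalPar, ricPar, hT, traceFree]
    · rw [htrσ, ← hXweyl, weylPar, hT]
  · rintro ⟨h1, h2, h3⟩ a b m v
    rw [htrσ, ← hXscal] at h1
    have h1' : scal (L.gi x) (L.par x T) = scal (L.gi x) X := h1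
    have hric : ∀ b v, ric (L.gi x) (L.par x T) b v = ric (L.gi x) X b v := by
      intro b v
      have h := h2 b v
      rw [htrσ, ← hXhat] at h
      simp only [ricParHat, traceFree, scalPar, h1', ricPar] at h
      linarith
    have h := h3 a b m v
    rw [htrσ, ← hXweyl] at h
    simp only [weylPar, weyl, kn, sch, hric, h1'] at h
    linarith

end LocalData

/-! ### Pull-back of covariant indices by a matrix -/

section PullBack

variable {ι κ τ : Type*} [Fintype ι]

/-- Pull-back of one covariant index by the matrix `M`. -/
def pl (M : Matrix ι κ ℝ) (a : κ) (f : ι → ℝ) : ℝ := ∑ p, M p a * f p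

theorem pl_add (M : Matrix ι κ ℝ) (a : κ) (f g : ι → ℝ) :
    pl M a (fun p => f p + g p) = pl M a f + pl M a g := by
  simp only [pl, mul_add, Finset.sum_add_distrib]

theorem pl_sub (M : Matrix ι κ ℝ) (a : κ) (f g : ι → ℝ) :
    pl M a (fun p => f p - g p) = pl M a f - pl M a g := by
  simp only [pl, mul_sub, Finset.sum_sub_distrib]

theorem pl_const_mul (M : Matrix ι κ ℝ) (a : κ) (c : ℝ) (f : ι → ℝ) :
    pl M a (fun p => c * f p) = c * pl M a f := by
  simp only [pl, Finset.mul_sum, mul_left_comm c]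

theorem pl_mul_const (M : Matrix ι κ ℝ) (a : κ) (c : ℝ) (f : ι → ℝ) :
    pl M a (fun p => f p * c) = pl M a f * c := by
  simp only [pl, Finset.sum_mul, mul_assoc]

theorem pl_comm {ι' κ' : Type*} [Fintype ι'] (M : Matrix ι κ ℝ) (N : Matrix ι' κ' ℝ)
    (a : κ) (b : κ') (f : ι → ι' → ℝ) :
    pl M a (fun p => pl N b (f p)) = pl N b (fun q => pl M a (fun p => f p q)) := by
  simp only [pl, Finset.mul_sum]
  rw [Finset.sum_comm]
  exact Finset.sum_congr rfl fun _ _ => Finset.sum_congr rfl fun _ _ => by ring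

theorem pl_mul [Fintype κ] (M : Matrix ι κ ℝ) (N : Matrix κ τ ℝ) (a : τ) (f : ι → ℝ) :
    pl (M * N) a f = pl N a (fun b => pl M b f) := by
  simp only [pl, Matrix.mul_apply, Finset.mul_sum, Finset.sum_mul]
  rw [Finset.sum_comm]
  exact Finset.sum_congr rfl fun _ _ => Finset.sum_congr rfl fun _ _ => by ring

theorem transpose_mul_mul_apply (M : Matrix ι κ ℝ) (S : Matrix ι ι ℝ) (a b : κ) :
    (M.transpose * S * M) a b = pl M a (fun p => pl M b (S p)) := by
  simp only [Matrix.mul_apply, pl, Matrix.transpose_apply, Finset.sum_mul, Finset.mul_sum]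
  rw [Finset.sum_comm]
  exact Finset.sum_congr rfl fun _ _ => Finset.sum_congr rfl fun _ _ => by ring

end PullBack

/-! ### Hypersurfaces in coordinates -/

/-- The Jacobian matrix of `φ`. -/
def jac {k d : ℕ} (φ : Coord k → Coord d) (y : Coord k) : Matrix (Fin d) (Fin k) ℝ :=
  Matrix.of fun i A => pd A (fun z => φ z i) y

/-- `φ` parametrizes, on `V`, a hypersurface orthogonal to the unit normal of `L`, with first
fundamental form `h`. -/
structure IsLeafChart {k d : ℕ} (L : LocalData d) (U : Set (Coord d)) (φ : Coord k → Coord d)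
    (h : Coord k → Tensor2 k) (V : Set (Coord k)) : Prop where
  isOpen : IsOpen V
  smooth : ∀ y ∈ V, ∀ i, ContDiffAt ℝ ∞ (fun z => φ z i) y
  mapsTo : ∀ y ∈ V, φ y ∈ U
  metric : ∀ y ∈ V, gMat h y = (jac φ y).transpose * gMat L.g (φ y) * jac φ y
  orth : ∀ y ∈ V, row (L.u (φ y)) * jac φ y = 0
  span : ∀ y ∈ V, ∀ v : Fin d → ℝ, ∑ i, L.u (φ y) i * v i = 0 →
    ∃ α : Fin k → ℝ, v = (jac φ y).mulVec α
  inj : ∀ y ∈ V, ∀ α : Fin k → ℝ, (jac φ y).mulVec α = 0 → α = 0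

namespace IsLeafChart

variable {k d : ℕ} {L : LocalData d} {U : Set (Coord d)} {φ : Coord k → Coord d}
  {h : Coord k → Tensor2 k} {V : Set (Coord k)}

/-- The pull-back `Γ_A` of the connection along `φ`. -/
def pullConn (G : Coord d → Tensor2 d) (φ : Coord k → Coord d) (A : Fin k) (y : Coord k) :
    Matrix (Fin d) (Fin d) ℝ :=
  Matrix.of fun a b => pl (jac φ y) A (fun j => conn G j (φ y) a b)

/-- The covariant derivative along `φ` of the coordinate vector fields `∂_B φ`. -/
def hess (G : Coord d → Tensor2 d) (φ : Coord k → Coord d) (A : Fin k) (y : Coord k) :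
    Matrix (Fin d) (Fin k) ℝ :=
  mpd A (jac φ) y + pullConn G φ A y * jac φ y

/-- The second fundamental form of the hypersurface. -/
def kk (L : LocalData d) (φ : Coord k → Coord d) (y : Coord k) (A B : Fin k) : ℝ :=
  pl (jac φ y) A (fun i => pl (jac φ y) B (L.W (φ y) i))

variable (hL : L.IsUnitNormal U) (hφ : IsLeafChart L U φ h V) {y : Coord k} (hy : y ∈ V)
include hφ hy

theorem smooth_jac : MSmoothAt (jac φ) y := fun i A => contDiffAt_pd (hφ.smooth y hy i) A

theorem mpd_jac_symm (A B : Fin k) (i : Fin d) :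
    mpd A (jac φ) y i B = mpd B (jac φ) y i A := pd_comm (hφ.smooth y hy i) A B

theorem mpd_comp {ι κ : Type*} {M : Coord d → Matrix ι κ ℝ} (hM : MSmoothAt M (φ y)) (A : Fin k) :
    mpd A (fun z => M (φ z)) y = Matrix.of fun a b => pl (jac φ y) A (fun j => mpd j M (φ y) a b) := by
  ext a b
  exact pd_comp (f := fun x => M x a b) (hM a b) (hφ.smooth y hy) A

theorem smooth_comp {ι κ : Type*} {M : Coord d → Matrix ι κ ℝ} (hM : MSmoothAt M (φ y)) :
    MSmoothAt (fun z => M (φ z)) y := fun a b =>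
  (hM a b).comp (f := φ) (g := fun x => M x a b) y (contDiffAt_euclidean.2 (hφ.smooth y hy))

include hL

theorem smooth_pullConn (A : Fin k) : MSmoothAt (pullConn L.g φ A) y := by
  intro a b
  change ContDiffAt ℝ ∞ (fun z => ∑ j, jac φ z j A * conn L.g j (φ z) a b) y
  exact ContDiffAt.sum fun j _ => (hφ.smooth_jac hy j A).mul
    (hφ.smooth_comp hy (hL.metric.conn_smooth (hφ.mapsTo y hy) j) a b)

theorem smooth_hess (A : Fin k) : MSmoothAt (hess L.g φ A) y :=
  ((hφ.smooth_jac hy).mpd A).add ((smooth_pullConn hL hφ hy A).mul (hφ.smooth_jac hy))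

/-- Second partial derivatives of φ commute, and the ambient connection is torsion-free. -/
theorem hess_symm (A B : Fin k) (i : Fin d) : hess L.g φ A y i B = hess L.g φ B y i A := by
  have hs : ∀ A B, (pullConn L.g φ A y * jac φ y) i B =
      pl (jac φ y) B (fun l => pl (jac φ y) A (fun j => conn L.g j (φ y) i l)) := by
    intro A B
    simp only [Matrix.mul_apply, pullConn, Matrix.of_apply, mul_comm]
    rfl
  simp only [hess, Matrix.add_apply, hφ.mpd_jac_symm hy A B, hs]
  congr 1
  rw [pl_comm]
  have : ∀ j l, conn L.g j (φ y) i l = conn L.g l (φ y) i j := fun j l =>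
    hL.metric.christoffel_symm (hφ.mapsTo y hy) i j l
  simp only [this]

/-- Chain rule and ∇g = 0: the pulled-back connection preserves g along φ. -/
theorem mpd_gMat_comp (A : Fin k) : mpd A (fun z => gMat L.g (φ z)) y =
    (pullConn L.g φ A y).transpose * gMat L.g (φ y) + gMat L.g (φ y) * pullConn L.g φ A y := by
  rw [hφ.mpd_comp hy (hL.metric.gMat_smooth (hφ.mapsTo y hy))]
  simp only [hL.metric.mpd_gMat (hφ.mapsTo y hy)]
  ext a b
  simp only [Matrix.add_apply, Matrix.of_apply, pl_add]
  congr 1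
  · simp only [Matrix.mul_apply, Matrix.transpose_apply, pullConn, Matrix.of_apply, pl,
      Finset.mul_sum, Finset.sum_mul]
    rw [Finset.sum_comm]
    exact Finset.sum_congr rfl fun _ _ => Finset.sum_congr rfl fun _ _ => by ring
  · simp only [Matrix.mul_apply, pullConn, Matrix.of_apply, pl, Finset.mul_sum]
    rw [Finset.sum_comm]
    exact Finset.sum_congr rfl fun _ _ => Finset.sum_congr rfl fun _ _ => by ring

theorem gMat_transpose_comp : (gMat L.g (φ y)).transpose = gMat L.g (φ y) :=
  hL.metric.gMat_transpose (hφ.mapsTo y hy)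

theorem uRow_mul_uUp : row (L.u (φ y)) * (row (L.uUp (φ y))).transpose = L.ε • 1 := by
  ext a b
  simp only [Matrix.mul_apply, row, Matrix.of_apply, Matrix.transpose_apply, Matrix.smul_apply,
    Matrix.one_apply]
  rw [← hL.norm _ (hφ.mapsTo y hy)]
  simp [mul_comm]

theorem gMat_mul_uUp : gMat L.g (φ y) * (row (L.uUp (φ y))).transpose =
    (row (L.u (φ y))).transpose := by
  rw [LocalData.uUp_row, hL.metric.gMat_mul_inv_mul (hφ.mapsTo y hy)]

/-- Every vector is the sum of a tangential and a normal vector. -/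
theorem decomp (v : Fin d → ℝ) : ∃ α : Fin k → ℝ, v = (jac φ y).mulVec α +
    (L.ε * ∑ i, L.u (φ y) i * v i) • L.uUp (φ y) := by
  have hx := hφ.mapsTo y hy
  obtain ⟨α, hα⟩ := hφ.span y hy (v - (L.ε * ∑ i, L.u (φ y) i * v i) • L.uUp (φ y)) (by
    simp only [Pi.sub_apply, Pi.smul_apply, smul_eq_mul, mul_sub, Finset.sum_sub_distrib]
    have h := hL.norm _ hx
    have : ∀ i, L.u (φ y) i * (L.ε * (∑ j, L.u (φ y) j * v j) * L.uUp (φ y) i) =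
      (L.ε * ∑ j, L.u (φ y) j * v j) * (L.uUp (φ y) i * L.u (φ y) i) := fun i => by ring
    simp only [this, ← Finset.mul_sum, h]
    linear_combination (-∑ j, L.u (φ y) j * v j) * hL.sq)
  exact ⟨α, by rw [← hα]; simp⟩

theorem jac_transpose_mul_gMat_mul_uUp :
    (jac φ y).transpose * (gMat L.g (φ y) * (row (L.uUp (φ y))).transpose) = 0 := by
  rw [gMat_mul_uUp hL hφ hy, ← Matrix.transpose_mul, hφ.orth y hy, Matrix.transpose_zero]

theorem isUnit_det_h : IsUnit (gMat h y).det := by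
  rw [← Matrix.isUnit_iff_isUnit_det, ← Matrix.mulVec_injective_iff_isUnit]
  refine (injective_iff_map_eq_zero (Matrix.mulVecLin (gMat h y))).2 fun α hα => ?_
  apply hφ.inj y hy
  have hx := hφ.mapsTo y hy
  have hinv : Function.Injective (Matrix.mulVecLin (gMat L.g (φ y))) :=
    Matrix.mulVec_injective_iff_isUnit.2
      ((Matrix.isUnit_iff_isUnit_det _).2 (hL.metric.isUnit_det _ hx))
  refine hinv ?_
  rw [map_zero]
  simp only [Matrix.mulVecLin_apply] at hα ⊢
  rw [hφ.metric y hy, ← Matrix.mulVec_mulVec, ← Matrix.mulVec_mulVec] at hα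
  -- If hα = 0, the covector gEα annihilates the tangent space and u, hence every vector by
  -- `decomp`. So it vanishes, and α = 0 because g and E are injective.
  set z := (gMat L.g (φ y)).mulVec ((jac φ y).mulVec α) with hz
  have h1 : ∀ β, dotProduct z ((jac φ y).mulVec β) = 0 := by
    intro β
    rw [Matrix.dotProduct_mulVec, ← Matrix.mulVec_transpose, hα, zero_dotProduct]
  have h2 : dotProduct z (L.uUp (φ y)) = 0 := by
    have h3 := congrArg Matrix.transpose (jac_transpose_mul_gMat_mul_uUp hL hφ hy)
    simp only [Matrix.transpose_mul, Matrix.transpose_transpose, gMat_transpose_comp hL hφ hy] at h3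
    have h4 : dotProduct z (L.uUp (φ y)) =
        dotProduct (fun A => (row (L.uUp (φ y)) * gMat L.g (φ y) * jac φ y) () A) α := by
      rw [hz, dotProduct_comm, Matrix.dotProduct_mulVec, Matrix.dotProduct_mulVec]
      rfl
    rw [h4, h3]
    simp [dotProduct]
  funext i
  obtain ⟨β, hβ⟩ := decomp hL hφ hy (Pi.single i 1)
  have h5 : dotProduct z (Pi.single i 1) = 0 := by
    rw [hβ, dotProduct_add, h1, dotProduct_smul, h2]; simp
  simpa using h5

theorem smooth_h (A B : Fin k) : ContDiffAt ℝ ∞ (fun z => h z A B) y := by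
  have h1 : MSmoothAt (fun z => (jac φ z).transpose * gMat L.g (φ z) * jac φ z) y :=
    ((hφ.smooth_jac hy).transpose.mul
      (hφ.smooth_comp hy (hL.metric.gMat_smooth (hφ.mapsTo y hy)))).mul (hφ.smooth_jac hy)
  refine (h1 A B).congr_of_eventuallyEq ?_
  filter_upwards [hφ.isOpen.mem_nhds hy] with z hz
  exact congrFun (congrFun (hφ.metric z hz) A) B

omit hy in
theorem isMetricOn : IsMetricOn h V where
  isOpen := hφ.isOpen
  smooth _ hy := smooth_h hL hφ hy
  symm y hy A B := by
    have h1 : (gMat h y).transpose = gMat h y := by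
      rw [hφ.metric y hy]
      simp only [Matrix.transpose_mul, Matrix.transpose_transpose, gMat_transpose_comp hL hφ hy,
        Matrix.mul_assoc]
    exact congrFun (congrFun h1 B) A
  isUnit_det _ hy := isUnit_det_h hL hφ hy

/-- The tangential part of the Gauss formula. -/
theorem gMat_h_mul_conn (A : Fin k) : gMat h y * conn h A y =
    (jac φ y).transpose * (gMat L.g (φ y) * hess L.g φ A y) := by
  -- Uniqueness of the Levi-Civita connection of h: Eᵀ g ∇_A E is symmetric by `hess_symm`, and
  -- differentiating h = Eᵀ g E gives its compatibility.
  refine (isMetricOn hL hφ).gMat_mul_conn_eq hy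
    (C := fun A => (jac φ y).transpose * (gMat L.g (φ y) * hess L.g φ A y)) ?_ ?_ A
  · intro A B D
    simp only [Matrix.mul_apply, fun j => hess_symm hL hφ hy A D j]
  · intro A
    have sE := hφ.smooth_jac hy
    have sG := hφ.smooth_comp hy (hL.metric.gMat_smooth (hφ.mapsTo y hy))
    rw [mpd_congr hφ.isOpen hy hφ.metric A, mpd_mul (sE.transpose.mul sG) sE,
      mpd_mul sE.transpose sG, mpd_transpose, mpd_gMat_comp hL hφ hy]
    simp only [hess, Matrix.transpose_mul, Matrix.transpose_add, Matrix.mul_add, Matrix.add_mul,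
      Matrix.transpose_transpose, gMat_transpose_comp hL hφ hy, Matrix.mul_assoc]
    abel

omit hφ hy hL in
/-- The normal part of the covariant derivative of the coordinate vector fields. -/
def nor (G : Coord d → Tensor2 d) (φ : Coord k → Coord d) (h : Coord k → Tensor2 k) (A : Fin k)
    (y : Coord k) : Matrix (Fin d) (Fin k) ℝ :=
  hess G φ A y - jac φ y * conn h A y

theorem smooth_nor (A : Fin k) : MSmoothAt (nor L.g φ h A) y :=
  (smooth_hess hL hφ hy A).sub ((hφ.smooth_jac hy).mul ((isMetricOn hL hφ).conn_smooth hy A))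

theorem jac_mul_gMat_mul_nor (A : Fin k) :
    (jac φ y).transpose * (gMat L.g (φ y) * nor L.g φ h A y) = 0 := by
  simp only [nor, Matrix.mul_sub, ← gMat_h_mul_conn hL hφ hy A]
  rw [hφ.metric y hy]
  simp only [Matrix.mul_assoc, sub_self]

/-- The commutator of the covariant derivatives along φ, applied to E, is the curvature of the
pulled-back connection; the terms with derivatives of E are symmetric in A and B. -/
theorem mpd_hess_sub (A B : Fin k) :
    (mpd A (hess L.g φ B) y + pullConn L.g φ A y * hess L.g φ B y)
      - (mpd B (hess L.g φ A) y + pullConn L.g φ B y * hess L.g φ A y) =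
    (mpd A (pullConn L.g φ B) y - mpd B (pullConn L.g φ A) y
      + (pullConn L.g φ A y * pullConn L.g φ B y - pullConn L.g φ B y * pullConn L.g φ A y))
      * jac φ y := by
  have sE := hφ.smooth_jac hy
  have key : ∀ A B, mpd A (hess L.g φ B) y = mpd A (mpd B (jac φ)) y
      + (mpd A (pullConn L.g φ B) y * jac φ y + pullConn L.g φ B y * mpd A (jac φ) y) := by
    intro A B
    have sC := smooth_pullConn hL hφ hy B
    change mpd A (fun z => mpd B (jac φ) z + pullConn L.g φ B z * jac φ z) y = _
    rw [mpd_add (sE.mpd B) (sC.mul sE), mpd_mul sC sE]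
  rw [key, key, mpd_comm sE B A]
  simp only [hess, Matrix.mul_add, Matrix.add_mul, Matrix.sub_mul, Matrix.mul_assoc]
  abel

/-- The curvature of the pulled back connection. -/
theorem pullConn_curv (A B : Fin k) :
    mpd A (pullConn L.g φ B) y - mpd B (pullConn L.g φ A) y
      + (pullConn L.g φ A y * pullConn L.g φ B y - pullConn L.g φ B y * pullConn L.g φ A y) =
    Matrix.of fun a b =>
      pl (jac φ y) A (fun i => pl (jac φ y) B (fun j => curv L.g (φ y) i j a b)) := by
  have hx := hφ.mapsTo y hy
  -- The derivative of the Jacobian is symmetric in A and B, so its contribution disappears from the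
  -- curvature.
  have h1 : ∀ A B a b, mpd A (pullConn L.g φ B) y a b =
      ∑ j, mpd A (jac φ) y j B * conn L.g j (φ y) a b
      + pl (jac φ y) A (fun i => pl (jac φ y) B (fun j => mpd i (conn L.g j) (φ y) a b)) := by
    intro A B a b
    have hc : ∀ j, ContDiffAt ℝ ∞ (fun z => conn L.g j (φ z) a b) y := fun j =>
      hφ.smooth_comp hy (hL.metric.conn_smooth hx j) a b
    change pd A (fun z => ∑ j, jac φ z j B * conn L.g j (φ z) a b) y = _
    rw [pd_sum (fun j _ => (hφ.smooth_jac hy j B).mul (hc j))]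
    simp only [pd_mul (hφ.smooth_jac hy _ B) (hc _), Finset.sum_add_distrib]
    congr 1
    rw [pl_comm]
    refine Finset.sum_congr rfl fun j _ => ?_
    congr 1
    exact congrFun (congrFun (hφ.mpd_comp hy (hL.metric.conn_smooth hx j) A) a) b
  have h2 : ∀ A B a b, (pullConn L.g φ A y * pullConn L.g φ B y) a b =
      pl (jac φ y) A (fun i => pl (jac φ y) B
        (fun j => (conn L.g i (φ y) * conn L.g j (φ y)) a b)) := by
    intro A B a b
    simp only [Matrix.mul_apply, pullConn, Matrix.of_apply, pl, Finset.sum_mul, Finset.mul_sum]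
    rw [Finset.sum_comm]
    symm
    rw [Finset.sum_comm]
    refine Finset.sum_congr rfl fun j _ => ?_
    rw [Finset.sum_comm]
    exact Finset.sum_congr rfl fun l _ => Finset.sum_congr rfl fun i _ => by ring
  ext a b
  simp only [Matrix.add_apply, Matrix.sub_apply, h1, h2, hφ.mpd_jac_symm hy B A, Matrix.of_apply,
    curv, pl_add, pl_sub]
  rw [pl_comm _ _ B A, pl_comm _ _ B A]
  ring

/-- The Gauss equation, for the components with respect to the coordinates of the hypersurface. -/
theorem gauss_nor (A B : Fin k) :
    (jac φ y).transpose * (gMat L.g (φ y) * ((Matrix.of fun a b =>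
      pl (jac φ y) A (fun i => pl (jac φ y) B (fun j => curv L.g (φ y) i j a b))) * jac φ y)) =
    gMat h y * curv h y A B
      - (nor L.g φ h A y).transpose * (gMat L.g (φ y) * nor L.g φ h B y)
      + (nor L.g φ h B y).transpose * (gMat L.g (φ y) * nor L.g φ h A y) := by
  have hx := hφ.mapsTo y hy
  have sE := hφ.smooth_jac hy
  have sG := hφ.smooth_comp hy (hL.metric.gMat_smooth hx)
  have sN := fun A => smooth_nor hL hφ hy A
  have sC := fun A => (isMetricOn hL hφ).conn_smooth hy A
  have hN := fun A => jac_mul_gMat_mul_nor hL hφ hy A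
  have hhess : ∀ A z, hess L.g φ A z = jac φ z * conn h A z + nor L.g φ h A z := by
    intro A z; simp only [nor]; abel
  -- Weingarten equation, from differentiating Eᵀ g N_B = 0: the tangential part of ∇_A N_B is minus
  -- the product of the normal parts N_A and N_B.
  have h3 : ∀ A B, (jac φ y).transpose * (gMat L.g (φ y) *
      (mpd A (nor L.g φ h B) y + pullConn L.g φ A y * nor L.g φ h B y)) =
      -((nor L.g φ h A y).transpose * (gMat L.g (φ y) * nor L.g φ h B y)) := by
    intro A B
    have h0 : mpd A (fun z => (jac φ z).transpose * (gMat L.g (φ z) * nor L.g φ h B z)) y = 0 := by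
      rw [mpd_congr hφ.isOpen hy (N := fun _ => 0)
        (fun z hz => jac_mul_gMat_mul_nor hL hφ hz B), mpd_const]
    rw [mpd_mul sE.transpose (sG.mul (sN B)), mpd_mul sG (sN B), mpd_transpose,
      mpd_gMat_comp hL hφ hy] at h0
    have h1 : (mpd A (jac φ) y).transpose = (nor L.g φ h A y).transpose
        + (conn h A y).transpose * (jac φ y).transpose
        - (jac φ y).transpose * (pullConn L.g φ A y).transpose := by
      rw [← Matrix.transpose_mul, ← Matrix.transpose_mul, ← Matrix.transpose_add,
        ← Matrix.transpose_sub]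
      congr 1
      simp only [nor, hess]; abel
    rw [h1] at h0
    simp only [Matrix.mul_add, Matrix.add_mul, Matrix.sub_mul, Matrix.mul_assoc, hN B,
      Matrix.mul_zero] at h0
    simp only [Matrix.mul_add]
    rw [eq_neg_iff_add_eq_zero, ← h0]
    abel
  have h4 : ∀ A B, (jac φ y).transpose * (gMat L.g (φ y) *
      (mpd A (hess L.g φ B) y + pullConn L.g φ A y * hess L.g φ B y)) =
      gMat h y * (conn h A y * conn h B y + mpd A (conn h B) y)
        - (nor L.g φ h A y).transpose * (gMat L.g (φ y) * nor L.g φ h B y) := by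
    intro A B
    -- Apply ∇_A to the Gauss formula ∇_B E = E Γ_B + N_B.
    have h5 : mpd A (hess L.g φ B) y + pullConn L.g φ A y * hess L.g φ B y =
        jac φ y * (conn h A y * conn h B y + mpd A (conn h B) y) + nor L.g φ h A y * conn h B y
        + (mpd A (nor L.g φ h B) y + pullConn L.g φ A y * nor L.g φ h B y) := by
      have h6 : mpd A (jac φ) y = jac φ y * conn h A y + nor L.g φ h A y
          - pullConn L.g φ A y * jac φ y := by
        rw [← hhess, hess]; abel
      rw [mpd_congr hφ.isOpen hy (fun z _ => hhess B z), mpd_add (sE.mul (sC B)) (sN B),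
        mpd_mul sE (sC B), hhess, h6]
      simp only [Matrix.mul_add, Matrix.add_mul, Matrix.sub_mul, Matrix.mul_assoc]
      abel
    rw [h5, Matrix.mul_add, Matrix.mul_add, h3, Matrix.mul_add, Matrix.mul_add]
    have h7 : (jac φ y).transpose * (gMat L.g (φ y) * (nor L.g φ h A y * conn h B y)) = 0 := by
      have := congrArg (· * conn h B y) (hN A)
      simpa only [Matrix.mul_assoc, Matrix.zero_mul] using this
    rw [h7, hφ.metric y hy]
    simp only [Matrix.mul_assoc]
    abel
  -- Antisymmetrizing in A and B turns the tangential parts into the curvature of h.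
  rw [← pullConn_curv hL hφ hy, ← mpd_hess_sub hL hφ hy, Matrix.mul_sub, Matrix.mul_sub, h4, h4,
    curv]
  simp only [Matrix.mul_add, Matrix.mul_sub]
  abel

end IsLeafChart

/-! ### Extension of leaf tensors to ambient tensors -/

section Extension

variable {k d : ℕ}

/-- Extension of a 2-tensor by the matrix `θ`. -/
def lift2 (θ : Matrix (Fin k) (Fin d) ℝ) (S : Tensor2 k) : Tensor2 d := fun a b =>
  pl θ a (fun A => pl θ b (S A))

/-- Extension of a 4-tensor by the matrix `θ`. -/
def lift4 (θ : Matrix (Fin k) (Fin d) ℝ) (T : Tensor4 k) : Tensor4 d := fun a b m v =>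
  pl θ a (fun A => pl θ b (fun B => pl θ m (fun C => pl θ v (T A B C))))

theorem lift4_add (θ : Matrix (Fin k) (Fin d) ℝ) (T T' : Tensor4 k) (a b m v : Fin d) :
    lift4 θ (fun A B C D => T A B C D + T' A B C D) a b m v =
      lift4 θ T a b m v + lift4 θ T' a b m v := by
  simp only [lift4, pl_add]

theorem lift4_sub (θ : Matrix (Fin k) (Fin d) ℝ) (T T' : Tensor4 k) (a b m v : Fin d) :
    lift4 θ (fun A B C D => T A B C D - T' A B C D) a b m v =
      lift4 θ T a b m v - lift4 θ T' a b m v := by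
  simp only [lift4, pl_sub]

theorem lift4_const_mul (θ : Matrix (Fin k) (Fin d) ℝ) (c : ℝ) (T : Tensor4 k) (a b m v : Fin d) :
    lift4 θ (fun A B C D => c * T A B C D) a b m v = c * lift4 θ T a b m v := by
  simp only [lift4, pl_const_mul]

theorem lift4_mul13_24 (θ : Matrix (Fin k) (Fin d) ℝ) (S S' : Tensor2 k) (a b m v : Fin d) :
    lift4 θ (fun A B C D => S A C * S' B D) a b m v = lift2 θ S a m * lift2 θ S' b v := by
  simp only [lift4, lift2, pl_const_mul, pl_mul_const]

theorem lift4_mul14_23 (θ : Matrix (Fin k) (Fin d) ℝ) (S S' : Tensor2 k) (a b m v : Fin d) :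
    lift4 θ (fun A B C D => S A D * S' B C) a b m v = lift2 θ S a v * lift2 θ S' b m := by
  simp only [lift4, lift2, pl_const_mul, pl_mul_const]

theorem lift4_kn (θ : Matrix (Fin k) (Fin d) ℝ) (S S' : Tensor2 k) (a b m v : Fin d) :
    lift4 θ (kn S S') a b m v = kn (lift2 θ S) (lift2 θ S') a b m v := by
  have h : kn S S' = fun A B C D => ((S A C * S' B D - S A D * S' B C) - S' A D * S B C)
      + S' A C * S B D := by
    funext A B C D; simp only [kn]; ring
  rw [h, lift4_add, lift4_sub, lift4_sub, lift4_mul13_24, lift4_mul14_23, lift4_mul14_23,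
    lift4_mul13_24]
  simp only [kn]; ring

variable {gi : Tensor2 d} {hi : Tensor2 k} {θ : Matrix (Fin k) (Fin d) ℝ}
  (hθ : θ * Matrix.of gi * θ.transpose = Matrix.of hi)
include hθ

/-- The inverse metric pushes forward along θ to the inverse leaf metric. All contractions, and with
them Ric, Scal and Weyl, therefore commute with extension. -/
theorem tr_lift2 (S : Tensor2 k) : tr gi (lift2 θ S) = tr hi S := by
  have h : ∀ A B, hi A B = ∑ a, ∑ b, gi a b * (θ A a * θ B b) := by
    intro A B
    have h1 := congrFun (congrFun hθ A) B
    simp only [Matrix.mul_apply, Matrix.of_apply, Matrix.transpose_apply, Finset.sum_mul] at h1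
    rw [← h1, Finset.sum_comm]
    exact Finset.sum_congr rfl fun _ _ => Finset.sum_congr rfl fun _ _ => by ring
  have h2 : lift2 θ S = fun a b => ∑ p : Fin k × Fin k, S p.1 p.2 *
      (fun (p : Fin k × Fin k) a b => θ p.1 a * θ p.2 b) p a b := by
    funext a b
    simp only [lift2, pl, Fintype.sum_prod_type, Finset.mul_sum]
    exact Finset.sum_congr rfl fun _ _ => Finset.sum_congr rfl fun _ _ => by ring
  rw [h2, tr_sum, Fintype.sum_prod_type]
  simp only [tr, h]
  exact Finset.sum_congr rfl fun _ _ => Finset.sum_congr rfl fun _ _ => by ring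

theorem ric_lift4 (T : Tensor4 k) (b v : Fin d) :
    ric gi (lift4 θ T) b v = lift2 θ (ric hi T) b v := by
  have h1 : ric gi (lift4 θ T) b v = tr gi (fun a c => lift4 θ T a b c v) := rfl
  have h2 : (fun a c => lift4 θ T a b c v) = fun a c => ∑ B, θ B b *
      (fun B a c => ∑ D, θ D v * (fun D a c => lift2 θ (fun A C => T A B C D) a c) D a c) B a c := by
    funext a c
    change _ = pl θ b (fun B => pl θ v (fun D => lift2 θ (fun A C => T A B C D) a c))
    simp only [lift4, lift2]
    rw [pl_comm]
    congr 1; funext B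
    rw [pl_comm θ θ v a]
    congr 1; funext A
    rw [pl_comm]
  rw [h1, h2, tr_sum]
  simp only [tr_sum, tr_lift2 hθ]
  rfl

theorem scal_lift4 (T : Tensor4 k) : scal gi (lift4 θ T) = scal hi T := by
  have : ric gi (lift4 θ T) = lift2 θ (ric hi T) := by
    funext b v; exact ric_lift4 hθ T b v
  rw [scal, this, tr_lift2 hθ, scal]

theorem weyl_lift4 (c : ℝ) (h : Tensor2 k) (T : Tensor4 k) (a b m v : Fin d) :
    lift4 θ (weyl c hi h T) a b m v = weyl c gi (lift2 θ h) (lift4 θ T) a b m v := by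
  have h1 : lift2 θ (sch c hi h T) = sch c gi (lift2 θ h) (lift4 θ T) := by
    funext a b
    simp only [sch, ric_lift4 hθ, scal_lift4 hθ]
    change pl θ a (fun A => pl θ b (fun B =>
      1 / (c - 2) * (ric hi T A B - scal hi T / (2 * (c - 1)) * h A B))) = _
    simp only [lift2, pl_const_mul, pl_sub]
  have h2 : weyl c hi h T = fun A B C D => T A B C D - kn (sch c hi h T) h A B C D := rfl
  rw [h2, lift4_sub, lift4_kn, h1, weyl]

end Extension

/-! ### The leaf inside the ambient space: projector, second fundamental form, Gauss identity -/

namespace IsLeafChart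

variable {k d : ℕ} {L : LocalData d} {U : Set (Coord d)} {φ : Coord k → Coord d}
  {h : Coord k → Tensor2 k} {V : Set (Coord k)}

/-- The matrix of the orthogonal projection onto the tangent space of the hypersurface. -/
def thetaMat (L : LocalData d) (φ : Coord k → Coord d) (h : Coord k → Tensor2 k) (y : Coord k) :
    Matrix (Fin k) (Fin d) ℝ :=
  (gMat h y)⁻¹ * ((jac φ y).transpose * gMat L.g (φ y))

/-- The intrinsic curvature of the hypersurface as a collection of ambient tensors. -/
def leafCurv (L : LocalData d) (φ : Coord k → Coord d) (h : Coord k → Tensor2 k) (y : Coord k) :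
    LeafCurvature d where
  Riem := lift4 (thetaMat L φ h y) (riem h y)
  Ric := lift2 (thetaMat L φ h y) (ric (invMetric h y) (riem h y))
  Scal := scal (invMetric h y) (riem h y)
  Weyl := lift4 (thetaMat L φ h y) (weyl ((d : ℝ) - 1) (invMetric h y) (h y) (riem h y))

variable (hL : L.IsUnitNormal U) (hφ : IsLeafChart L U φ h V) {y : Coord k} (hy : y ∈ V)
include hL hφ hy

theorem thetaMat_mul_jac : thetaMat L φ h y * jac φ y = 1 := by
  rw [thetaMat, Matrix.mul_assoc, ← hφ.metric y hy, (isMetricOn hL hφ).inv_mul_gMat hy]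

/-- The projector is `E θ`. -/
theorem proj_eq : jac φ y * thetaMat L φ h y = Matrix.of (L.proj (φ y)) := by
  -- Both candidates fix tangent vectors and annihilate u, so their difference vanishes on a
  -- spanning set.
  set Z := Matrix.of (L.proj (φ y)) - jac φ y * thetaMat L φ h y with hZ
  have hP : Matrix.of (L.proj (φ y)) =
      1 - L.ε • ((row (L.uUp (φ y))).transpose * row (L.u (φ y))) := by
    ext i j
    simp only [LocalData.proj, Matrix.of_apply, Matrix.sub_apply, Matrix.one_apply,
      Matrix.smul_apply, Matrix.mul_apply, row, Matrix.transpose_apply, smul_eq_mul]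
    simp [mul_assoc]
  have hZE : Z * jac φ y = 0 := by
    rw [hZ, hP, Matrix.sub_mul, Matrix.sub_mul, Matrix.one_mul, Matrix.smul_mul, Matrix.mul_assoc,
      hφ.orth y hy, Matrix.mul_assoc, thetaMat_mul_jac hL hφ hy]
    simp
  have hZU : Z * (row (L.uUp (φ y))).transpose = 0 := by
    rw [hZ, hP, Matrix.sub_mul, Matrix.sub_mul, Matrix.one_mul, Matrix.smul_mul, Matrix.mul_assoc,
      uRow_mul_uUp hL hφ hy, thetaMat]
    simp only [Matrix.mul_assoc, jac_transpose_mul_gMat_mul_uUp hL hφ hy, Matrix.mul_zero]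
    simp [smul_smul, hL.sq]
  have hZ0 : Z = 0 := by
    ext i j
    obtain ⟨α, hα⟩ := decomp hL hφ hy (Pi.single j 1)
    have h1 : Z i j = Z.mulVec (Pi.single j 1) i := by simp
    have h2 : Z.mulVec (L.uUp (φ y)) = 0 := by
      funext a; exact congrFun (congrFun hZU a) ()
    rw [h1, hα, Matrix.mulVec_add, Matrix.mulVec_mulVec, hZE, Matrix.mulVec_smul, h2]
    simp
  exact (sub_eq_zero.1 hZ0).symm

theorem thetaMat_inv : thetaMat L φ h y * Matrix.of (L.gi (φ y)) * (thetaMat L φ h y).transpose =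
    Matrix.of (invMetric h y) := by
  have hx := hφ.mapsTo y hy
  change thetaMat L φ h y * (gMat L.g (φ y))⁻¹ * _ = (gMat h y)⁻¹
  have h1 : (thetaMat L φ h y).transpose = gMat L.g (φ y) * (jac φ y * (gMat h y)⁻¹) := by
    simp only [thetaMat, Matrix.transpose_mul, Matrix.transpose_transpose,
      hL.metric.gMat_transpose hx, (isMetricOn hL hφ).inv_transpose hy, Matrix.mul_assoc]
  rw [h1, Matrix.mul_assoc, hL.metric.inv_mul_gMat_mul hx, ← Matrix.mul_assoc,
    thetaMat_mul_jac hL hφ hy, Matrix.one_mul]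

theorem lift2_metric (a b : Fin d) : lift2 (thetaMat L φ h y) (h y) a b = L.gam (φ y) a b := by
  have hx := hφ.mapsTo y hy
  have h1 : lift2 (thetaMat L φ h y) (h y) a b =
      ((thetaMat L φ h y).transpose * gMat h y * thetaMat L φ h y) a b :=
    (transpose_mul_mul_apply _ (gMat h y) a b).symm
  have h2 : (thetaMat L φ h y).transpose * gMat h y * thetaMat L φ h y =
      gMat L.g (φ y) * Matrix.of (L.proj (φ y)) := by
    rw [← proj_eq hL hφ hy]
    conv_lhs => enter [1, 1]; rw [thetaMat]
    simp only [Matrix.transpose_mul, Matrix.transpose_transpose,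
      hL.metric.gMat_transpose hx, (isMetricOn hL hφ).inv_transpose hy, Matrix.mul_assoc,
      (isMetricOn hL hφ).inv_mul_gMat_mul hy]
  rw [h1, h2]
  simp only [Matrix.mul_apply, LocalData.proj, gMat, Matrix.of_apply, mul_sub,
    Finset.sum_sub_distrib, LocalData.gam]
  congr 1
  · simp
  · rw [hL.u_eq hx a]
    simp only [Finset.mul_sum, Finset.sum_mul]
    exact Finset.sum_congr rfl fun _ _ => by ring

/-- Extension by θ sends h to γ and preserves traces, so the extended leaf curvatures satisfy the
relations needed in `gauss_iff`. -/
theorem isCompatible : L.IsCompatible (φ y) (leafCurv L φ h y) where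
  ric_eq b v := (ric_lift4 (thetaMat_inv hL hφ hy) _ b v).symm
  scal_eq := (scal_lift4 (thetaMat_inv hL hφ hy) _).symm
  weyl_eq a b m v := by
    have h1 : lift2 (thetaMat L φ h y) (h y) = L.gam (φ y) := by
      funext a b; exact lift2_metric hL hφ hy a b
    rw [← h1]
    exact weyl_lift4 (thetaMat_inv hL hφ hy) _ _ _ a b m v

/-- Differentiate the orthogonality relation u·E = 0 along the leaf. -/
theorem uRow_mul_hess (A : Fin k) :
    row (L.u (φ y)) * hess L.g φ A y = -row (kk L φ y A) := by
  have hx := hφ.mapsTo y hy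
  have su : MSmoothAt (fun x => row (L.u x)) (φ y) := fun _ j => hL.smooth_u _ hx j
  have h0 : mpd A (fun z => row (L.u (φ z)) * jac φ z) y = 0 := by
    rw [mpd_congr hφ.isOpen hy (N := fun _ => 0) (fun z hz => hφ.orth z hz), mpd_const]
  rw [mpd_mul (hφ.smooth_comp hy su) (hφ.smooth_jac hy), hφ.mpd_comp hy su] at h0
  have h1 : (Matrix.of fun a b =>
      pl (jac φ y) A (fun j => mpd j (fun x => row (L.u x)) (φ y) a b)) =
      row (fun b => pl (jac φ y) A (fun j => L.W (φ y) j b))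
        + row (L.u (φ y)) * pullConn L.g φ A y := by
    ext a b
    have hW : ∀ j, mpd j (fun x => row (L.u x)) (φ y) a b =
        L.W (φ y) j b + (row (L.u (φ y)) * conn L.g j (φ y)) a b := by
      intro j
      have := congrFun (congrFun (cov1_eq L.g L.u (φ y) j) a) b
      rw [Matrix.sub_apply] at this
      exact sub_eq_iff_eq_add.1 this.symm
    simp only [Matrix.of_apply, hW, pl_add, Matrix.add_apply]
    congr 1
    simp only [row, Matrix.mul_apply, pullConn, Matrix.of_apply, pl, Finset.mul_sum]
    rw [Finset.sum_comm]
    exact Finset.sum_congr rfl fun _ _ => Finset.sum_congr rfl fun _ _ => by ring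
  have h2 : row (fun b => pl (jac φ y) A (fun j => L.W (φ y) j b)) * jac φ y =
      row (kk L φ y A) := by
    ext _ B
    simp only [kk, Matrix.mul_apply, row, Matrix.of_apply]
    rw [pl_comm]
    exact Finset.sum_congr rfl fun _ _ => mul_comm _ _
  rw [h1, Matrix.add_mul, h2, Matrix.mul_assoc] at h0
  rw [hess, Matrix.mul_add, eq_neg_iff_add_eq_zero, ← h0]
  abel

/-- The form equals -u·∇_A E_B, which inherits the symmetry of `hess_symm`. This is where
integrability enters. -/
theorem kk_symm (A B : Fin k) : kk L φ y A B = kk L φ y B A := by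
  have h1 : ∀ A B, kk L φ y A B = -∑ i, L.u (φ y) i * hess L.g φ A y i B := by
    intro A B
    have := congrFun (congrFun (uRow_mul_hess hL hφ hy A) ()) B
    simp only [Matrix.mul_apply, row, Matrix.of_apply, Matrix.neg_apply] at this
    rw [this, neg_neg]
  rw [h1, h1]
  simp only [fun i => hess_symm hL hφ hy A B i]

theorem pr_eq_pl (a : Fin d) (f : Fin d → ℝ) :
    L.pr (φ y) a f = pl (thetaMat L φ h y) a (fun A => pl (jac φ y) A f) := by
  rw [← pl_mul, proj_eq hL hφ hy]; rfl

theorem K_eq_lift2 (a b : Fin d) :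
    L.K (φ y) a b = lift2 (thetaMat L φ h y) (kk L φ y) a b := by
  rw [LocalData.K_eq_pr]
  simp only [pr_eq_pl hL hφ hy, lift2]
  congr 1; funext A
  rw [pl_comm]
  rfl

/-- The second fundamental form is symmetric. -/
theorem K_symm (a b : Fin d) : L.K (φ y) a b = L.K (φ y) b a := by
  rw [K_eq_lift2 hL hφ hy, K_eq_lift2 hL hφ hy, lift2, pl_comm]
  simp only [lift2, fun A B => kk_symm hL hφ hy A B]

/-- The projector Eθ annihilates N_A, so N_A is a multiple of u, determined by its product with u.
-/
theorem nor_eq (A : Fin k) : nor L.g φ h A y =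
    -(L.ε • ((row (L.uUp (φ y))).transpose * row (kk L φ y A))) := by
  have h1 : Matrix.of (L.proj (φ y)) * nor L.g φ h A y = 0 := by
    rw [← proj_eq hL hφ hy, thetaMat]
    simp only [Matrix.mul_assoc, jac_mul_gMat_mul_nor hL hφ hy, Matrix.mul_zero]
  have h2 : row (L.u (φ y)) * nor L.g φ h A y = -row (kk L φ y A) := by
    rw [nor, Matrix.mul_sub, ← Matrix.mul_assoc, hφ.orth y hy, Matrix.zero_mul, sub_zero, uRow_mul_hess hL hφ hy]
  have hP : Matrix.of (L.proj (φ y)) =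
      1 - L.ε • ((row (L.uUp (φ y))).transpose * row (L.u (φ y))) := by
    ext i j
    simp only [LocalData.proj, Matrix.of_apply, Matrix.sub_apply, Matrix.one_apply,
      Matrix.smul_apply, Matrix.mul_apply, row, Matrix.transpose_apply, smul_eq_mul]
    simp [mul_assoc]
  rw [hP, Matrix.sub_mul, Matrix.one_mul, Matrix.smul_mul, Matrix.mul_assoc, h2,
    sub_eq_zero] at h1
  rw [h1]; simp

theorem nor_mul_nor (A B F C : Fin k) :
    ((nor L.g φ h A y).transpose * (gMat L.g (φ y) * nor L.g φ h B y)) F C =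
      L.ε * (kk L φ y A F * kk L φ y B C) := by
  have h1 : (nor L.g φ h A y).transpose * (gMat L.g (φ y) * nor L.g φ h B y) =
      L.ε • ((row (kk L φ y A)).transpose * row (kk L φ y B)) := by
    rw [nor_eq hL hφ hy, nor_eq hL hφ hy]
    have h2 : row (L.uUp (φ y)) * (row (L.u (φ y))).transpose = L.ε • 1 := by
      have := congrArg Matrix.transpose (uRow_mul_uUp hL hφ hy)
      simpa using this
    have h3 : row (L.uUp (φ y)) * (gMat L.g (φ y) * (row (L.uUp (φ y))).transpose) = L.ε • 1 := by
      rw [gMat_mul_uUp hL hφ hy, h2]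
    simp only [Matrix.transpose_neg, Matrix.transpose_smul, Matrix.transpose_mul,
      Matrix.transpose_transpose, Matrix.mul_neg, Matrix.neg_mul, Matrix.mul_smul,
      Matrix.smul_mul, Matrix.mul_assoc]
    rw [← Matrix.mul_assoc (gMat L.g (φ y)), ← Matrix.mul_assoc (row (L.uUp (φ y))), h3]
    simp [smul_smul, hL.sq]
  rw [h1]
  simp [Matrix.mul_apply, row]

/-- The Gauss equation in the coordinates of the hypersurface. -/
theorem gauss_pull (F C A B : Fin k) :
    pl (jac φ y) F (fun p => pl (jac φ y) C (fun q => pl (jac φ y) A (fun r =>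
      pl (jac φ y) B (fun s => riem L.g (φ y) p q r s)))) =
    riem h y F C A B - L.ε * (kk L φ y F A * kk L φ y C B)
      + L.ε * (kk L φ y F B * kk L φ y C A) := by
  have h0 := congrFun (congrFun (gauss_nor hL hφ hy A B) F) C
  rw [Matrix.add_apply, Matrix.sub_apply, nor_mul_nor hL hφ hy, nor_mul_nor hL hφ hy,
    ← riem_eq_curv, ← Matrix.mul_assoc (gMat _ _), ← Matrix.mul_assoc, transpose_mul_mul_apply]
    at h0
  have h1 : ∀ p q, (gMat L.g (φ y) * (Matrix.of fun a b =>
      pl (jac φ y) A (fun i => pl (jac φ y) B (fun j => curv L.g (φ y) i j a b)))) p q =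
      pl (jac φ y) A (fun r => pl (jac φ y) B (fun s => riem L.g (φ y) p q r s)) := by
    intro p q
    simp only [riem_eq_curv]
    have : ∀ M : Matrix (Fin d) (Fin d) ℝ, (gMat L.g (φ y) * M) p q =
        pl (gMat L.g (φ y)).transpose p (fun b => M b q) := fun M => by
      simp only [Matrix.mul_apply, pl, Matrix.transpose_apply]
    simp only [this]
    simp only [Matrix.of_apply]
    rw [pl_comm]
    congr 1; funext r
    rw [pl_comm]
  simp only [fun p => funext (h1 p)] at h0
  rw [h0, kk_symm hL hφ hy A F, kk_symm hL hφ hy B C, kk_symm hL hφ hy B F, kk_symm hL hφ hy A C]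

/-- The Gauss identity for the Riemann tensor. -/
theorem gaussIdentity : GaussIdentity L (leafCurv L φ h y) (φ y) (riem L.g (φ y)) := by
  intro a b m v
  have h1 : L.par (φ y) (riem L.g (φ y)) a b m v =
      L.pr (φ y) a (fun p => L.pr (φ y) b (fun q => L.pr (φ y) m (fun r =>
        L.pr (φ y) v (fun s => riem L.g (φ y) p q r s)))) := by
    simp only [LocalData.par, LocalData.pr, Finset.mul_sum, mul_assoc]
  have h2 : L.par (φ y) (riem L.g (φ y)) a b m v = lift4 (thetaMat L φ h y)
      (fun F C A B => pl (jac φ y) F (fun p => pl (jac φ y) C (fun q => pl (jac φ y) A (fun r =>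
        pl (jac φ y) B (fun s => riem L.g (φ y) p q r s))))) a b m v := by
    rw [h1]
    simp only [pr_eq_pl hL hφ hy, lift4]
    -- Each projector has been factored as Eθ; all pull-backs by E are now moved inside those by θ.
    simp only [pl_comm (jac φ y) (thetaMat L φ h y)]
  have h3 := funext fun F => funext fun C => funext fun A => funext fun B =>
    gauss_pull hL hφ hy F C A B
  rw [h2]
  refine (congrArg (fun T => lift4 (thetaMat L φ h y) T a b m v) h3).trans ?_
  rw [lift4_add]
  simp only [lift4_sub, lift4_const_mul, lift4_mul13_24,
    lift4_mul14_23, ← K_eq_lift2 hL hφ hy, leafCurv]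
  ring

end IsLeafChart

/-! ### The theorem in coordinates -/

/-- Symmetry of K is assumed on all of `U`: a single leaf chart gives it only along its image, which
is not open in the ambient space. -/
theorem coordinate_theorem {k d : ℕ} {L : LocalData d} {U : Set (Coord d)}
    {φ : Coord k → Coord d} {h : Coord k → Tensor2 k} {V : Set (Coord k)} (hd : 3 ≤ d)
    (hL : L.IsUnitNormal U) (hφ : IsLeafChart L U φ h V) {y : Coord k} (hy : y ∈ V)
    (hK : ∀ x ∈ U, ∀ a b, L.K x a b = L.K x b a) :
    let S := IsLeafChart.leafCurv L φ h y
    let x := φ y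
    let R := riem L.g x
    (GaussIdentity L S x R ∧ CodazziIdentity L x R ∧ RicciIdentity L x R) ∧
    ((4 ≤ d → GaussDecomposed L S x R) ∧ CodazziDecomposed L x R ∧ RicciDecomposed L x R) ∧
    (∀ T : Tensor4 d, IsRiemannType T →
      (4 ≤ d → (GaussIdentity L S x T ↔ GaussDecomposed L S x T)) ∧
      (CodazziIdentity L x T ↔ CodazziDecomposed L x T) ∧
      (RicciIdentity L x T ↔ RicciDecomposed L x T)) := by
  intro S x R
  have hx : x ∈ U := hφ.mapsTo y hy
  have hd' : (3 : ℝ) ≤ d := by exact_mod_cast hd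
  have hd1 : (d : ℝ) - 1 ≠ 0 := by linarith
  have hd2 : (d : ℝ) - 2 ≠ 0 := by linarith
  have gauss : ∀ T, 4 ≤ d → (GaussIdentity L S x T ↔ GaussDecomposed L S x T) := by
    intro T h4
    have h4' : (4 : ℝ) ≤ d := by exact_mod_cast h4
    exact hL.gauss_iff hx hd1 hd2 (by linarith) (hK x hx) (IsLeafChart.isCompatible hL hφ hy) T
  have codazzi := hL.codazzi_iff hx hd1 hd2 hK
  have ricci := hL.ricci_iff hx hd1 (hK x hx)
  have g0 : GaussIdentity L S x R := IsLeafChart.gaussIdentity hL hφ hy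
  have c0 := hL.codazziIdentity hx (hK x hx)
  have r0 := hL.ricciIdentity hx
  exact ⟨⟨g0, c0, r0⟩, ⟨fun h4 => (gauss R h4).1 g0, (codazzi R).1 c0, (ricci R).1 r0⟩,
    fun T _ => ⟨gauss T, codazzi T, ricci T⟩⟩

/-! ### Coordinate expressions on a manifold -/

section Manifold

variable {n : ℕ} {M : Type*} [TopologicalSpace M] [ChartedSpace (Coord n) M]

theorem mdifferentiable_of_mem_maximalAtlas {e : OpenPartialHomeomorph M (Coord n)}
    (he : e ∈ IsManifold.maximalAtlas (𝓡 n) ∞ M) : e.MDifferentiable (𝓡 n) (𝓡 n) :=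
  ⟨(contMDiffOn_of_mem_maximalAtlas he).mdifferentiableOn (by simp),
    (contMDiffOn_symm_of_mem_maximalAtlas he).mdifferentiableOn (by simp)⟩

variable {e : OpenPartialHomeomorph M (Coord n)} (he : e ∈ IsManifold.maximalAtlas (𝓡 n) ∞ M)
  {x : Coord n} (hx : x ∈ e.target)

theorem mfderiv_eq_sum_coordVec (v : Coord n) :
    mfderiv (𝓡 n) (𝓡 n) e.symm x v = ∑ i, v i • coordVec e x i := by
  have h : v = ∑ j, v j • (EuclideanSpace.single j (1 : ℝ) : Coord n) := by
    ext m; simp [Finset.sum_apply, Pi.single_apply]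
  conv_lhs => rw [h]
  exact (map_sum (mfderiv (𝓡 n) (𝓡 n) e.symm x) _ _).trans
    (Finset.sum_congr rfl fun i _ => map_smul (mfderiv (𝓡 n) (𝓡 n) e.symm x) _ _)

include he hx in
theorem contMDiffAt_symm : ContMDiffAt (𝓡 n) (𝓡 n) ∞ e.symm x :=
  (contMDiffOn_symm_of_mem_maximalAtlas he).contMDiffAt (e.open_target.mem_nhds hx)

variable [IsManifold (𝓡 n) ∞ M] (g : SemiRiemannianMetric n M)

theorem sum_inner_coordVec (w : Fin n → ℝ) (v : TangentSpace (𝓡 n) (e.symm x)) :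
    g.inner (e.symm x) v (∑ i, w i • coordVec e x i) =
      ∑ i, w i * g.inner (e.symm x) v (coordVec e x i) :=
  (map_sum (g.inner (e.symm x) v) _ _).trans
    (Finset.sum_congr rfl fun _ _ => map_smul (g.inner (e.symm x) v) _ _)

include he hx

/-- The coordinate field is the image of a constant section under the tangent map of the inverse
chart. -/
theorem contMDiffAt_coordVec (i : Fin n) :
    ContMDiffAt (𝓡 n) ((𝓡 n).prod 𝓘(ℝ, Coord n)) ∞
      (fun y => Bundle.TotalSpace.mk' (Coord n) (E := fun p : M => TangentSpace (𝓡 n) p)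
        (e.symm y) (coordVec e y i)) x := by
  have h1 := (contMDiffOn_symm_of_mem_maximalAtlas he).contMDiffOn_tangentMapWithin (m := ∞)
    (by simp) e.open_target.uniqueMDiffOn
  have h2 : ContMDiffAt (𝓡 n) (𝓡 n).tangent ∞ (fun y : Coord n =>
      (⟨y, (EuclideanSpace.single i (1 : ℝ) : Coord n)⟩ : TangentBundle (𝓡 n) (Coord n))) x :=
    contMDiffAt_vectorSpace_iff_contDiffAt.2 contDiffAt_const
  have h3 := (h1.contMDiffAt (x := (⟨x, (EuclideanSpace.single i (1 : ℝ) : Coord n)⟩ :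
      TangentBundle (𝓡 n) (Coord n))) (((FiberBundle.continuous_proj _ _).isOpen_preimage _
        e.open_target).mem_nhds hx)).comp x h2
  refine h3.congr_of_eventuallyEq ?_
  filter_upwards [e.open_target.mem_nhds hx] with y hy
  simp only [Function.comp_apply, tangentMapWithin, coordVec]
  rw [mfderivWithin_of_isOpen e.open_target hy]

omit [IsManifold (𝓡 n) ∞ M] in
theorem exists_eq_sum_coordVec (v : TangentSpace (𝓡 n) (e.symm x)) :
    ∃ w : Coord n, v = ∑ i, w i • coordVec e x i := by
  obtain ⟨w, hw⟩ := (mdifferentiable_of_mem_maximalAtlas he).symm.mfderiv_surjective hx v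
  exact ⟨w, hw.symm.trans (mfderiv_eq_sum_coordVec w)⟩

omit [IsManifold (𝓡 n) ∞ M] in
theorem eq_zero_of_sum_coordVec (w : Fin n → ℝ) (hw : ∑ i, w i • coordVec e x i = 0) : w = 0 := by
  have h := mfderiv_eq_sum_coordVec (e := e) (x := x) (WithLp.toLp 2 w)
  have h2 : mfderiv (𝓡 n) (𝓡 n) e.symm x (WithLp.toLp 2 w) = 0 := h.trans hw
  have h3 := (mdifferentiable_of_mem_maximalAtlas he).symm.mfderiv_injective hx
    (h2.trans (map_zero _).symm)
  exact congrArg WithLp.ofLp h3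

omit [IsManifold (𝓡 n) ∞ M] in
theorem eq_of_sum_coordVec_eq (w w' : Fin n → ℝ)
    (h : ∑ i, w i • coordVec e x i = ∑ i, w' i • coordVec e x i) : w = w' :=
  sub_eq_zero.1 <| eq_zero_of_sum_coordVec he hx (w - w') <| by
    simp only [Pi.sub_apply, sub_smul, Finset.sum_sub_distrib, h, sub_self]

theorem contDiffAt_inner_comp {X Y : ∀ y : Coord n, TangentSpace (𝓡 n) (e.symm y)}
    (hX : ContMDiffAt (𝓡 n) ((𝓡 n).prod 𝓘(ℝ, Coord n)) ∞
      (fun y => Bundle.TotalSpace.mk' (Coord n) (E := fun p : M => TangentSpace (𝓡 n) p)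
        (e.symm y) (X y)) x)
    (hY : ContMDiffAt (𝓡 n) ((𝓡 n).prod 𝓘(ℝ, Coord n)) ∞
      (fun y => Bundle.TotalSpace.mk' (Coord n) (E := fun p : M => TangentSpace (𝓡 n) p)
        (e.symm y) (Y y)) x) :
    ContDiffAt ℝ ∞ (fun y => g.inner (e.symm y) (X y) (Y y)) x := by
  have hg : ContMDiffAt (𝓡 n) ((𝓡 n).prod 𝓘(ℝ, Coord n →L[ℝ] Coord n →L[ℝ] ℝ)) ∞
      (fun y => Bundle.TotalSpace.mk' (Coord n →L[ℝ] Coord n →L[ℝ] ℝ)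
      (E := fun p : M => TangentSpace (𝓡 n) p →L[ℝ] TangentSpace (𝓡 n) p →L[ℝ] ℝ)
      (e.symm y) (g.inner (e.symm y))) x :=
    (g.contMDiff.contMDiffAt (x := e.symm x)).comp x (contMDiffAt_symm he hx)
  have h := ContMDiffAt.clm_bundle_apply₂ (F₁ := Coord n) (F₂ := Coord n) (F₃ := ℝ)
    (E₁ := fun p : M => TangentSpace (𝓡 n) p) (E₂ := fun p : M => TangentSpace (𝓡 n) p)
    (E₃ := Bundle.Trivial M ℝ) (b := e.symm) (ψ := fun y => g.inner (e.symm y)) hg hX hY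
  have h2 := (Bundle.contMDiffAt_totalSpace.1 h).2
  exact contMDiffAt_iff_contDiffAt.1 h2

omit hx in
theorem isMetricOn_components :
    IsMetricOn (components2 (fun p v w => g.inner p v w) e) e.target where
  isOpen := e.open_target
  smooth x hx i j := contDiffAt_inner_comp he hx g (contMDiffAt_coordVec he hx i)
    (contMDiffAt_coordVec he hx j)
  symm _ _ _ _ := g.symm _ _ _
  isUnit_det x hx := by
    rw [← Matrix.isUnit_iff_isUnit_det, ← Matrix.mulVec_injective_iff_isUnit]
    refine (injective_iff_map_eq_zero (Matrix.mulVecLin _)).2 fun w hw => ?_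
    apply eq_zero_of_sum_coordVec he hx
    apply g.nondegenerate
    intro v
    obtain ⟨v', rfl⟩ := exists_eq_sum_coordVec he hx v
    rw [sum_inner_coordVec]
    refine Finset.sum_eq_zero fun i _ => ?_
    rw [g.symm, sum_inner_coordVec]
    have := congrFun hw i
    simp only [Matrix.mulVecLin_apply, Matrix.mulVec, dotProduct, Matrix.of_apply, components2]
      at this
    rw [show ∑ j, w j * _ = (0 : Fin n → ℝ) i from
      (Finset.sum_congr rfl fun j _ => mul_comm _ _).trans this]
    simp

variable {u : ∀ p : M, TangentSpace (𝓡 n) p} {ε : ℝ}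

omit hx in
theorem isUnitNormal_localData
    (hu : ContMDiff (𝓡 n) (𝓡 n).tangent ∞ (fun p => (⟨p, u p⟩ : TangentBundle (𝓡 n) M)))
    (hε : ε = 1 ∨ ε = -1) (hunit : ∀ p, g.inner p (u p) (u p) = ε) :
    (localData g u ε e).IsUnitNormal e.target where
  metric := isMetricOn_components he g
  smooth_u x hx i := contDiffAt_inner_comp he hx g
    ((hu.contMDiffAt (x := e.symm x)).comp x (contMDiffAt_symm he hx))
    (contMDiffAt_coordVec he hx i)
  norm x hx := by
    -- The components w of the vector u must be identified with `uUp`, which is defined by raising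
    -- the index of the one-form.
    obtain ⟨w, hw⟩ := exists_eq_sum_coordVec he hx (u (e.symm x))
    have hG : IsMetricOn (localData g u ε e).g e.target := isMetricOn_components he g
    have h1 : (row ((localData g u ε e).u x)).transpose =
        gMat (localData g u ε e).g x * (row w).transpose := by
      ext i _
      simp only [row, Matrix.transpose_apply, Matrix.of_apply, localData, gMat, Matrix.mul_apply,
        components2]
      rw [g.symm, hw, sum_inner_coordVec]
      exact Finset.sum_congr rfl fun j _ => mul_comm _ _
    have h2 : (row ((localData g u ε e).uUp x)).transpose = (row w).transpose := by
      rw [LocalData.uUp_row, h1, hG.inv_mul_gMat_mul hx]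
    have h3 : ∀ i, (localData g u ε e).uUp x i = w i := fun i => congrFun (congrFun h2 i) ()
    simp only [h3]
    change _ = ε
    rw [← hunit (e.symm x)]
    conv_rhs => enter [2]; rw [hw]
    rw [sum_inner_coordVec]
    rfl
  sq := by
    change ε * ε = 1
    rcases hε with rfl | rfl <;> norm_num

end Manifold

/-! ### Coordinate expressions of the leaves -/

namespace HypersurfaceFoliation

variable {n : ℕ} {M : Type*} [TopologicalSpace M] [ChartedSpace (Coord n) M]
  [IsManifold (𝓡 n) ∞ M] {g : SemiRiemannianMetric n M} {u : ∀ p : M, TangentSpace (𝓡 n) p}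
  (F : HypersurfaceFoliation g u) {l : F.Index}
  {e : OpenPartialHomeomorph M (Coord n)}
  {c : OpenPartialHomeomorph (F.Leaf l) (Coord (n - 1))}

/-- The inclusion of a leaf in coordinates. -/
def localIncl (e : OpenPartialHomeomorph M (Coord n))
    (c : OpenPartialHomeomorph (F.Leaf l) (Coord (n - 1))) (y : Coord (n - 1)) : Coord n :=
  e (F.incl l (c.symm y))

/-- The domain of the coordinate expression of the inclusion of a leaf. -/
def localDomain (e : OpenPartialHomeomorph M (Coord n))
    (c : OpenPartialHomeomorph (F.Leaf l) (Coord (n - 1))) : Set (Coord (n - 1)) :=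
  c.target ∩ (fun y => F.incl l (c.symm y)) ⁻¹' e.source

theorem isOpen_localDomain : IsOpen (F.localDomain e c) :=
  ((F.contMDiff l).continuous.comp_continuousOn c.continuousOn_symm).isOpen_inter_preimage
    c.open_target e.open_source

variable (he : e ∈ IsManifold.maximalAtlas (𝓡 n) ∞ M)
  (hc : c ∈ IsManifold.maximalAtlas (𝓡 (n - 1)) ∞ (F.Leaf l))
  {y : Coord (n - 1)} (hy : y ∈ F.localDomain e c)

include hy in
theorem symm_localIncl : e.symm (F.localIncl e c y) = F.incl l (c.symm y) :=
  e.left_inv hy.2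

include he hc hy

theorem contDiffAt_localIncl : ContDiffAt ℝ ∞ (F.localIncl e c) y := by
  have h1 : ContMDiffAt (𝓡 (n - 1)) (𝓡 (n - 1)) ∞ c.symm y := contMDiffAt_symm hc hy.1
  have h2 : ContMDiffAt (𝓡 n) (𝓡 n) ∞ e (F.incl l (c.symm y)) :=
    (contMDiffOn_of_mem_maximalAtlas he).contMDiffAt (e.open_source.mem_nhds hy.2)
  exact contMDiffAt_iff_contDiffAt.1 (h2.comp y ((F.contMDiff l).contMDiffAt.comp y h1))

/-- The coordinate vectors of a leaf, in terms of the Jacobian matrix. -/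
theorem mfderiv_incl_sum (α : Fin (n - 1) → ℝ) :
    (mfderiv (𝓡 (n - 1)) (𝓡 n) (F.incl l) (c.symm y) (∑ A, α A • coordVec c y A) : Coord n) =
      ∑ i, (jac (F.localIncl e c) y).mulVec α i •
        (coordVec e (F.localIncl e c y) i : Coord n) := by
  have hx : F.localIncl e c y ∈ e.target := e.map_source hy.2
  have hc' : MDifferentiableAt (𝓡 (n - 1)) (𝓡 (n - 1)) c.symm y :=
    (contMDiffAt_symm hc hy.1).mdifferentiableAt (by simp)
  have hi : MDifferentiableAt (𝓡 (n - 1)) (𝓡 n) (F.incl l) (c.symm y) :=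
    (F.contMDiff l).contMDiffAt.mdifferentiableAt (by simp)
  have hφ := (F.contDiffAt_localIncl he hc hy).differentiableAt (by simp)
  have he' : MDifferentiableAt (𝓡 n) (𝓡 n) e.symm (F.localIncl e c y) :=
    (contMDiffAt_symm he hx).mdifferentiableAt (by simp)
  -- The derivatives of these two factorizations of the inclusion are compared by the chain rule.
  have h1 : (fun z => e.symm (F.localIncl e c z)) =ᶠ[nhds y] fun z => F.incl l (c.symm z) := by
    filter_upwards [F.isOpen_localDomain.mem_nhds hy] with z hz
    exact F.symm_localIncl hz
  have h2 := h1.mfderiv_eq (I := 𝓡 (n - 1)) (I' := 𝓡 n)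
  have h3 := mfderiv_comp y he' hφ.mdifferentiableAt
  have h4 := mfderiv_comp y hi hc'
  have h5 : ∀ v : Coord (n - 1),
      (mfderiv (𝓡 (n - 1)) (𝓡 n) (F.incl l) (c.symm y)
        (mfderiv (𝓡 (n - 1)) (𝓡 (n - 1)) c.symm y v) : Coord n) =
      mfderiv (𝓡 n) (𝓡 n) e.symm (F.localIncl e c y) (fderiv ℝ (F.localIncl e c) y v) := by
    intro v
    have h6 := congrArg (fun T : Coord (n - 1) →L[ℝ] Coord n => T v) (h4.symm.trans (h2.symm.trans h3))
    rw [mfderiv_eq_fderiv] at h6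
    exact h6
  have h6 := h5 (WithLp.toLp 2 α)
  rw [mfderiv_eq_sum_coordVec, mfderiv_eq_sum_coordVec] at h6
  refine h6.trans (Finset.sum_congr rfl fun i _ => ?_)
  congr 1
  have h7 : (WithLp.toLp 2 α : Coord (n - 1)) =
      ∑ A, α A • (EuclideanSpace.single A (1 : ℝ) : Coord (n - 1)) := by
    ext m; simp [Finset.sum_apply, Pi.single_apply]
  have h8 : ∀ A, jac (F.localIncl e c) y i A =
      fderiv ℝ (F.localIncl e c) y (EuclideanSpace.single A 1) i := by
    intro A
    have := ((hasFDerivWithinAt_euclidean.1 hφ.hasFDerivAt.hasFDerivWithinAt) i).hasFDerivAt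
      Filter.univ_mem
    simp only [jac, Matrix.of_apply, pd, this.fderiv]
    rfl
  rw [h7]
  simp [Matrix.mulVec, dotProduct, h8, mul_comm]

end HypersurfaceFoliation

/-- All tangent spaces are definitionally the model space, so the base point can be replaced by an
equal one without casts. -/
theorem SemiRiemannianMetric.inner_congr {n : ℕ} {M : Type*} [TopologicalSpace M]
    [ChartedSpace (Coord n) M] [IsManifold (𝓡 n) ∞ M] (g : SemiRiemannianMetric n M) {p p' : M}
    (h : p = p') (v w : Coord n) :
    g.inner p (v : TangentSpace (𝓡 n) p) (w : TangentSpace (𝓡 n) p) =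
      g.inner p' (v : TangentSpace (𝓡 n) p') (w : TangentSpace (𝓡 n) p') := by
  subst h; rfl

namespace HypersurfaceFoliation

variable {n : ℕ} {M : Type*} [TopologicalSpace M] [ChartedSpace (Coord n) M]
  [IsManifold (𝓡 n) ∞ M] {g : SemiRiemannianMetric n M} {u : ∀ p : M, TangentSpace (𝓡 n) p}
  (F : HypersurfaceFoliation g u) {l : F.Index}
  {e : OpenPartialHomeomorph M (Coord n)}
  {c : OpenPartialHomeomorph (F.Leaf l) (Coord (n - 1))}

section

variable (he : e ∈ IsManifold.maximalAtlas (𝓡 n) ∞ M)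
  (hc : c ∈ IsManifold.maximalAtlas (𝓡 (n - 1)) ∞ (F.Leaf l))
  {y : Coord (n - 1)} (hy : y ∈ F.localDomain e c)
include he hc hy

theorem mfderiv_incl_coordVec (A : Fin (n - 1)) :
    (mfderiv (𝓡 (n - 1)) (𝓡 n) (F.incl l) (c.symm y) (coordVec c y A) : Coord n) =
      ∑ i, jac (F.localIncl e c) y i A • (coordVec e (F.localIncl e c y) i : Coord n) := by
  have h := F.mfderiv_incl_sum he hc hy (Pi.single A 1)
  have h2 : ∑ B, (Pi.single A 1 : Fin (n - 1) → ℝ) B • coordVec c y B = coordVec c y A := by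
    rw [Finset.sum_eq_single A]
    · simp
    · intro B _ hB; simp [hB]
    · simp
  rw [h2] at h
  simpa using h

omit he hc in
theorem inner_u_mfderiv (ε : ℝ) (α : Fin n → ℝ) :
    g.inner (F.incl l (c.symm y)) (u (F.incl l (c.symm y)))
      (∑ i, α i • (coordVec e (F.localIncl e c y) i : Coord n) : Coord n) =
    ∑ i, (localData g u ε e).u (F.localIncl e c y) i * α i := by
  have hp := F.symm_localIncl hy
  have h := sum_inner_coordVec (e := e) (x := F.localIncl e c y) g α
    (u (e.symm (F.localIncl e c y)))
  have h2 : g.inner (F.incl l (c.symm y)) (u (F.incl l (c.symm y)))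
      (∑ i, α i • (coordVec e (F.localIncl e c y) i : Coord n) : Coord n) =
      g.inner (e.symm (F.localIncl e c y)) (u (e.symm (F.localIncl e c y)))
        (∑ i, α i • coordVec e (F.localIncl e c y) i) := by
    have hu : (u (F.incl l (c.symm y)) : Coord n) = u (e.symm (F.localIncl e c y)) := by rw [hp]
    exact (g.inner_congr hp.symm _ _).trans (by rw [hu]; rfl)
  rw [h2, h]
  exact Finset.sum_congr rfl fun i _ => mul_comm _ _

end

/-- The bridge from the foliation to coordinates: the tangency condition supplies `orth` and `span`,
and immersivity supplies `inj`. -/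
theorem isLeafChart (he : e ∈ IsManifold.maximalAtlas (𝓡 n) ∞ M)
    (hc : c ∈ IsManifold.maximalAtlas (𝓡 (n - 1)) ∞ (F.Leaf l)) (ε : ℝ) :
    IsLeafChart (localData g u ε e) e.target (F.localIncl e c) (F.leafMetric c)
      (F.localDomain e c) where
  isOpen := F.isOpen_localDomain
  smooth y hy i := contDiffAt_euclidean.1 (F.contDiffAt_localIncl he hc hy) i
  mapsTo y hy := e.map_source hy.2
  metric y hy := by
    ext A B
    have hp := F.symm_localIncl hy
    have h1 : gMat (F.leafMetric c) y A B =
        g.inner (e.symm (F.localIncl e c y))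
          (∑ i, jac (F.localIncl e c) y i A • coordVec e (F.localIncl e c y) i)
          (∑ i, jac (F.localIncl e c) y i B • coordVec e (F.localIncl e c y) i) := by
      refine Eq.trans ?_ (g.inner_congr hp.symm _ _)
      rw [← F.mfderiv_incl_coordVec he hc hy, ← F.mfderiv_incl_coordVec he hc hy]
      rfl
    rw [h1, transpose_mul_mul_apply, sum_inner_coordVec]
    refine Eq.trans ?_ (pl_comm _ _ B A
      (fun j i => gMat (localData g u ε e).g (F.localIncl e c y) i j))
    refine Finset.sum_congr rfl fun j _ => ?_
    congr 1
    rw [g.symm, sum_inner_coordVec]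
    refine Finset.sum_congr rfl fun i _ => ?_
    congr 1
    exact g.symm _ _ _
  orth y hy := by
    ext _ A
    have h := (congrArg (fun v : Coord n => g.inner (F.incl l (c.symm y))
      (u (F.incl l (c.symm y))) v) (F.mfderiv_incl_coordVec he hc hy A)).trans
      (F.inner_u_mfderiv hy ε (fun i => jac (F.localIncl e c) y i A))
    exact h.symm.trans ((F.tangent l (c.symm y) _).1 ⟨_, rfl⟩)
  span y hy v hv := by
    rw [← F.inner_u_mfderiv hy ε v] at hv
    obtain ⟨w, hw⟩ := (F.tangent l (c.symm y) _).2 hv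
    obtain ⟨α, rfl⟩ := exists_eq_sum_coordVec hc hy.1 w
    refine ⟨α, ?_⟩
    have h1 : (∑ i, (jac (F.localIncl e c) y).mulVec α i •
        coordVec e (F.localIncl e c y) i : Coord n) =
        ∑ i, v i • (coordVec e (F.localIncl e c y) i : Coord n) :=
      (F.mfderiv_incl_sum he hc hy α).symm.trans hw
    exact (eq_of_sum_coordVec_eq he (e.map_source hy.2) _ _ h1).symm
  inj y hy α hα := by
    have h1 := F.mfderiv_incl_sum he hc hy α
    rw [hα] at h1
    simp only [Pi.zero_apply, zero_smul, Finset.sum_const_zero] at h1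
    exact eq_zero_of_sum_coordVec hc hy.1 α
      (F.immersive l (c.symm y) (h1.trans (map_zero _).symm))

include F in
/-- The second fundamental form of a foliation is symmetric at every point. -/
theorem K_symm {ε : ℝ} (he : e ∈ IsManifold.maximalAtlas (𝓡 n) ∞ M)
    (hL : (localData g u ε e).IsUnitNormal e.target) {x : Coord n} (hx : x ∈ e.target)
    (a b : Fin n) : (localData g u ε e).K x a b = (localData g u ε e).K x b a := by
  -- The leaf is chosen afresh for each point, which spreads the symmetry from single leaves to the
  -- whole chart.
  obtain ⟨l, ⟨q, hq⟩, -⟩ := F.partition (e.symm x)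
  set c := chartAt (Coord (n - 1)) q
  have hc : c ∈ IsManifold.maximalAtlas (𝓡 (n - 1)) ∞ (F.Leaf l) :=
    IsManifold.chart_mem_maximalAtlas q
  have hcq : c.symm (c q) = q := c.left_inv (mem_chart_source _ q)
  have hy : c q ∈ F.localDomain e c :=
    ⟨c.map_source (mem_chart_source _ q), by
      simp only [Set.mem_preimage, hcq, hq]; exact e.map_target hx⟩
  have h := IsLeafChart.K_symm hL (F.isLeafChart he hc ε) hy a b
  have hφ : F.localIncl e c (c q) = x := by
    rw [localIncl, hcq, hq, e.right_inv hx]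
  rwa [hφ] at h

theorem leafCurvature_eq (ε : ℝ) (q : F.Leaf l) (hq : q ∈ c.source) :
    F.leafCurvature e c q =
      IsLeafChart.leafCurv (localData g u ε e) (F.localIncl e c) (F.leafMetric c) (c q) := by
  have hx : F.localIncl e c (c q) = e (F.incl l q) := by rw [localIncl, c.left_inv hq]
  have hθ : F.theta e c q = IsLeafChart.thetaMat (localData g u ε e) (F.localIncl e c)
      (F.leafMetric c) (c q) := by
    funext A i
    simp only [theta, IsLeafChart.thetaMat, hx, Matrix.mul_apply, Finset.mul_sum]
    refine Finset.sum_congr rfl fun B _ => Finset.sum_congr rfl fun j _ => ?_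
    rw [mul_assoc]
    rfl
  simp only [leafCurvature, IsLeafChart.leafCurv, LeafCurvature.mk.injEq, true_and]
  refine ⟨?_, ?_, ?_⟩
  · funext i j k m
    simp only [ext4, lift4, pl, hθ, Finset.mul_sum, mul_assoc]
  · funext i j
    simp only [ext2, lift2, pl, hθ, Finset.mul_sum, mul_assoc]
  · funext i j k m
    simp only [ext4, lift4, pl, hθ, Finset.mul_sum, mul_assoc]

end HypersurfaceFoliation

end FoliationGCR

end

open FoliationGCR in
theorem mainTheorem4 {n : ℕ} (hn : 3 ≤ n) {M : Type*} [TopologicalSpace M]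
    [ChartedSpace (Coord n) M] [IsManifold (𝓡 n) ∞ M]
    (g : SemiRiemannianMetric n M)
    (u : ∀ p : M, TangentSpace (𝓡 n) p)
    (hu : ContMDiff (𝓡 n) (𝓡 n).tangent ∞ (fun p => (⟨p, u p⟩ : TangentBundle (𝓡 n) M)))
    (ε : ℝ) (hε : ε = 1 ∨ ε = -1) (hunit : ∀ p, g.inner p (u p) (u p) = ε)
    (F : HypersurfaceFoliation g u) (l : F.Index) (q : F.Leaf l)
    (e : OpenPartialHomeomorph M (Coord n)) (he : e ∈ IsManifold.maximalAtlas (𝓡 n) ∞ M)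
    (hp : F.incl l q ∈ e.source)
    (c : OpenPartialHomeomorph (F.Leaf l) (Coord (n - 1)))
    (hc : c ∈ IsManifold.maximalAtlas (𝓡 (n - 1)) ∞ (F.Leaf l)) (hq : q ∈ c.source) :
    let L : LocalData n := localData g u ε e
    let S : LeafCurvature n := F.leafCurvature e c q
    let x : Coord n := e (F.incl l q)
    let R : Tensor4 n := riem L.g x
    (GaussIdentity L S x R ∧ CodazziIdentity L x R ∧ RicciIdentity L x R) ∧
    ((4 ≤ n → GaussDecomposed L S x R) ∧ CodazziDecomposed L x R ∧ RicciDecomposed L x R) ∧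
    (∀ T : Tensor4 n, IsRiemannType T →
      (4 ≤ n → (GaussIdentity L S x T ↔ GaussDecomposed L S x T)) ∧
      (CodazziIdentity L x T ↔ CodazziDecomposed L x T) ∧
      (RicciIdentity L x T ↔ RicciDecomposed L x T)) := by
  have hL := isUnitNormal_localData he g hu hε hunit
  have hcq := c.left_inv hq
  have hy : c q ∈ F.localDomain e c :=
    ⟨c.map_source hq, by simp only [Set.mem_preimage, hcq]; exact hp⟩
  have h := coordinate_theorem hn hL (F.isLeafChart he hc ε) hy
    (fun x hx a b => F.K_symm he hL hx a b)
  have hx : F.localIncl e c (c q) = e (F.incl l q) := by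
    rw [HypersurfaceFoliation.localIncl, hcq]
  rw [← F.leafCurvature_eq ε q hq, hx] at h
  exact h
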